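/- Let $(\overline M,J,\overline g)$ be a locally conformal Kähler (l.c.K.) manifold of real dimension $2n$: an almost Hermitian manifold such that every point has an open neighbourhood $U$ and a smooth function $f_U$ on $U$ for which $\exp(-f_U)\,\overline g|_U$ is Kähler. Let $\omega$ be its Lee form, i.e. the (closed, global) 1-form with $\omega|_U=df_U$ for such local functions, and let $\theta=\omega\circ J$ be the anti-Lee form. Let $M$ be a CR-submanifold of $\overline M$: an (immersed) submanifold, with induced metric $g$, equipped with a differentiable distribution $D\subset TM$ such that $JD_p=D_p$ for every $p\in M$ and such that the orthogonal complement $D^\perp$ of $D$ in $TM$ satisfies $JD^\perp_p\subset T_p^\perp M$ for every $p\in M$. Let $h$ be the second fundamental form of $M$ in $(\overline M,\overline g)$, given by $\overline\nabla_XY=\nabla_XY+h(X,Y)$ with the Levi-Civita connections $\overline\nabla$, $\nabla$ of $\overline g$, $g$, and let $h_{JD^\perp}$ be its component in $JD^\perp$ for the orthogonal decomposition $T^\perp M=JD^\perp\oplus\mu$ of the normal bundle. Let $\mathfrak F^\perp$ be the totally real foliation of $M$, whose leaves are the maximal connected integral manifolds of $D^\perp$. Then $\mathfrak F^\perp$ is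 a totally geodesic foliation, i.e. each of its leaves is a totally geodesic submanifold of $(M,g)$, if and only if $$\theta(Y)\,JX=2\,h_{JD^\perp}(X,Y)\qquad\text{for all } X\in D^\perp_p,\ Y\in D_p,\ p\in M.$$ -/

import Mathlib

open scoped Manifold ContDiff Topology
open Bundle

noncomputable section

namespace LCK

universe u

section Metric

variable {E : Type*} [NormedAddCommGroup E] [NormedSpace ℝ E]
  {M : Type*} [TopologicalSpace M] [ChartedSpace E M]

/-- A field of bilinear forms on the tangent spaces of `M`; the metrics below (a given Riemannian
metric, a conformal change of it, an induced metric) are all handled in this form. -/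
abbrev BilinField (E : Type*) [NormedAddCommGroup E] [NormedSpace ℝ E]
    (M : Type*) [TopologicalSpace M] [ChartedSpace E M] :=
  ∀ x : M, LinearMap.BilinForm ℝ (TangentSpace 𝓘(ℝ, E) x)

/-- The field of bilinear forms underlying a smooth Riemannian metric. -/
def ofMetric [IsManifold 𝓘(ℝ, E) ∞ M]
    (g : ContMDiffRiemannianMetric 𝓘(ℝ, E) ∞ E (fun x : M => TangentSpace 𝓘(ℝ, E) x)) :
    BilinField E M := fun x =>
  LinearMap.mk₂ ℝ (fun v w => g.inner x v w) (by simp) (by simp) (by simp) (by simp)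

/-- The conformal metric `exp (-φ) g`. -/
def conformal (φ : M → ℝ) (g : BilinField E M) : BilinField E M :=
  fun x => Real.exp (-φ x) • g x

variable [IsManifold 𝓘(ℝ, E) ∞ M]

/-- The operator `cov`, with `cov Y x v` standing for `(∇_v Y)(x)`, is on the set `s` a
Levi-Civita connection of `g`: a linear connection that is torsion free and metric. -/
structure IsLeviCivitaOn (g : BilinField E M)
    (cov : (Π x : M, TangentSpace 𝓘(ℝ, E) x) →
      (Π x : M, TangentSpace 𝓘(ℝ, E) x →L[ℝ] TangentSpace 𝓘(ℝ, E) x))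
    (s : Set M) : Prop where
  isCovariantDerivativeOn : IsCovariantDerivativeOn E cov s
  torsion_free : ∀ x ∈ s, ∀ X Y : Π x : M, TangentSpace 𝓘(ℝ, E) x,
    MDiffAt (T% X) x → MDiffAt (T% Y) x →
      cov Y x (X x) - cov X x (Y x) = VectorField.mlieBracket 𝓘(ℝ, E) X Y x
  metric : ∀ x ∈ s, ∀ Y Z : Π x : M, TangentSpace 𝓘(ℝ, E) x,
    MDiffAt (T% Y) x → MDiffAt (T% Z) x → ∀ v : TangentSpace 𝓘(ℝ, E) x,
      mvfderiv 𝓘(ℝ, E) (fun y => g y (Y y) (Z y)) x v =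
        g x (cov Y x v) (Z x) + g x (Y x) (cov Z x v)

/-- The Levi-Civita connection of a Riemannian metric `g`; `leviCivita g Y x v` is `(∇_v Y)(x)`.
The defining properties determine its value whenever `Y` is differentiable at `x`. -/
def leviCivita (g : BilinField E M) :
    (Π x : M, TangentSpace 𝓘(ℝ, E) x) →
      (Π x : M, TangentSpace 𝓘(ℝ, E) x →L[ℝ] TangentSpace 𝓘(ℝ, E) x) :=
  Classical.epsilon fun cov => IsLeviCivitaOn g cov Set.univ

/-- `b`-orthogonal projection of `v` to the subspace `S`, for an inner product `b`: the vector of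
`S` whose difference from `v` is orthogonal to `S`. -/
def orthProj {V : Type*} [AddCommGroup V] [Module ℝ V] (b : LinearMap.BilinForm ℝ V)
    (S : Submodule ℝ V) (v : V) : V :=
  Classical.epsilon fun w => w ∈ S ∧ ∀ s ∈ S, b s (v - w) = 0

/-- A distribution: a subspace of each tangent space. -/
abbrev Distribution (E : Type*) [NormedAddCommGroup E] [NormedSpace ℝ E]
    (M : Type*) [TopologicalSpace M] [ChartedSpace E M] :=
  ∀ x : M, Submodule ℝ (TangentSpace 𝓘(ℝ, E) x)

/-- The distribution is differentiable: near every point it has a smooth frame. -/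
def IsSmoothDistribution (D : Distribution E M) : Prop :=
  ∀ p : M, ∃ U : Set M, IsOpen U ∧ p ∈ U ∧
    ∃ (r : ℕ) (X : Fin r → Π x : M, TangentSpace 𝓘(ℝ, E) x),
      (∀ i, CMDiff[U] ∞ (T% (X i))) ∧
      ∀ x ∈ U, LinearIndependent ℝ (fun i => X i x) ∧
        Submodule.span ℝ (Set.range fun i => X i x) = D x

/-- The complementary orthogonal distribution `D^⊥` in the tangent bundle. -/
def orthDistribution (g : BilinField E M) (D : Distribution E M) : Distribution E M :=
  fun x => (D x).orthogonalBilin (g x)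

end Metric

section Immersion

variable {E : Type*} [NormedAddCommGroup E] [NormedSpace ℝ E]
  {M : Type*} [TopologicalSpace M] [ChartedSpace E M]
  {F : Type*} [NormedAddCommGroup F] [NormedSpace ℝ F]
  {N : Type*} [TopologicalSpace N] [ChartedSpace F N]

/-- A smooth immersion. -/
structure IsSmoothImmersion (f : M → N) : Prop where
  contMDiff : ContMDiff 𝓘(ℝ, E) 𝓘(ℝ, F) ∞ f
  injective_mfderiv : ∀ p, Function.Injective (mfderiv 𝓘(ℝ, E) 𝓘(ℝ, F) f p)

/-- The differential of `f` at `p`, as a linear map. -/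
def dmap (E F : Type*) [NormedAddCommGroup E] [NormedSpace ℝ E]
    [NormedAddCommGroup F] [NormedSpace ℝ F]
    {M : Type*} [TopologicalSpace M] [ChartedSpace E M]
    {N : Type*} [TopologicalSpace N] [ChartedSpace F N] (f : M → N) (p : M) :
    TangentSpace 𝓘(ℝ, E) p →ₗ[ℝ] TangentSpace 𝓘(ℝ, F) (f p) :=
  (mfderiv 𝓘(ℝ, E) 𝓘(ℝ, F) f p).toLinearMap

/-- The metric induced on `M` by `f : M → N` from the metric `g` of `N`. -/
def inducedMetric (g : BilinField F N) (f : M → N) : BilinField E M :=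
  fun p => (g (f p)).compl₁₂ (dmap E F f p) (dmap E F f p)

/-- The normal space of the immersion `f` at `p`. -/
def normalSpace (E : Type*) [NormedAddCommGroup E] [NormedSpace ℝ E]
    {M : Type*} [TopologicalSpace M] [ChartedSpace E M]
    (g : BilinField F N) (f : M → N) (p : M) : Submodule ℝ (TangentSpace 𝓘(ℝ, F) (f p)) :=
  (LinearMap.range (dmap E F f p)).orthogonalBilin (g (f p))

variable [IsManifold 𝓘(ℝ, F) ∞ N]

/-- The Levi-Civita connection of `N` on vector fields `V` along `f : M → N`: the value at `p` of
`∇_v V`. In the trivialization of `TN` given by the chart at `f p`, the field `V` is a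
combination `∑ Vⁱ (eᵢ ∘ f)` of the coordinate fields `eᵢ`, and
`∇_v V = ∑ v(Vⁱ) eᵢ + ∑ Vⁱ(p) ∇_{df v} eᵢ`; the field `FiberBundle.extend F (V p)` is
`∑ Vⁱ(p) eᵢ` near `f p`. -/
def covAlong (g : BilinField F N) (f : M → N) (V : Π q : M, TangentSpace 𝓘(ℝ, F) (f q))
    (p : M) (v : TangentSpace 𝓘(ℝ, E) p) : TangentSpace 𝓘(ℝ, F) (f p) :=
  (trivializationAt F (TangentSpace 𝓘(ℝ, F)) (f p)).symm (f p)
      (mvfderiv 𝓘(ℝ, E)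
        (fun q => (trivializationAt F (TangentSpace 𝓘(ℝ, F)) (f p) ⟨f q, V q⟩).2) p v) +
    leviCivita g (FiberBundle.extend F (V p)) (f p) (dmap E F f p v)

variable [IsManifold 𝓘(ℝ, E) ∞ M]

/-- The second fundamental form of the immersion `f : M → N`: `h(v, w)` is the normal component
of `∇_v (df W)` for a vector field `W` with `W(p) = w`. -/
def secondFundamentalForm (g : BilinField F N) (f : M → N) (p : M)
    (v w : TangentSpace 𝓘(ℝ, E) p) : TangentSpace 𝓘(ℝ, F) (f p) :=
  orthProj (g (f p)) (normalSpace E g f p)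
    (covAlong g f (fun q => dmap E F f q (FiberBundle.extend E w q)) p v)

/-- The immersed submanifold `f : M → N` is totally geodesic: its second fundamental form is
zero. -/
def IsTotallyGeodesic (g : BilinField F N) (f : M → N) : Prop :=
  ∀ (p : M) (v w : TangentSpace 𝓘(ℝ, E) p), secondFundamentalForm g f p v w = 0

end Immersion

section Foliation

variable {E : Type*} [NormedAddCommGroup E] [NormedSpace ℝ E]
  {M : Type u} [TopologicalSpace M] [ChartedSpace E M]

/-- An integral manifold of `D`: an injectively immersed manifold with tangent spaces `D`. -/
structure IsIntegralManifold (D : Distribution E M) (k : ℕ)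
    {L : Type*} [TopologicalSpace L] [ChartedSpace (EuclideanSpace ℝ (Fin k)) L]
    (ι : L → M) : Prop where
  isSmoothImmersion : IsSmoothImmersion (E := EuclideanSpace ℝ (Fin k)) (F := E) ι
  injective : Function.Injective ι
  tangent : ∀ q, LinearMap.range (dmap (EuclideanSpace ℝ (Fin k)) E ι q) = D (ι q)

/-- A leaf of the foliation defined by `D`: a maximal connected integral manifold. -/
structure IsLeaf (D : Distribution E M) (k : ℕ)
    {L : Type u} [TopologicalSpace L] [ChartedSpace (EuclideanSpace ℝ (Fin k)) L]
    (ι : L → M) : Prop where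
  isIntegralManifold : IsIntegralManifold D k ι
  connected : ConnectedSpace L
  maximal : ∀ (L' : Type u) [TopologicalSpace L'] [ChartedSpace (EuclideanSpace ℝ (Fin k)) L']
    [IsManifold (𝓡 k) ∞ L'] [ConnectedSpace L'] (ι' : L' → M), IsIntegralManifold D k ι' →
    (Set.range ι ∩ Set.range ι').Nonempty → Set.range ι' ⊆ Set.range ι

/-- The foliation of `M` by the leaves of the (integrable) distribution `D` is totally geodesic
for the metric `g`: each leaf is a totally geodesic submanifold of `M`. -/
def IsTotallyGeodesicFoliation [IsManifold 𝓘(ℝ, E) ∞ M] (g : BilinField E M)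
    (D : Distribution E M) : Prop :=
  ∀ (k : ℕ) (L : Type u) [TopologicalSpace L] [ChartedSpace (EuclideanSpace ℝ (Fin k)) L]
    [IsManifold (𝓡 k) ∞ L] (ι : L → M), IsLeaf D k ι →
    IsTotallyGeodesic (E := EuclideanSpace ℝ (Fin k)) g ι

end Foliation

section Hermitian

variable {F : Type*} [NormedAddCommGroup F] [NormedSpace ℝ F]
  {N : Type*} [TopologicalSpace N] [ChartedSpace F N] [IsManifold 𝓘(ℝ, F) ∞ N]

/-- `(N, J, g)` is an almost Hermitian manifold. -/
structure IsAlmostHermitian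
    (J : Π x : N, TangentSpace 𝓘(ℝ, F) x →L[ℝ] TangentSpace 𝓘(ℝ, F) x)
    (g : BilinField F N) : Prop where
  contMDiff : ContMDiff 𝓘(ℝ, F) (𝓘(ℝ, F).prod 𝓘(ℝ, F →L[ℝ] F)) ∞
    (fun x => TotalSpace.mk' (F →L[ℝ] F)
      (E := fun x : N => TangentSpace 𝓘(ℝ, F) x →L[ℝ] TangentSpace 𝓘(ℝ, F) x) x (J x))
  sq : ∀ x v, J x (J x v) = -v
  hermitian : ∀ x v w, g x (J x v) (J x w) = g x v w

/-- On the open set `U` the almost Hermitian metric `g` is Kähler: `J` is parallel for the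
Levi-Civita connection of `g` on `U`, that is, `∇_v (J Y) = J (∇_v Y)`. -/
def IsKaehlerOn (J : Π x : N, TangentSpace 𝓘(ℝ, F) x →L[ℝ] TangentSpace 𝓘(ℝ, F) x)
    (g : BilinField F N) (U : Set N) : Prop :=
  ∃ cov, IsLeviCivitaOn g cov U ∧
    ∀ x ∈ U, ∀ Y : Π x : N, TangentSpace 𝓘(ℝ, F) x, MDiffAt (T% Y) x →
      ∀ v : TangentSpace 𝓘(ℝ, F) x, cov (fun y => J y (Y y)) x v = J x (cov Y x v)

/-- The almost Hermitian manifold `(N, J, g)` is locally conformal Kähler with Lee form `lee`: every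
point has an open neighbourhood `U` with a smooth function `φ` on `U` such that `exp (-φ) g` is
Kähler on `U`, and the differentials `dφ` of these local functions glue to the 1-form `lee`. -/
def IsLCKWithLeeForm (J : Π x : N, TangentSpace 𝓘(ℝ, F) x →L[ℝ] TangentSpace 𝓘(ℝ, F) x)
    (g : BilinField F N) (lee : Π x : N, TangentSpace 𝓘(ℝ, F) x →L[ℝ] ℝ) : Prop :=
  ∀ p : N, ∃ U : Set N, IsOpen U ∧ p ∈ U ∧ ∃ φ : N → ℝ,
    CMDiff[U] ∞ φ ∧ IsKaehlerOn J (conformal φ g) U ∧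
      ∀ x ∈ U, lee x = mvfderiv 𝓘(ℝ, F) φ x

/-- The anti-Lee form `θ = lee ∘ J`. -/
def antiLee (J : Π x : N, TangentSpace 𝓘(ℝ, F) x →L[ℝ] TangentSpace 𝓘(ℝ, F) x)
    (lee : Π x : N, TangentSpace 𝓘(ℝ, F) x →L[ℝ] ℝ) : Π x : N, TangentSpace 𝓘(ℝ, F) x →L[ℝ] ℝ :=
  fun x => (lee x).comp (J x)

variable {E : Type*} [NormedAddCommGroup E] [NormedSpace ℝ E]
  {M : Type*} [TopologicalSpace M] [ChartedSpace E M] [IsManifold 𝓘(ℝ, E) ∞ M]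

/-- The subspace `J (df (S))` of `T_{f p} N` for a subspace `S` of `T_p M`. -/
def mapJ (J : Π x : N, TangentSpace 𝓘(ℝ, F) x →L[ℝ] TangentSpace 𝓘(ℝ, F) x) (f : M → N) (p : M)
    (S : Submodule ℝ (TangentSpace 𝓘(ℝ, E) p)) : Submodule ℝ (TangentSpace 𝓘(ℝ, F) (f p)) :=
  (S.map (dmap E F f p)).map (J (f p)).toLinearMap

/-- The immersed submanifold `f : M → N` of `(N, J, g)` is a CR-submanifold with holomorphic
distribution `D` and totally real distribution `D^⊥`. -/
structure IsCRSubmanifold (J : Π x : N, TangentSpace 𝓘(ℝ, F) x →L[ℝ] TangentSpace 𝓘(ℝ, F) x)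
    (g : BilinField F N) (f : M → N) (D : Distribution E M) : Prop where
  isSmoothImmersion : IsSmoothImmersion (E := E) (F := F) f
  smooth : IsSmoothDistribution D
  holomorphic : ∀ p, mapJ J f p (D p) = (D p).map (dmap E F f p)
  totally_real : ∀ p,
    mapJ J f p (orthDistribution (inducedMetric g f) D p) ≤ normalSpace E g f p

end Hermitian

end LCK

end

/-!
The proof compares the second fundamental form of a leaf in `M` with that of `M` in `N`, and shows
that there is a leaf through every point.

Both the Levi-Civita connection and the connection along a map are computed in charts, through their
Christoffel symbols. A metric conformal to `g` has explicit Christoffel symbols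
(`IsChristoffelAt.of_conformal`), so that the Kähler condition for the local metrics `exp (-φ) g`
gives the formula for the derivative of `J` with respect to the connection of `g`, in terms of the
Lee form (`IsLCKWithLeeForm.covAlong_J`, with the tensor `leeDefect`).

Let `v`, `w` be tangent to an integral manifold of `D^⊥`, extend `w` to a tangent field `W`, and
let `Y` be a section of `D`. As `JY` is a section of `D`, the function `g(JY, W)` vanishes along
the integral manifold. Its derivative in the direction `v`, with the formula for the derivative of
`J`, gives `g(∇_v W, JY) = g(h(v, Y), Jw) - θ(Y) g(v, w) / 2`
(`IsCRSubmanifold.inducedMetric_covAlong_leaf`). The vectors `JY` fill `D`, which is the normal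
space of the integral manifold in `M`, and the vectors `Jw` fill `JD^⊥`. Hence the second
fundamental form of the integral manifold vanishes at a point if and only if
`θ(Y) Jv = 2 h_{JD^⊥}(v, Y)` there (`IsCRSubmanifold.secondFundamentalForm_eq_zero_iff`,
`IsAlmostHermitian.smul_eq_orthProj_iff`).

This proves that the equation makes all leaves totally geodesic. The converse needs a leaf through
every point of `M`. The distribution `D^⊥` is the kernel of the restriction to `M` of the
fundamental form `g(·, J ·)` (`IsCRSubmanifold.mem_orthDistribution_iff`), or equally of the
fundamental form of the local Kähler metric `exp (-φ) g`, which is closed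
(`exists_closed_twoForm`). The kernel of a closed 2-form of constant nullity is integrable: in a
chart its integral manifolds are the solutions of a total differential equation `Dψ = S ∘ ψ`, whose
integrability condition follows from closedness (`fderiv_frame_symm`) and which is solved by
integrating along rays (`exists_total_differential_solution`, `exists_plaque`). The plaques so
obtained are the charts of a finer topology on `M`, whose connected components are the leaves
(`exists_isLeaf`).
-/

noncomputable section

namespace LCK

set_option synthInstance.maxHeartbeats 200000

/-! ### Total differential equations -/

section FlatFrobenius

open scoped NNReal
open Set Metric ContinuousLinearMap

lemma _root_.LipschitzOnWith.exists_norm_le_closedBall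
    {E F : Type*} [NormedAddCommGroup E] [NormedAddCommGroup F]
    {f : E → F} {q₀ : E} {a κ : ℝ≥0} (hf : LipschitzOnWith κ f (closedBall q₀ a)) :
    ∃ C : ℝ≥0, ∀ q ∈ closedBall q₀ (a : ℝ), ‖f q‖ ≤ C := by
  refine ⟨κ * a + ‖f q₀‖₊, fun q hq => ?_⟩
  have h1 := hf.norm_sub_le hq (mem_closedBall_self a.2)
  have h2 : ‖q - q₀‖ ≤ a := by simpa [dist_eq_norm] using hq
  calc ‖f q‖ = ‖(f q - f q₀) + f q₀‖ := by simp
    _ ≤ ‖f q - f q₀‖ + ‖f q₀‖ := norm_add_le _ _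
    _ ≤ κ * a + ‖f q₀‖ := by gcongr; exact h1.trans (by gcongr)

section Frobenius
variable {E K : Type*} [NormedAddCommGroup E] [NormedSpace ℝ E]
  [NormedAddCommGroup K] [NormedSpace ℝ K]

/-- Picard-Lindelöf on `[0, 1]`, with the bound on the distance to the initial point. -/
lemma exists_ode_solution_unit_interval [CompleteSpace E] {v : E → E} {q₀ : E} {a C : ℝ≥0} {κ : ℝ≥0}
    (hb : ∀ q ∈ closedBall q₀ a, ‖v q‖ ≤ C) (hl : LipschitzOnWith κ v (closedBall q₀ a))
    (hC : C ≤ a) :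
    ∃ w : ℝ → E, w 0 = q₀ ∧ (∀ t ∈ Icc (0 : ℝ) 1, HasDerivWithinAt w (v (w t)) (Icc 0 1) t) ∧
      ∀ t ∈ Icc (0 : ℝ) 1, w t ∈ closedBall q₀ a := by
  have hf : IsPicardLindelof (fun _ : ℝ => v) (tmin := 0) (tmax := 1) ⟨0, by simp⟩ q₀ a 0 C κ :=
    IsPicardLindelof.of_time_independent hb hl (by simpa using hC)
  obtain ⟨α, hα⟩ := ODE.FunSpace.exists_isFixedPt_next hf (x := q₀) (mem_closedBall_self le_rfl)
  refine ⟨α.compProj, ?_, ?_, fun t _ => α.compProj_mem_closedBall hf.mul_max_le⟩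
  · have := α.compProj_val (t := ⟨0, by simp⟩)
    simp only at this
    rw [this, ← hα, ODE.FunSpace.next_apply₀]
  · intro t ht
    apply ODE.hasDerivWithinAt_picard_Icc (f := fun _ : ℝ => v) (t₀ := 0) (by simp)
      hf.continuousOn_uncurry
      α.continuous_compProj.continuousOn (fun _ ht' ↦ α.compProj_mem_closedBall hf.mul_max_le)
      q₀ ht |>.congr_of_mem _ ht
    intro t' ht'
    nth_rw 1 [← hα]
    rw [ODE.FunSpace.compProj_of_mem ht', ODE.FunSpace.next_apply]

/-- Second-order Taylor bound. -/
lemma norm_sub_sub_fderiv_le {F : Type*} [NormedAddCommGroup F] [NormedSpace ℝ F]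
    {S : E → F} {s : Set E} (hs : Convex ℝ s) {κ : ℝ≥0}
    (hd : ∀ q ∈ s, DifferentiableAt ℝ S q) (hl : LipschitzOnWith κ (fderiv ℝ S) s)
    {q q' : E} (hq : q ∈ s) (hq' : q' ∈ s) :
    ‖S q' - S q - fderiv ℝ S q (q' - q)‖ ≤ κ * ‖q' - q‖ ^ 2 := by
  have hseg : segment ℝ q q' ⊆ s := hs.segment_subset hq hq'
  have := (convex_segment q q').norm_image_sub_le_of_norm_hasFDerivWithin_le' (f := S)
    (f' := fderiv ℝ S) (φ := fderiv ℝ S q) (C := κ * ‖q' - q‖)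
    (fun z hz => (hd z (hseg hz)).hasFDerivAt.hasFDerivWithinAt) (fun z hz => ?_)
    (left_mem_segment ℝ q q') (right_mem_segment ℝ q q')
  · calc _ ≤ _ := this
      _ = _ := by ring
  · refine (hl.norm_sub_le (hseg hz) hq).trans ?_
    gcongr
    rw [norm_sub_rev z q, norm_sub_rev q' q, ← dist_eq_norm, ← dist_eq_norm]
    have h := dist_add_dist_of_mem_segment hz
    have := dist_nonneg (x := z) (y := q')
    linarith

set_option synthInstance.maxHeartbeats 200000 in
/-- The total differential equation `Dψ = S ∘ ψ` has a solution through every point at which `S` is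
smooth, if the integrability condition holds. The solution `ψ x` is the value at time one of the
integral curve of `q ↦ S q x`; that `Dψ = S ∘ ψ` follows from Grönwall's inequality, by which
`w x t + t • S (w x t) h` is close to the integral curve `w (x + h) t`. -/
theorem exists_total_differential_solution [CompleteSpace E] {S : E → K →L[ℝ] E} {q₀ : E}
    (hS : ContDiffAt ℝ 2 S q₀)
    (hint : ∀ᶠ q in 𝓝 q₀, ∀ a b, fderiv ℝ S q (S q a) b = fderiv ℝ S q (S q b) a) :
    ∀ W ∈ 𝓝 q₀, ∀ x₀ : K, ∃ r > 0, ∃ ψ : K → E, ψ x₀ = q₀ ∧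
      ∀ x ∈ ball x₀ r, ψ x ∈ W ∧ HasFDerivAt ψ (S (ψ x)) x := by
  intro W hW x₀
  -- a ball around `q₀` with uniform bounds for `S` and its derivative
  obtain ⟨κ, s, hs, hl⟩ := (hS.of_le one_le_two).exists_lipschitzOnWith
  obtain ⟨κ₂, s₂, hs₂, hl₂⟩ :=
    (hS.fderiv_right (m := 1) (by norm_num)).exists_lipschitzOnWith
  have hdiff : ∀ᶠ q in 𝓝 q₀, DifferentiableAt ℝ S q :=
    (hS.eventually (by simp)).mono fun q hq => hq.differentiableAt (by simp)
  obtain ⟨a, ha, hball⟩ := Metric.nhds_basis_closedBall.mem_iff.1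
    (Filter.inter_mem (Filter.inter_mem hs hs₂) (Filter.inter_mem hW (hdiff.and hint)))
  lift a to ℝ≥0 using ha.le
  have haa : (0 : ℝ) < a := ha
  set B := closedBall q₀ (a : ℝ) with hB
  have hBc : Convex ℝ B := convex_closedBall _ _
  have hlB : LipschitzOnWith κ S B := hl.mono fun q hq => (hball hq).1.1
  have hl₂B : LipschitzOnWith κ₂ (fderiv ℝ S) B := hl₂.mono fun q hq => (hball hq).1.2
  have hq₀ : q₀ ∈ B := mem_closedBall_self haa.le
  obtain ⟨C, hC⟩ := hlB.exists_norm_le_closedBall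
  obtain ⟨C', hC'⟩ :=
    LipschitzOnWith.exists_norm_le_closedBall (F := E →L[ℝ] K →L[ℝ] E) hl₂B
  -- on the ball of radius `r`, the integral curves of `S · x` exist up to time one
  obtain ⟨r, hr, hr1, hCr⟩ : ∃ r : ℝ≥0, 0 < r ∧ r ≤ 1 ∧ C * (2 * r) ≤ a / 2 := by
    have ha' : 0 < a := ha
    refine ⟨min 1 (a / (4 * (C + 1))), by positivity, min_le_left _ _, ?_⟩
    calc C * (2 * min 1 (a / (4 * (C + 1)))) ≤ (C + 1) * (2 * (a / (4 * (C + 1)))) := by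
          gcongr
          · simp
          · exact min_le_right _ _
      _ = a / 2 := by field_simp; ring
  have hhalf : closedBall q₀ ((a / 2 : ℝ≥0) : ℝ) ⊆ B := closedBall_subset_closedBall (by simp)
  have hw : ∀ x : K, ∃ w : ℝ → E, ‖x‖ ≤ r → w 0 = q₀ ∧
      (∀ t ∈ Icc (0 : ℝ) 1, HasDerivWithinAt w (S (w t) x) (Icc 0 1) t) ∧
      ∀ t ∈ Icc (0 : ℝ) 1, w t ∈ closedBall q₀ ((a / 2 : ℝ≥0) : ℝ) := by
    intro x
    by_cases hx : ‖x‖ ≤ r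
    · have h1 : ∀ q ∈ closedBall q₀ ((a / 2 : ℝ≥0) : ℝ), ‖S q x‖ ≤ (C * r : ℝ≥0) := fun q hq =>
        (le_opNorm _ _).trans
          (mul_le_mul (hC q (hhalf hq)) hx (norm_nonneg _) C.2)
      have h2 : LipschitzOnWith (κ * ‖x‖₊) (fun q => S q x)
          (closedBall q₀ ((a / 2 : ℝ≥0) : ℝ)) := by
        refine LipschitzOnWith.of_dist_le_mul fun q hq q' hq' => ?_
        rw [dist_eq_norm, ← sub_apply]
        refine (le_opNorm _ _).trans ?_
        have := hlB.dist_le_mul q (hhalf hq) q' (hhalf hq')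
        rw [dist_eq_norm] at this
        calc _ ≤ (κ * dist q q') * ‖x‖ := by gcongr
          _ = _ := by push_cast; ring
      have h3 : C * r ≤ a / 2 := le_trans (by gcongr; linarith) hCr
      obtain ⟨w, h⟩ := exists_ode_solution_unit_interval h1 h2 h3
      exact ⟨w, fun _ => h⟩
    · exact ⟨0, fun h => (hx h).elim⟩
  choose w hw using hw
  have hder : ∀ x : K, ‖x‖ ≤ r → ∀ t ∈ Ico (0 : ℝ) 1,
      HasDerivWithinAt (w x) (S (w x t) x) (Ici t) t := fun x hx t ht =>
    ((hw x hx).2.1 t (Ico_subset_Icc_self ht)).mono_of_mem_nhdsWithin (Icc_mem_nhdsGE_of_mem ht)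
  have hcont : ∀ x : K, ‖x‖ ≤ r → ContinuousOn (w x) (Icc 0 1) := fun x hx t ht =>
    ((hw x hx).2.1 t ht).continuousWithinAt
  have hmem : ∀ x : K, ‖x‖ ≤ r → ∀ t ∈ Icc (0 : ℝ) 1, w x t ∈ B := fun x hx t ht =>
    hhalf ((hw x hx).2.2 t ht)
  set ε : ℝ := C' * C + κ₂ * C ^ 2 with hε
  -- `ε * ‖h‖ ^ 2` bounds the error with which the approximation solves the equation
  have key : ∀ x h : K, ‖x‖ ≤ r → ‖x + h‖ ≤ r →
      ‖w (x + h) 1 - w x 1 - S (w x 1) h‖ ≤ gronwallBound 0 (κ * r) (ε * ‖h‖ ^ 2) 1 := by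
    intro x h hx hxh
    have hh : ‖h‖ ≤ 2 * r := by
      calc ‖h‖ = ‖(x + h) - x‖ := by simp
        _ ≤ ‖x + h‖ + ‖x‖ := norm_sub_le _ _
        _ ≤ 2 * r := by linarith
    -- the first-order approximation of the trajectory of `S · (x + h)`
    set z : ℝ → E := fun t => w x t + t • S (w x t) h with hz
    have hSh : ∀ t ∈ Icc (0 : ℝ) 1, ‖t • S (w x t) h‖ ≤ C * ‖h‖ := by
      intro t ht
      rw [norm_smul, Real.norm_of_nonneg ht.1]
      calc t * ‖S (w x t) h‖ ≤ 1 * (C * ‖h‖) := by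
            gcongr
            · exact ht.2
            · exact (le_opNorm _ _).trans (by gcongr; exact hC _ (hmem x hx t ht))
        _ = _ := one_mul _
    have hzB : ∀ t ∈ Icc (0 : ℝ) 1, z t ∈ B := by
      intro t ht
      have h1 := (hw x hx).2.2 t ht
      have h2 := hSh t ht
      have h3 : (C : ℝ) * ‖h‖ ≤ a / 2 :=
        le_trans (by gcongr) (show (C : ℝ) * (2 * r) ≤ a / 2 by exact_mod_cast hCr)
      rw [hB, mem_closedBall_iff_norm]
      rw [mem_closedBall_iff_norm] at h1
      push_cast at h1
      calc ‖z t - q₀‖ = ‖(w x t - q₀) + t • S (w x t) h‖ := by rw [hz]; congr 1; simp only; abel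
        _ ≤ ‖w x t - q₀‖ + ‖t • S (w x t) h‖ := norm_add_le _ _
        _ ≤ a := by linarith
    have hSd : ∀ t ∈ Icc (0 : ℝ) 1, HasFDerivAt S (fderiv ℝ S (w x t)) (w x t) := fun t ht =>
      ((hball (hmem x hx t ht)).2.2.1).hasFDerivAt
    have hzd : ∀ t ∈ Ico (0 : ℝ) 1, HasDerivWithinAt z
        (S (w x t) x + (t • fderiv ℝ S (w x t) (S (w x t) x) h + (1 : ℝ) • S (w x t) h))
        (Ici t) t := by
      intro t ht
      have h1 := (hSd t (Ico_subset_Icc_self ht)).comp_hasDerivWithinAt t (hder x hx t ht)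
      have h2 := h1.clm_apply (hasDerivWithinAt_const t (Ici t) h)
      simp only [map_zero, add_zero] at h2
      exact (hder x hx t ht).add ((hasDerivWithinAt_id t (Ici t)).smul h2)
    have hzc : ContinuousOn z (Icc 0 1) := by
      have h1 : ContinuousOn (fun t => S (w x t)) (Icc 0 1) := fun t ht =>
        (hSd t ht).continuousAt.comp_continuousWithinAt (hcont x hx t ht)
      exact (hcont x hx).add (continuousOn_id.smul (h1.clm_apply continuousOn_const))
    have hzapprox : ∀ t ∈ Ico (0 : ℝ) 1,
        dist (S (w x t) x + (t • fderiv ℝ S (w x t) (S (w x t) x) h + (1 : ℝ) • S (w x t) h))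
          (S (z t) (x + h)) ≤ ε * ‖h‖ ^ 2 := by
      intro t ht
      have ht' := Ico_subset_Icc_self ht
      have hsym : fderiv ℝ S (w x t) (S (w x t) x) h = fderiv ℝ S (w x t) (S (w x t) h) x :=
        (hball (hmem x hx t ht')).2.2.2 x h
      have hT := norm_sub_sub_fderiv_le hBc (fun q hq => (hball hq).2.2.1) hl₂B
        (hmem x hx t ht') (hzB t ht')
      have hzw : z t - w x t = t • S (w x t) h := by simp [hz]
      rw [hzw] at hT
      set R := S (z t) - S (w x t) - fderiv ℝ S (w x t) (t • S (w x t) h) with hR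
      have e : S (z t) = S (w x t) + fderiv ℝ S (w x t) (t • S (w x t) h) + R := by
        rw [hR]; abel
      have e2 : S (w x t) x + (t • fderiv ℝ S (w x t) (S (w x t) x) h + (1 : ℝ) • S (w x t) h)
          - S (z t) (x + h) =
          -(fderiv ℝ S (w x t) (t • S (w x t) h) h) - R (x + h) := by
        rw [e, hsym]
        simp only [map_add, map_smul, add_apply, smul_apply]
        module
      rw [dist_eq_norm, e2]
      have h1 : ‖fderiv ℝ S (w x t) (t • S (w x t) h) h‖ ≤ C' * (C * ‖h‖) * ‖h‖ :=
        (le_opNorm _ _).trans (by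
          gcongr
          exact (le_opNorm _ _).trans (by
            gcongr
            · exact hC' _ (hmem x hx t ht')
            · exact hSh t ht'))
      have h2 : ‖R (x + h)‖ ≤ κ₂ * (C * ‖h‖) ^ 2 * 1 :=
        (le_opNorm _ _).trans (by
          gcongr
          · exact hT.trans (by gcongr; exact hSh t ht')
          · exact hxh.trans (by exact_mod_cast hr1))
      calc _ ≤ ‖-(fderiv ℝ S (w x t) (t • S (w x t) h) h)‖ + ‖R (x + h)‖ := norm_sub_le _ _
        _ ≤ C' * (C * ‖h‖) * ‖h‖ + κ₂ * (C * ‖h‖) ^ 2 * 1 := by rw [norm_neg]; gcongr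
        _ = ε * ‖h‖ ^ 2 := by rw [hε]; ring
    have hlip : ∀ t ∈ Ico (0 : ℝ) 1,
        LipschitzOnWith (κ * r) (fun q => S q (x + h)) B := fun t _ => by
      refine LipschitzOnWith.of_dist_le_mul fun q hq q' hq' => ?_
      rw [dist_eq_norm, ← sub_apply]
      refine (le_opNorm _ _).trans ?_
      have := hlB.dist_le_mul q hq q' hq'
      rw [dist_eq_norm] at this
      calc _ ≤ (κ * dist q q') * r := by gcongr
        _ = _ := by push_cast; ring
    have := dist_le_of_approx_trajectories_ODE_of_mem (v := fun _ q => S q (x + h))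
      (s := fun _ => B) (δ := 0) (εf := 0) hlip (hcont _ hxh) (hder _ hxh)
      (fun t _ => by simp) (fun t ht => hmem _ hxh t (Ico_subset_Icc_self ht))
      hzc hzd hzapprox (fun t ht => hzB t (Ico_subset_Icc_self ht))
      (by simp [hz, (hw x hx).1, (hw (x + h) hxh).1]) 1 (by simp)
    rw [dist_eq_norm] at this
    simpa [hz, sub_sub] using this
  have hlin : ∀ c : ℝ, gronwallBound 0 (κ * r) (ε * c) 1 = gronwallBound 0 (κ * r) ε 1 * c := by
    intro c
    unfold gronwallBound
    split_ifs <;> ring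
  have hfd : ∀ x : K, ‖x‖ < r → HasFDerivAt (fun y => w y 1) (S (w x 1)) x := by
    intro x hx
    rw [hasFDerivAt_iff_isLittleO_nhds_zero]
    refine Asymptotics.IsBigO.trans_isLittleO (g := fun h : K => ‖h‖ ^ 2) ?_
      (Asymptotics.isLittleO_norm_pow_id one_lt_two)
    refine Asymptotics.IsBigO.of_bound (gronwallBound 0 (κ * r) ε 1) ?_
    have : ∀ᶠ h : K in 𝓝 0, ‖x + h‖ < r :=
      (Continuous.tendsto (by fun_prop : Continuous fun h : K => ‖x + h‖) 0).eventually_lt_const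
        (by simpa using hx)
    filter_upwards [this] with h hh
    rw [← hlin]
    simpa using key x h hx.le hh.le
  have hw0 : w 0 1 = q₀ := by
    have h0 : ‖(0 : K)‖ ≤ r := by simp
    rw [constant_of_has_deriv_right_zero (hcont 0 h0)
      (fun t ht => by simpa using hder 0 h0 t ht) 1 (by simp), (hw 0 h0).1]
  refine ⟨r, hr, fun x => w (x - x₀) 1, by simpa using hw0, fun x hx => ?_⟩
  have hx' : ‖x - x₀‖ < r := by simpa [dist_eq_norm] using hx
  refine ⟨(hball (hmem _ hx'.le 1 (by simp))).2.1, ?_⟩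
  have := (hfd _ hx').comp x ((hasFDerivAt_id x).sub_const x₀)
  rwa [ContinuousLinearMap.comp_id] at this

/-- Solutions of `Dψ = S ∘ ψ` are as smooth as `S`. -/
lemma contDiffOn_of_total_differential {S : E → K →L[ℝ] E} {W : Set E} {V : Set K} {ψ : K → E}
    (hS : ContDiffOn ℝ ∞ S W) (hV : IsOpen V) (hψW : MapsTo ψ V W)
    (hψ : ∀ x ∈ V, HasFDerivAt ψ (S (ψ x)) x) : ContDiffOn ℝ ∞ ψ V := by
  rw [contDiffOn_infty]
  intro n
  induction n with
  | zero =>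
    rw [Nat.cast_zero, contDiffOn_zero]
    exact fun x hx => (hψ x hx).continuousAt.continuousWithinAt
  | succ n ih =>
    rw [Nat.cast_succ, contDiffOn_succ_iff_fderiv_of_isOpen hV]
    refine ⟨fun x hx => (hψ x hx).differentiableAt.differentiableWithinAt, by simp, ?_⟩
    exact ((hS.of_le (by exact_mod_cast le_top)).comp ih hψW).congr fun x hx => (hψ x hx).fderiv

end Frobenius

/-! ### The Frobenius theorem for the kernel of a closed 2-form -/

/-- If `v ↦ (A q v, P v)` is invertible at `q₀`, the equations `A q v = 0`, `P v = a` are solved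
near `q₀` by a smooth family of linear maps. -/
lemma exists_contDiffAt_section {E K G : Type*} [NormedAddCommGroup E] [NormedSpace ℝ E]
    [CompleteSpace E] [NormedAddCommGroup K] [NormedSpace ℝ K] [NormedAddCommGroup G]
    [NormedSpace ℝ G] {A : E → E →L[ℝ] G} {q₀ : E} (hA : ∀ᶠ q in 𝓝 q₀, ContDiffAt ℝ ∞ A q)
    (P : E →L[ℝ] K) (e₀ : E ≃L[ℝ] G × K) (he₀ : (e₀ : E →L[ℝ] G × K) = (A q₀).prod P) :
    ∃ S : E → K →L[ℝ] E, ∀ᶠ q in 𝓝 q₀, ContDiffAt ℝ ∞ S q ∧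
      ∀ v a, v = S q a ↔ A q v = 0 ∧ P v = a := by
  set Φ : E → E →L[ℝ] G × K := fun q => (A q).prod P with hΦ
  have hΦs : ∀ᶠ q in 𝓝 q₀, ContDiffAt ℝ ∞ Φ q := by
    filter_upwards [hA] with q hq
    have : Φ = fun q => (inl ℝ G K) ∘L (A q) + (inr ℝ G K) ∘L P := by
      ext q v <;> simp [hΦ]
    rw [this]
    exact (contDiffAt_const.clm_comp hq).add contDiffAt_const
  refine ⟨fun q => (Φ q).inverse ∘L inr ℝ G K, ?_⟩
  have hev : ∀ᶠ q in 𝓝 q₀, Φ q ∈ range ((↑) : (E ≃L[ℝ] G × K) → E →L[ℝ] G × K) :=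
    hΦs.self_of_nhds.continuousAt.eventually_mem (by
      change _ ∈ 𝓝 ((A q₀).prod P); rw [← he₀]; exact e₀.nhds)
  filter_upwards [hev, hΦs] with q ⟨e, he⟩ hq
  refine ⟨?_, fun v a => ?_⟩
  · have h := contDiffAt_map_inverse (n := ∞) e
    rw [he] at h
    exact (h.comp q hq).clm_comp contDiffAt_const
  · rw [← he, ContinuousLinearMap.inverse_equiv, ContinuousLinearMap.comp_apply]
    simp only [ContinuousLinearEquiv.coe_coe, ContinuousLinearEquiv.eq_symm_apply]
    have : e v = (A q v, P v) := by
      rw [← ContinuousLinearEquiv.coe_coe, he]; rfl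
    rw [this, inr_apply, Prod.mk.injEq]

/-- The kernel of a closed 2-form is involutive: a frame `S` of it, normalized by `P ∘ S = id`,
satisfies the integrability condition of the equation `Dψ = S ∘ ψ`. -/
lemma fderiv_frame_symm {E K : Type*} [NormedAddCommGroup E] [NormedSpace ℝ E]
    [NormedAddCommGroup K] [NormedSpace ℝ K] {Ω : E → E →L[ℝ] E →L[ℝ] ℝ} {q : E}
    {S : E → K →L[ℝ] E} {P : E →L[ℝ] K}
    (hΩ : DifferentiableAt ℝ Ω q) (hS : DifferentiableAt ℝ S q)
    (hskew : ∀ᶠ y in 𝓝 q, ∀ a b, Ω y a b = -Ω y b a)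
    (hclosed : ∀ a b c, fderiv ℝ Ω q a b c + fderiv ℝ Ω q b c a + fderiv ℝ Ω q c a b = 0)
    (hPS : ∀ᶠ y in 𝓝 q, ∀ a, P (S y a) = a)
    (hker : ∀ᶠ y in 𝓝 q, ∀ v, Ω y v = 0 ↔ v = S y (P v)) (a b : K) :
    fderiv ℝ S q (S q a) b = fderiv ℝ S q (S q b) a := by
  have hΩS : ∀ᶠ y in 𝓝 q, ∀ a, Ω y (S y a) = 0 := by
    filter_upwards [hPS, hker] with y h1 h2 a
    rw [h2, h1]
  have hsk : ∀ u v w, fderiv ℝ Ω q u v w = -fderiv ℝ Ω q u w v := by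
    intro u v w
    have h1 := (hΩ.hasFDerivAt.clm_apply (hasFDerivAt_const v q)).clm_apply (hasFDerivAt_const w q)
    have h2 := ((hΩ.hasFDerivAt.clm_apply (hasFDerivAt_const w q)).clm_apply
      (hasFDerivAt_const v q)).neg
    have h3 := h1.unique (h2.congr_of_eventuallyEq (hskew.mono fun y hy => hy v w))
    simpa using congr($h3 u)
  have hPd : ∀ u b, P (fderiv ℝ S q u b) = 0 := by
    intro u b
    have h1 := P.hasFDerivAt.comp q (hS.hasFDerivAt.clm_apply (hasFDerivAt_const b q))
    have h3 := h1.unique ((hasFDerivAt_const b q).congr_of_eventuallyEq (hPS.mono fun y hy => hy b))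
    simpa using congr($h3 u)
  have hΩd : ∀ u b c, fderiv ℝ Ω q u (S q b) c + Ω q (fderiv ℝ S q u b) c = 0 := by
    intro u b c
    have h1 := (hΩ.hasFDerivAt.clm_apply (hS.hasFDerivAt.clm_apply
      (hasFDerivAt_const b q))).clm_apply (hasFDerivAt_const c q)
    have h3 := h1.unique ((hasFDerivAt_const (0 : ℝ) q).congr_of_eventuallyEq
      (hΩS.mono fun y hy => by simp [hy b]))
    simpa [add_comm] using congr($h3 u)
  have h0 : Ω q (fderiv ℝ S q (S q a) b - fderiv ℝ S q (S q b) a) = 0 := by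
    ext c
    have e1 := hΩd (S q a) b c
    have e2 := hΩd (S q b) a c
    have e3 := hclosed c (S q a) (S q b)
    have e4 := hΩd c a (S q b)
    have e5 := hskew.self_of_nhds (fderiv ℝ S q c a) (S q b)
    have e6 : Ω q (S q b) (fderiv ℝ S q c a) = 0 := by rw [hΩS.self_of_nhds]; rfl
    have e7 := hsk (S q b) (S q a) c
    have e8 := hsk (S q a) (S q b) c
    simp only [map_sub, sub_apply, zero_apply]
    linarith
  have := (hker.self_of_nhds _).1 h0
  rw [map_sub, hPd, hPd, sub_zero, map_zero] at this
  exact sub_eq_zero.1 this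

section KernelDistribution
variable {E K : Type*} [NormedAddCommGroup E] [NormedSpace ℝ E] [FiniteDimensional ℝ E]
  [NormedAddCommGroup K] [NormedSpace ℝ K] [FiniteDimensional ℝ K]

/-- The kernel of a smooth field of alternating forms of constant nullity has a smooth frame `S`,
normalized by a fixed projection `P`; here `j` parametrizes a complement of the kernel at `q₀`. -/
lemma exists_frame_of_ker_of_isCompl {C : Type*} [NormedAddCommGroup C] [NormedSpace ℝ C]
    [FiniteDimensional ℝ C] {Ω : E → E →L[ℝ] E →L[ℝ] ℝ} {q₀ : E}
    (hΩ : ∀ᶠ q in 𝓝 q₀, ContDiffAt ℝ ∞ Ω q)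
    (hskew : ∀ᶠ q in 𝓝 q₀, ∀ a b, Ω q a b = -Ω q b a)
    (hk : ∀ᶠ q in 𝓝 q₀, Module.finrank ℝ (LinearMap.ker (Ω q).toLinearMap) = Module.finrank ℝ K)
    (j : C →L[ℝ] E) (hj : Function.Injective j)
    (hC : IsCompl (LinearMap.ker (Ω q₀).toLinearMap) (LinearMap.range j.toLinearMap)) :
    ∃ (P : E →L[ℝ] K) (S : E → K →L[ℝ] E), ∀ᶠ q in 𝓝 q₀, ContDiffAt ℝ ∞ S q ∧
      (∀ a, P (S q a) = a) ∧ ∀ v, Ω q v = 0 ↔ v = S q (P v) := by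
  have e : LinearMap.ker (Ω q₀).toLinearMap ≃ₗ[ℝ] K := LinearEquiv.ofFinrankEq _ K hk.self_of_nhds
  obtain ⟨P, hP⟩ : ∃ P : E →L[ℝ] K, ∀ v, P v = 0 → v ∈ LinearMap.range j.toLinearMap :=
    ⟨LinearMap.toContinuousLinearMap (e.toLinearMap ∘ₗ Submodule.projectionOnto _ _ hC),
      fun v hv => by simpa using hv⟩
  set R : (E →L[ℝ] ℝ) →L[ℝ] (C →L[ℝ] ℝ) := (ContinuousLinearMap.compL ℝ C E ℝ).flip j
  set A : E → E →L[ℝ] (C →L[ℝ] ℝ) := fun q => R ∘L Ω q with hA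
  have hA1 : ∀ q v (c : C), A q v c = Ω q v (j c) := fun q v c => rfl
  have hAs : ∀ᶠ q in 𝓝 q₀, ContDiffAt ℝ ∞ A q := hΩ.mono fun q hq => contDiffAt_const.clm_comp hq
  have hinj : Function.Injective ((A q₀).prod P) := by
    rw [injective_iff_map_eq_zero]
    intro v hv
    have h2 := hP v (congrArg Prod.snd hv)
    have h3 : v ∈ LinearMap.ker (Ω q₀).toLinearMap := by
      rw [LinearMap.mem_ker]
      ext w
      obtain ⟨n, hn, _, ⟨c, rfl⟩, rfl⟩ := Submodule.mem_sup.1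
        (hC.sup_eq_top ▸ Submodule.mem_top : w ∈ LinearMap.ker (Ω q₀).toLinearMap ⊔ _)
      have hn' : Ω q₀ n = 0 := hn
      have hc' : Ω q₀ v (j c) = 0 := by
        rw [← hA1 q₀ v c, show A q₀ v = 0 from congrArg Prod.fst hv]; rfl
      simp [hskew.self_of_nhds v n, hn', hc']
    exact (Submodule.disjoint_def.1 hC.disjoint) v h3 h2
  have hdim : Module.finrank ℝ E = Module.finrank ℝ ((C →L[ℝ] ℝ) × K) := by
    rw [Module.finrank_prod, ← hk.self_of_nhds, ← Submodule.finrank_add_eq_of_isCompl hC, add_comm]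
    congr 1
    rw [← (LinearMap.toContinuousLinearMap (𝕜 := ℝ) (E := C) (F' := ℝ)).finrank_eq,
      LinearMap.finrank_range_of_inj (f := j.toLinearMap) hj]
    exact (Subspace.dual_finrank_eq).symm
  obtain ⟨S, hS⟩ := exists_contDiffAt_section hAs P
    (LinearEquiv.ofInjectiveOfFinrankEq ((A q₀).prod P).toLinearMap hinj
      hdim).toContinuousLinearEquiv
    (by ext v <;> rfl)
  refine ⟨P, S, ?_⟩
  filter_upwards [hS, hk] with q ⟨hSs, hSq⟩ hkq
  have hPS : ∀ a, P (S q a) = a := fun a => ((hSq (S q a) a).1 rfl).2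
  have hker : ∀ v, Ω q v = 0 → v = S q (P v) := fun v hv =>
    (hSq v (P v)).2 ⟨by rw [hA, ContinuousLinearMap.comp_apply, hv, map_zero], rfl⟩
  -- the nullspace lies in the range of `S q`, and has the same dimension
  have hle : LinearMap.ker (Ω q).toLinearMap ≤ LinearMap.range (S q).toLinearMap :=
    fun v hv => ⟨P v, (hker v hv).symm⟩
  have hSi : Function.Injective (S q).toLinearMap := Function.LeftInverse.injective hPS
  have heq := Submodule.eq_of_le_of_finrank_eq hle
    (by rw [hkq, LinearMap.finrank_range_of_inj hSi])
  refine ⟨hSs, hPS, fun v => ⟨hker v, fun hv => ?_⟩⟩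
  have : v ∈ LinearMap.ker (Ω q).toLinearMap := heq ▸ ⟨P v, hv.symm⟩
  exact this

lemma exists_frame_of_ker {Ω : E → E →L[ℝ] E →L[ℝ] ℝ} {q₀ : E}
    (hΩ : ∀ᶠ q in 𝓝 q₀, ContDiffAt ℝ ∞ Ω q)
    (hskew : ∀ᶠ q in 𝓝 q₀, ∀ a b, Ω q a b = -Ω q b a)
    (hk : ∀ᶠ q in 𝓝 q₀, Module.finrank ℝ (LinearMap.ker (Ω q).toLinearMap) = Module.finrank ℝ K) :
    ∃ (P : E →L[ℝ] K) (S : E → K →L[ℝ] E), ∀ᶠ q in 𝓝 q₀, ContDiffAt ℝ ∞ S q ∧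
      (∀ a, P (S q a) = a) ∧ ∀ v, Ω q v = 0 ↔ v = S q (P v) := by
  obtain ⟨C, hC⟩ := (LinearMap.ker (Ω q₀).toLinearMap).exists_isCompl
  refine exists_frame_of_ker_of_isCompl hΩ hskew hk C.subtypeL Subtype.val_injective ?_
  rwa [Submodule.toLinearMap_subtypeL, Submodule.range_subtype]

/-- **Frobenius theorem** for the kernel of a closed 2-form `Ω` of constant nullity. Near `q₀` the
integral manifold through `q₀` is parametrized by `ψ` on a ball, with inverse the linear map `P`,
and an integral curve that starts on it and stays in `W` (with `P`-image in the ball) remains on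
it. -/
theorem exists_plaque {Ω : E → E →L[ℝ] E →L[ℝ] ℝ} {q₀ : E}
    (hΩ : ∀ᶠ q in 𝓝 q₀, ContDiffAt ℝ ∞ Ω q)
    (hskew : ∀ᶠ q in 𝓝 q₀, ∀ a b, Ω q a b = -Ω q b a)
    (hclosed : ∀ᶠ q in 𝓝 q₀, ∀ a b c,
      fderiv ℝ Ω q a b c + fderiv ℝ Ω q b c a + fderiv ℝ Ω q c a b = 0)
    (hk : ∀ᶠ q in 𝓝 q₀, Module.finrank ℝ (LinearMap.ker (Ω q).toLinearMap) = Module.finrank ℝ K)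
    {O : Set E} (hO : O ∈ 𝓝 q₀) :
    ∃ (P : E →L[ℝ] K) (r : ℝ) (ψ : K → E) (W : Set E), 0 < r ∧ IsOpen W ∧ q₀ ∈ W ∧ W ⊆ O ∧
      ψ (P q₀) = q₀ ∧ ContDiffOn ℝ ∞ ψ (ball (P q₀) r) ∧ MapsTo ψ (ball (P q₀) r) W ∧
      (∀ x ∈ ball (P q₀) r, P (ψ x) = x) ∧
      (∀ x ∈ ball (P q₀) r, ∀ v, Ω (ψ x) v = 0 ↔ v ∈ LinearMap.range (fderiv ℝ ψ x).toLinearMap) ∧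
      ∀ γ γ' : ℝ → E, ContinuousOn γ' (Icc 0 1) →
        (∀ t ∈ Icc (0 : ℝ) 1, HasDerivWithinAt γ (γ' t) (Icc 0 1) t ∧ γ t ∈ W ∧
          Ω (γ t) (γ' t) = 0 ∧ P (γ t) ∈ ball (P q₀) r) →
        γ 0 = ψ (P (γ 0)) → γ 1 = ψ (P (γ 1)) := by
  obtain ⟨P, S, hS⟩ := exists_frame_of_ker (K := K) hΩ hskew hk
  have hPS : ∀ᶠ q in 𝓝 q₀, (∀ a, P (S q a) = a) ∧ ∀ v, Ω q v = 0 ↔ v = S q (P v) :=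
    hS.mono fun q hq => hq.2
  have hint : ∀ᶠ q in 𝓝 q₀, ∀ a b, fderiv ℝ S q (S q a) b = fderiv ℝ S q (S q b) a := by
    filter_upwards [hΩ, hS, hskew.eventually_nhds, hclosed, hPS.eventually_nhds]
      with q h0 h1 h2 h3 h4
    exact fderiv_frame_symm (h0.differentiableAt (by simp)) (h1.1.differentiableAt (by simp)) h2 h3
      (h4.mono fun y hy => hy.1) (h4.mono fun y hy => hy.2)
  have hS₀ : ContDiffAt ℝ ∞ S q₀ := hS.self_of_nhds.1
  obtain ⟨κ, s, hs, hl⟩ := (hS₀.of_le (m := 1) (by simp)).exists_lipschitzOnWith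
  obtain ⟨W, hWs, hWo, hqW⟩ := _root_.mem_nhds_iff.1
    (Filter.inter_mem hs (Filter.inter_mem hO hS))
  obtain ⟨r, hr, ψ, hψ0, hψ⟩ := exists_total_differential_solution
    (hS₀.of_le (WithTop.coe_le_coe.2 le_top)) hint W (hWo.mem_nhds hqW) (P q₀)
  have hPψ : ∀ x ∈ ball (P q₀) r, P (ψ x) = x := by
    intro x hx
    have h1 : ∀ y ∈ ball (P q₀) r, HasFDerivWithinAt (fun y => P (ψ y) - y)
        (0 : K →L[ℝ] K) (ball (P q₀) r) y := by
      intro y hy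
      have h2 := (P.hasFDerivAt.comp y (hψ y hy).2).sub (hasFDerivAt_id y)
      have h3 : P ∘L S (ψ y) - ContinuousLinearMap.id ℝ K = 0 := by
        ext a
        simp [(hWs (hψ y hy).1).2.2.2.1 a]
      rw [h3] at h2
      exact h2.hasFDerivWithinAt
    have h4 := (convex_ball (P q₀) r).is_const_of_fderivWithin_eq_zero (𝕜 := ℝ)
      (fun y hy => (h1 y hy).differentiableWithinAt)
      (fun y hy => (h1 y hy).fderivWithin (isOpen_ball.uniqueDiffWithinAt hy)) (mem_ball_self hr) hx
    simp only [hψ0, sub_self] at h4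
    exact sub_eq_zero.1 h4.symm
  refine ⟨P, r, ψ, W, hr, hWo, hqW, fun q hq => (hWs hq).2.1, hψ0,
    contDiffOn_of_total_differential (fun q hq => (hWs hq).2.2.1.contDiffWithinAt) isOpen_ball
      (fun x hx => (hψ x hx).1) (fun x hx => (hψ x hx).2), fun x hx => (hψ x hx).1, hPψ, ?_, ?_⟩
  · intro x hx v
    rw [(hψ x hx).2.fderiv, (hWs (hψ x hx).1).2.2.2.2]
    refine ⟨fun h => ⟨_, h.symm⟩, ?_⟩
    rintro ⟨a, rfl⟩
    exact congrArg _ ((hWs (hψ x hx).1).2.2.2.1 a).symm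
  · intro γ γ' hγ' hγ h0
    obtain ⟨C, hC⟩ := isCompact_Icc.exists_bound_of_continuousOn
      (P.continuous.comp_continuousOn hγ')
    -- both `γ` and `ψ ∘ P ∘ γ` solve the equation `y' = S y (P (γ' t))`
    set δ : ℝ → E := fun t => ψ (P (γ t)) with hδ
    have hI : ∀ t ∈ Ico (0 : ℝ) 1, t ∈ Icc (0 : ℝ) 1 := fun t ht => Ico_subset_Icc_self ht
    have hPγ : ∀ t ∈ Icc (0 : ℝ) 1, HasDerivWithinAt (fun t => P (γ t)) (P (γ' t)) (Icc 0 1) t :=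
      fun t ht => P.hasFDerivAt.comp_hasDerivWithinAt t (hγ t ht).1
    have hδd : ∀ t ∈ Icc (0 : ℝ) 1, HasDerivWithinAt δ (S (δ t) (P (γ' t))) (Icc 0 1) t :=
      fun t ht => (hψ _ (hγ t ht).2.2.2).2.comp_hasDerivWithinAt t (hPγ t ht)
    have hγd : ∀ t ∈ Icc (0 : ℝ) 1, HasDerivWithinAt γ (S (γ t) (P (γ' t))) (Icc 0 1) t := by
      intro t ht
      rw [← ((hWs (hγ t ht).2.1).2.2.2.2 _).1 (hγ t ht).2.2.1]
      exact (hγ t ht).1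
    have hnhds : ∀ t ∈ Ico (0 : ℝ) 1, Icc (0 : ℝ) 1 ∈ 𝓝[Ici t] t := fun t ht =>
      Icc_mem_nhdsGE_of_mem ht
    refine ODE_solution_unique_of_mem_Icc_right (v := fun t q => S q (P (γ' t)))
      (K := κ * C.toNNReal) (s := fun _ => W) (a := 0) (b := 1) (fun t ht => ?_)
      (fun t ht => (hγd t ht).continuousWithinAt)
      (fun t ht => (hγd t (hI t ht)).mono_of_mem_nhdsWithin (hnhds t ht))
      (fun t ht => (hγ t (hI t ht)).2.1)
      (fun t ht => (hδd t ht).continuousWithinAt)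
      (fun t ht => (hδd t (hI t ht)).mono_of_mem_nhdsWithin (hnhds t ht))
      (fun t ht => (hψ _ (hγ t (hI t ht)).2.2.2).1) h0 (by simp)
    refine LipschitzOnWith.of_dist_le_mul fun q hq q' hq' => ?_
    rw [dist_eq_norm, ← sub_apply]
    refine (le_opNorm _ _).trans ?_
    have h1 := hl.dist_le_mul q (hWs hq).1 q' (hWs hq').1
    rw [dist_eq_norm] at h1
    have h2 : ‖P (γ' t)‖ ≤ C.toNNReal := (hC t (hI t ht)).trans (Real.le_coe_toNNReal C)
    calc _ ≤ (κ * dist q q') * C.toNNReal := by gcongr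
      _ = _ := by push_cast; ring

end KernelDistribution

end FlatFrobenius

/-! ### Tangent vectors and connections in coordinates -/

lemma chart_source_eventually {E M : Type*} [TopologicalSpace E] [TopologicalSpace M]
    [ChartedSpace E M] (x : M) : ∀ᶠ y in 𝓝 x, y ∈ (chartAt E x).source :=
  (chartAt E x).open_source.mem_nhds (mem_chart_source E x)

section Coordinates
variable {E : Type*} [NormedAddCommGroup E] [NormedSpace ℝ E]
  {M : Type*} [TopologicalSpace M] [ChartedSpace E M]
  {F : Type*} [NormedAddCommGroup F] [NormedSpace ℝ F]
  {N : Type*} [TopologicalSpace N] [ChartedSpace F N]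
  {G : Type*} [NormedAddCommGroup G] [NormedSpace ℝ G]
  {G' : Type*} [NormedAddCommGroup G'] [NormedSpace ℝ G']

lemma mdifferentiableAt_iff_chart {u : M → G} {p : M} :
    MDifferentiableAt 𝓘(ℝ, E) 𝓘(ℝ, G) u p ↔
      ContinuousAt u p ∧ DifferentiableAt ℝ (u ∘ (extChartAt 𝓘(ℝ, E) p).symm)
        (extChartAt 𝓘(ℝ, E) p p) := by
  rw [mdifferentiableAt_iff]
  simp only [mfld_simps, writtenInExtChartAt, differentiableWithinAt_univ]
  rfl

lemma mvfderiv_eq_fderiv {u : M → G} {p : M} (hu : MDifferentiableAt 𝓘(ℝ, E) 𝓘(ℝ, G) u p)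
    (v : TangentSpace 𝓘(ℝ, E) p) :
    mvfderiv 𝓘(ℝ, E) u p v = fderiv ℝ (u ∘ (extChartAt 𝓘(ℝ, E) p).symm)
        (extChartAt 𝓘(ℝ, E) p p) v := by
  rw [hu.mvfderiv]
  simp only [mfld_simps, writtenInExtChartAt, fderivWithin_univ]
  rfl

lemma mvfderiv_congr {u u' : M → G} {p : M} (h : u =ᶠ[𝓝 p] u') (v : TangentSpace 𝓘(ℝ, E) p) :
    mvfderiv 𝓘(ℝ, E) u p v = mvfderiv 𝓘(ℝ, E) u' p v := by
  unfold mvfderiv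
  have := h.mfderiv_eq (I := 𝓘(ℝ, E)) (I' := 𝓘(ℝ, G))
  exact congr($this v)

lemma mvfderiv_clm_apply {A : M → G →L[ℝ] G'} {u : M → G} {p : M}
    (hA : MDifferentiableAt 𝓘(ℝ, E) 𝓘(ℝ, G →L[ℝ] G') A p)
    (hu : MDifferentiableAt 𝓘(ℝ, E) 𝓘(ℝ, G) u p) (v : TangentSpace 𝓘(ℝ, E) p) :
    mvfderiv 𝓘(ℝ, E) (fun q => A q (u q)) p v =
      mvfderiv 𝓘(ℝ, E) A p v (u p) + A p (mvfderiv 𝓘(ℝ, E) u p v) := by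
  rw [mvfderiv_eq_fderiv (hA.clm_apply hu), mvfderiv_eq_fderiv hA, mvfderiv_eq_fderiv hu]
  have h1 := (mdifferentiableAt_iff_chart.1 hA).2.hasFDerivAt.clm_apply
    (mdifferentiableAt_iff_chart.1 hu).2.hasFDerivAt
  have h2 := congr($(h1.fderiv) v)
  simp only [Function.comp_apply, extChartAt_to_inv] at h2
  rw [add_comm]
  exact h2

lemma mvfderiv_comp_mfderiv {u : N → G} {f : M → N} {p : M}
    (hu : MDifferentiableAt 𝓘(ℝ, F) 𝓘(ℝ, G) u (f p))
    (hf : MDifferentiableAt 𝓘(ℝ, E) 𝓘(ℝ, F) f p) (v : TangentSpace 𝓘(ℝ, E) p) :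
    mvfderiv 𝓘(ℝ, E) (fun q => u (f q)) p v =
      mvfderiv 𝓘(ℝ, F) u (f p) (mfderiv 𝓘(ℝ, E) 𝓘(ℝ, F) f p v) :=
  mfderiv_comp_apply p hu hf v

/-- The coordinates of tangent vectors at `y` in the trivialization of the tangent bundle given by
the chart at `x`. -/
def tcoord (x y : M) : TangentSpace 𝓘(ℝ, E) y →L[ℝ] E :=
  fderivWithin ℝ (((chartAt E x).extend 𝓘(ℝ, E)) ∘ ((chartAt E y).extend 𝓘(ℝ, E)).symm)
    (Set.range 𝓘(ℝ, E)) ((chartAt E y).extend 𝓘(ℝ, E) y)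

lemma tcoord_self (x : M) (v : TangentSpace 𝓘(ℝ, E) x) : tcoord x x v = v := by
  have h : ((chartAt E x).extend 𝓘(ℝ, E)) ∘ ((chartAt E x).extend 𝓘(ℝ, E)).symm
      =ᶠ[𝓝 ((chartAt E x).extend 𝓘(ℝ, E) x)] id := by
    filter_upwards [extChartAt_target_mem_nhds (I := 𝓘(ℝ, E)) x] with z hz
    exact (extChartAt 𝓘(ℝ, E) x).right_inv hz
  have h3 : fderivWithin ℝ (((chartAt E x).extend 𝓘(ℝ, E)) ∘ ((chartAt E x).extend 𝓘(ℝ, E)).symm)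
      (Set.range 𝓘(ℝ, E)) ((chartAt E x).extend 𝓘(ℝ, E) x) = ContinuousLinearMap.id ℝ E := by
    rw [modelWithCornersSelf_coe, Set.range_id, fderivWithin_univ, h.fderiv_eq, fderiv_id]
  exact congr($h3 v)

variable [IsManifold 𝓘(ℝ, E) ∞ M] [IsManifold 𝓘(ℝ, F) ∞ N]

lemma trivializationAt_snd (x y : M) (v : TangentSpace 𝓘(ℝ, E) y) :
    (trivializationAt E (TangentSpace 𝓘(ℝ, E)) x ⟨y, v⟩).2 = tcoord x y v := by
  rw [TangentBundle.trivializationAt_apply]; rfl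

/-- The tangent vector at `x` with given coordinates in the chart at `x`. -/
def tvec (x : M) : E →L[ℝ] TangentSpace 𝓘(ℝ, E) x :=
  (trivializationAt E (TangentSpace 𝓘(ℝ, E)) x).symmL ℝ x

lemma trivializationAt_symm_self (x : M) (w : E) :
    (trivializationAt E (TangentSpace 𝓘(ℝ, E)) x).symm x w = tvec x w :=
  ((trivializationAt E (TangentSpace 𝓘(ℝ, E)) x).symmL_apply
    (FiberBundle.mem_baseSet_trivializationAt' x) w).symm

@[simp] lemma tcoord_tvec (x : M) (w : E) : tcoord x x (tvec x w) = w := by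
  rw [← trivializationAt_symm_self, ← trivializationAt_snd, Trivialization.apply_mk_symm]
  exact FiberBundle.mem_baseSet_trivializationAt' x

lemma mvfderiv_extChartAt {x y : M} (hy : y ∈ (chartAt E x).source) (v : TangentSpace 𝓘(ℝ, E) y) :
    mvfderiv 𝓘(ℝ, E) (extChartAt 𝓘(ℝ, E) x) y v = tcoord x y v := by
  have : MDifferentiableAt 𝓘(ℝ, E) 𝓘(ℝ, E) (extChartAt 𝓘(ℝ, E) x) y :=
    mdifferentiableAt_extChartAt hy
  rw [this.mvfderiv]
  rfl

lemma tcoord_injective {x y : M} (hy : y ∈ (chartAt E x).source) :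
    Function.Injective (tcoord (E := E) x y) := by
  intro v w h
  rw [← trivializationAt_snd, ← trivializationAt_snd] at h
  have hb : y ∈ (trivializationAt E (TangentSpace 𝓘(ℝ, E)) x).baseSet := by simpa using hy
  have := (trivializationAt E (TangentSpace 𝓘(ℝ, E)) x).symm_apply_apply_mk hb
  rw [← this v, ← this w, h]

lemma tcoord_extend {x y : M} (hy : y ∈ (chartAt E x).source) (w : TangentSpace 𝓘(ℝ, E) x) :
    tcoord x y (FiberBundle.extend E w y) = tcoord x x w := by
  rw [← trivializationAt_snd, ← trivializationAt_snd, FiberBundle.extend,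
    Trivialization.apply_mk_symm]
  simpa using hy

@[simp] lemma tvec_tcoord (x : M) (v : TangentSpace 𝓘(ℝ, E) x) : tvec x (tcoord x x v) = v :=
  tcoord_injective (mem_chart_source E x) (tcoord_tvec x _)

lemma mdifferentiableAt_field_iff {Y : Π x : M, TangentSpace 𝓘(ℝ, E) x} {x : M} :
    MDiffAt (T% Y) x ↔ MDifferentiableAt 𝓘(ℝ, E) 𝓘(ℝ, E) (fun y => tcoord x y (Y y)) x := by
  rw [mdifferentiableAt_section]
  simp only [trivializationAt_snd]

/-- The covariant derivative of a field in terms of its coordinates and of the covariant derivative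
of the coordinate fields. -/
lemma cov_eq_mvfderiv_add [FiniteDimensional ℝ E] {cov : (Π x : M, TangentSpace 𝓘(ℝ, E) x) →
      (Π x : M, TangentSpace 𝓘(ℝ, E) x →L[ℝ] TangentSpace 𝓘(ℝ, E) x)} {s : Set M}
    (hcov : IsCovariantDerivativeOn E cov s) {x : M} (hx : x ∈ s)
    {Y : Π x : M, TangentSpace 𝓘(ℝ, E) x} (hY : MDiffAt (T% Y) x) (v : TangentSpace 𝓘(ℝ, E) x) :
    cov Y x v = tvec x (mvfderiv 𝓘(ℝ, E) (fun y => tcoord x y (Y y)) x v) +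
      cov (FiberBundle.extend E (Y x)) x v := by
  set cov' : (Π x : M, TangentSpace 𝓘(ℝ, E) x) →
      (Π x : M, TangentSpace 𝓘(ℝ, E) x →L[ℝ] TangentSpace 𝓘(ℝ, E) x) := fun Z z =>
    (tvec z).comp (mvfderiv 𝓘(ℝ, E) (fun y => tcoord x y (Z y)) z)
    with hcov'
  have h' : IsCovariantDerivativeOn E cov' {x} := by
    constructor
    · rintro σ σ' y hσ hσ' rfl
      rw [mdifferentiableAt_field_iff] at hσ hσ'
      have := mvfderiv_add hσ hσ'
      simp only [hcov', Pi.add_apply, map_add]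
      rw [← ContinuousLinearMap.comp_add, ← this]
      rfl
    · rintro σ g y hσ hg rfl
      rw [mdifferentiableAt_field_iff] at hσ
      have := mvfderiv_smul hg hσ
      simp only [hcov', Pi.smul_apply', map_smul]
      refine (congrArg (fun A => (tvec y).comp A) this).trans ?_
      ext v
      simp
  have hc := hcov.mono (Set.singleton_subset_iff.2 hx)
  have h1 := IsCovariantDerivativeOn.difference_apply hc h' (Set.mem_singleton x) hY
  have h2 := IsCovariantDerivativeOn.difference_apply hc h' (Set.mem_singleton x)
    (FiberBundle.mdifferentiableAt_extend 𝓘(ℝ, E) E (Y x))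
  rw [FiberBundle.extend_apply_self, h1] at h2
  have h3 : cov' (FiberBundle.extend E (Y x)) x v = 0 := by
    have : (fun y => tcoord x y (FiberBundle.extend E (Y x) y)) =ᶠ[𝓝 x]
        fun _ => tcoord x x (Y x) :=
      (chart_source_eventually x).mono fun y hy => tcoord_extend hy _
    have h4 := mvfderiv_congr this v
    rw [mvfderiv_const] at h4
    simp only [hcov', ContinuousLinearMap.comp_apply, h4]
    simp
  have h5 := congr($h2 v)
  simp only [sub_apply, h3, sub_zero] at h5
  rw [← h5]
  exact (add_sub_cancel _ _).symm

/-- The Lie bracket in coordinates. -/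
lemma tcoord_mlieBracket [CompleteSpace E] {X Y : Π x : M, TangentSpace 𝓘(ℝ, E) x} {x : M}
    (hX : MDiffAt (T% X) x) (hY : MDiffAt (T% Y) x) :
    tcoord x x (VectorField.mlieBracket 𝓘(ℝ, E) X Y x) =
      mvfderiv 𝓘(ℝ, E) (fun y => tcoord x y (Y y)) x (X x) -
        mvfderiv 𝓘(ℝ, E) (fun y => tcoord x y (X y)) x (Y x) := by
  have key : ∀ Z : Π x : M, TangentSpace 𝓘(ℝ, E) x,
      VectorField.mpullbackWithin 𝓘(ℝ, E) 𝓘(ℝ, E) (extChartAt 𝓘(ℝ, E) x).symm Z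
        (Set.range 𝓘(ℝ, E)) =ᶠ[𝓝 (extChartAt 𝓘(ℝ, E) x x)]
        (fun y => tcoord x y (Z y)) ∘ (extChartAt 𝓘(ℝ, E) x).symm := by
    intro Z
    filter_upwards [extChartAt_target_mem_nhds (I := 𝓘(ℝ, E)) x] with z hz
    have h1 := mfderiv_extChartAt_comp_mfderivWithin_extChartAt_symm hz
    have h2 := mfderivWithin_extChartAt_symm_comp_mfderiv_extChartAt hz
    have hz' : (extChartAt 𝓘(ℝ, E) x).symm z ∈ (chartAt E x).source := by
      rw [← extChartAt_source 𝓘(ℝ, E)]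
      exact (extChartAt 𝓘(ℝ, E) x).map_target hz
    simp only [VectorField.mpullbackWithin, Function.comp_apply]
    rw [ContinuousLinearMap.inverse_eq h2 h1]
    exact mvfderiv_extChartAt hz' _
  have h0 : ∀ v, (mfderiv 𝓘(ℝ, E) 𝓘(ℝ, E) (extChartAt 𝓘(ℝ, E) x) x) v = tcoord x x v :=
    fun v => mvfderiv_extChartAt (mem_chart_source E x) v
  have hi : (mfderiv 𝓘(ℝ, E) 𝓘(ℝ, E) (extChartAt 𝓘(ℝ, E) x) x).inverse = tvec (E := E) x := by
    have h1 : ∀ w : E, tcoord x x (tvec x w) = w := tcoord_tvec x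
    have h2 : ∀ v : TangentSpace 𝓘(ℝ, E) x, tvec x (tcoord x x v) = v := tvec_tcoord x
    have h3 : mfderiv 𝓘(ℝ, E) 𝓘(ℝ, E) (extChartAt 𝓘(ℝ, E) x) x = tcoord x x :=
      ContinuousLinearMap.ext h0
    rw [h3]
    exact ContinuousLinearMap.inverse_eq (ContinuousLinearMap.ext h1) (ContinuousLinearMap.ext h2)
  rw [mdifferentiableAt_field_iff] at hX hY
  rw [VectorField.mlieBracket, VectorField.mlieBracketWithin_apply, hi]
  refine (tcoord_tvec x _).trans ?_
  rw [mvfderiv_eq_fderiv hX, mvfderiv_eq_fderiv hY, modelWithCornersSelf_coe, Set.range_id,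
    Set.preimage_univ, Set.univ_inter]
  have e1 : ∀ Z : Π x : M, TangentSpace 𝓘(ℝ, E) x,
      ((fun y => tcoord x y (Z y)) ∘ (extChartAt 𝓘(ℝ, E) x).symm)
        (extChartAt 𝓘(ℝ, E) x x) = Z x := by
    intro Z
    have e3 : ∀ y, y = x → tcoord x y (Z y) = Z x := by
      rintro y rfl; exact tcoord_self y _
    exact e3 _ (extChartAt_to_inv x)
  have kX := key X
  have kY := key Y
  rw [modelWithCornersSelf_coe, Set.range_id] at kX kY
  have e2 : ∀ (V W V' W' : E → E) (z : E), V =ᶠ[𝓝 z] V' → W =ᶠ[𝓝 z] W' →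
      VectorField.lieBracketWithin ℝ V W Set.univ z
        = fderiv ℝ W' z (V' z) - fderiv ℝ V' z (W' z) := by
    intro V W V' W' z h h'
    rw [VectorField.lieBracketWithin_univ, VectorField.lieBracket, h.fderiv_eq, h'.fderiv_eq,
      h.eq_of_nhds, h'.eq_of_nhds]
  refine (e2 _ _ _ _ _ kX kY).trans ?_
  rw [e1, e1]

end Coordinates

/-! ### Existence and uniqueness of the Levi-Civita connection -/

section LeviCivita
variable {E : Type*} [NormedAddCommGroup E] [NormedSpace ℝ E]
  {M : Type*} [TopologicalSpace M] [ChartedSpace E M]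
  {F : Type*} [NormedAddCommGroup F] [NormedSpace ℝ F]
  {N : Type*} [TopologicalSpace N] [ChartedSpace F N] [IsManifold 𝓘(ℝ, F) ∞ N]

/-- The field of bilinear forms `g` is a smooth Riemannian metric: `G` is its expression in the
chart at `x`. -/
structure IsRiemannian (g : BilinField E M) : Prop where
  symm : ∀ x v w, g x v w = g x w v
  pos : ∀ x v, v ≠ 0 → 0 < g x v v
  smooth : ∀ x, ∃ G : M → E →L[ℝ] E →L[ℝ] ℝ,
    (∀ᶠ y in 𝓝 x, ContMDiffAt 𝓘(ℝ, E) 𝓘(ℝ, E →L[ℝ] E →L[ℝ] ℝ) ∞ G y) ∧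
    ∀ᶠ y in 𝓝 x, ∀ v w, g y v w = G y (tcoord x y v) (tcoord x y w)

lemma IsRiemannian.eq_of_forall {g : BilinField E M} (hg : IsRiemannian g) {x : M}
    {v w : TangentSpace 𝓘(ℝ, E) x} (h : ∀ z, g x v z = g x w z) : v = w := by
  by_contra hne
  have := hg.pos x (v - w) (sub_ne_zero.2 hne)
  rw [hg.symm, map_sub, hg.symm, h, hg.symm x _ w, sub_self] at this
  exact lt_irrefl _ this

lemma IsRiemannian.separatingLeft {g : BilinField E M} (hg : IsRiemannian g) (x : M) :
    LinearMap.BilinForm.Nondegenerate (g x) := by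
  refine (LinearMap.IsRefl.nondegenerate_iff_separatingLeft ?_).2 ?_
  · intro v w h; rwa [hg.symm]
  · intro v h
    exact hg.eq_of_forall fun z => by simp [h]

/-- Every linear form on a tangent space is represented by a vector. -/
lemma IsRiemannian.exists_dual [FiniteDimensional ℝ E] {g : BilinField E M} (hg : IsRiemannian g)
    (x : M) : ∃ R : (TangentSpace 𝓘(ℝ, E) x →L[ℝ] ℝ) →ₗ[ℝ] TangentSpace 𝓘(ℝ, E) x,
      ∀ l z, g x (R l) z = l z := by
  have : FiniteDimensional ℝ (TangentSpace 𝓘(ℝ, E) x) := inferInstanceAs (FiniteDimensional ℝ E)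
  refine ⟨((LinearMap.BilinForm.toDual (g x) (hg.separatingLeft x)).symm.toLinearMap).comp
    (ContinuousLinearMap.coeLM ℝ), fun l z => ?_⟩
  simp [LinearMap.BilinForm.apply_toDual_symm_apply]

/-- The derivative of the inner product of two fields along a map. -/
lemma IsRiemannian.mvfderiv_inner {g : BilinField F N} (hg : IsRiemannian g) {f : M → N} {p : M}
    (hf : MDifferentiableAt 𝓘(ℝ, E) 𝓘(ℝ, F) f p) {V W : Π q : M, TangentSpace 𝓘(ℝ, F) (f q)}
    (hV : MDifferentiableAt 𝓘(ℝ, E) 𝓘(ℝ, F) (fun q => tcoord (f p) (f q) (V q)) p)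
    (hW : MDifferentiableAt 𝓘(ℝ, E) 𝓘(ℝ, F) (fun q => tcoord (f p) (f q) (W q)) p) :
    MDifferentiableAt 𝓘(ℝ, E) 𝓘(ℝ, ℝ) (fun q => g (f q) (V q) (W q)) p ∧
    ∀ v : TangentSpace 𝓘(ℝ, E) p, mvfderiv 𝓘(ℝ, E) (fun q => g (f q) (V q) (W q)) p v =
      mvfderiv 𝓘(ℝ, F) (fun y => g y (FiberBundle.extend F (V p) y) (FiberBundle.extend F (W p) y))
        (f p) (mfderiv 𝓘(ℝ, E) 𝓘(ℝ, F) f p v) +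
      g (f p) (tvec (f p) (mvfderiv 𝓘(ℝ, E) (fun q => tcoord (f p) (f q) (V q)) p v)) (W p) +
      g (f p) (V p) (tvec (f p) (mvfderiv 𝓘(ℝ, E) (fun q => tcoord (f p) (f q) (W q)) p v)) := by
  obtain ⟨G, hG, hGe⟩ := hg.smooth (f p)
  have hmem := chart_source_eventually (E := F) (f p)
  have hG1 : MDifferentiableAt 𝓘(ℝ, F) 𝓘(ℝ, F →L[ℝ] F →L[ℝ] ℝ) G (f p) :=
    hG.self_of_nhds.mdifferentiableAt (by simp)
  have hG2 : MDifferentiableAt 𝓘(ℝ, E) 𝓘(ℝ, F →L[ℝ] F →L[ℝ] ℝ) (fun q => G (f q)) p :=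
    hG1.comp p hf
  have hcV := hG2.clm_apply hV
  have e : (fun q => g (f q) (V q) (W q)) =ᶠ[𝓝 p]
      fun q => G (f q) (tcoord (f p) (f q) (V q)) (tcoord (f p) (f q) (W q)) :=
    (hf.continuousAt.eventually hGe).mono fun q hq => hq _ _
  have e' : (fun y => g y (FiberBundle.extend F (V p) y) (FiberBundle.extend F (W p) y))
      =ᶠ[𝓝 (f p)] fun y => G y (tcoord (f p) (f p) (V p)) (tcoord (f p) (f p) (W p)) :=
    (hmem.and hGe).mono fun y hy => by
      refine (hy.2 _ _).trans ?_
      rw [tcoord_extend hy.1, tcoord_extend hy.1]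
  refine ⟨(hcV.clm_apply hW).congr_of_eventuallyEq e, fun v => ?_⟩
  have hc : ∀ c : F, MDifferentiableAt 𝓘(ℝ, F) 𝓘(ℝ, F) (fun _ : N => c) (f p) := fun c =>
    mdifferentiableAt_const
  rw [mvfderiv_congr e, mvfderiv_congr e', mvfderiv_clm_apply hcV hW, mvfderiv_clm_apply hG2 hV,
    mvfderiv_clm_apply (hG1.clm_apply (hc _)) (hc _), mvfderiv_clm_apply hG1 (hc _),
    mvfderiv_comp_mfderiv hG1 hf, mvfderiv_const, mvfderiv_const,
    hGe.self_of_nhds, hGe.self_of_nhds, tcoord_tvec, tcoord_tvec]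
  simp

variable [IsManifold 𝓘(ℝ, E) ∞ M]

lemma isRiemannian_ofMetric
    (g : ContMDiffRiemannianMetric 𝓘(ℝ, E) ∞ E (fun x : M => TangentSpace 𝓘(ℝ, E) x)) :
    IsRiemannian (ofMetric g) where
  symm x v w := g.symm x v w
  pos x v hv := g.pos x v hv
  smooth x := by
    set e := trivializationAt (E →L[ℝ] E →L[ℝ] ℝ)
      (fun y : M => TangentSpace 𝓘(ℝ, E) y →L[ℝ] TangentSpace 𝓘(ℝ, E) y →L[ℝ] ℝ) x with he
    refine ⟨fun y => (e ⟨y, g.inner y⟩).2, ?_, ?_⟩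
    · have hb : e.baseSet = (chartAt E x).source := by
        simp [he, hom_trivializationAt_baseSet]
      have := (e.contMDiffOn_section_baseSet_iff).1 g.contMDiff.contMDiffOn
      rw [hb] at this
      exact (chart_source_eventually x).mono fun y hy =>
        this.contMDiffAt ((chartAt E x).open_source.mem_nhds hy)
    · filter_upwards [chart_source_eventually (E := E) x] with y hy v w
      have hb : y ∈ (trivializationAt E (TangentSpace 𝓘(ℝ, E)) x).baseSet := by simpa using hy
      have h := fun u : TangentSpace 𝓘(ℝ, E) y =>
        (trivializationAt E (TangentSpace 𝓘(ℝ, E)) x).symm_apply_apply_mk hb u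
      change _ = (e ⟨y, g.inner y⟩).2 _ _
      rw [he, hom_trivializationAt_apply, inCoordinates_apply_eq₂ hb hb
        (Set.mem_univ _), ← trivializationAt_snd, ← trivializationAt_snd, h, h]
      have h0 : ∀ r : ℝ,
          Trivialization.linearMapAt ℝ (trivializationAt ℝ (fun _ : M => ℝ) x) y r = r := by
        intro r
        exact congr($(Trivial.linearMapAt_trivialization ℝ M ℝ y) r)
      exact (h0 _).symm

/-- Symmetric Christoffel symbols at `x` compatible with the metric. -/
structure IsChristoffelAt (g : BilinField E M) (x : M)
    (Γ : TangentSpace 𝓘(ℝ, E) x → TangentSpace 𝓘(ℝ, E) x → TangentSpace 𝓘(ℝ, E) x) : Prop where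
  symm : ∀ v w, Γ v w = Γ w v
  metric : ∀ v w z, mvfderiv 𝓘(ℝ, E)
    (fun y => g y (FiberBundle.extend E w y) (FiberBundle.extend E z y)) x v =
      g x (Γ v w) z + g x w (Γ v z)

lemma IsChristoffelAt.unique {g : BilinField E M} (hg : IsRiemannian g) {x : M}
    {Γ Γ' : TangentSpace 𝓘(ℝ, E) x → TangentSpace 𝓘(ℝ, E) x → TangentSpace 𝓘(ℝ, E) x}
    (h : IsChristoffelAt g x Γ) (h' : IsChristoffelAt g x Γ') (v w : TangentSpace 𝓘(ℝ, E) x) :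
    Γ v w = Γ' v w := by
  refine hg.eq_of_forall fun z => ?_
  have key : ∀ a b c, g x (Γ a b) c - g x (Γ' a b) c = -(g x (Γ a c) b - g x (Γ' a c) b) := by
    intro a b c
    have h1 := h.metric a b c
    rw [h'.metric a b c] at h1
    rw [hg.symm x (Γ a c), hg.symm x (Γ' a c)]
    linarith
  have k1 := key v w z
  have k2 := key z v w
  have k3 := key w z v
  rw [h.symm z v, h'.symm z v, h.symm z w, h'.symm z w] at k2
  rw [h.symm w v, h'.symm w v] at k3
  linarith

lemma mdifferentiableAt_extend [FiniteDimensional ℝ E] {x : M} (w : TangentSpace 𝓘(ℝ, E) x) :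
    MDiffAt (T% (FiberBundle.extend E w)) x :=
  FiberBundle.mdifferentiableAt_extend 𝓘(ℝ, E) E w

lemma mvfderiv_tcoord_extend {x : M} (w v : TangentSpace 𝓘(ℝ, E) x) :
    mvfderiv 𝓘(ℝ, E) (fun y => tcoord x y (FiberBundle.extend E w y)) x v = 0 := by
  have : (fun y => tcoord x y (FiberBundle.extend E w y)) =ᶠ[𝓝 x] fun _ => tcoord x x w :=
    (chart_source_eventually x).mono fun y hy => tcoord_extend hy _
  rw [mvfderiv_congr this, mvfderiv_const]
  rfl

lemma IsLeviCivitaOn.isChristoffelAt [FiniteDimensional ℝ E] {g : BilinField E M}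
    {cov : (Π x : M, TangentSpace 𝓘(ℝ, E) x) →
      (Π x : M, TangentSpace 𝓘(ℝ, E) x →L[ℝ] TangentSpace 𝓘(ℝ, E) x)} {s : Set M}
    (h : IsLeviCivitaOn g cov s) {x : M} (hx : x ∈ s) :
    IsChristoffelAt g x fun v w => cov (FiberBundle.extend E w) x v where
  symm v w := by
    have h1 := h.torsion_free x hx _ _ (mdifferentiableAt_extend v) (mdifferentiableAt_extend w)
    have h2 := tcoord_mlieBracket (mdifferentiableAt_extend v) (mdifferentiableAt_extend w)
    rw [mvfderiv_tcoord_extend, mvfderiv_tcoord_extend, sub_zero] at h2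
    have h3 := tcoord_injective (mem_chart_source E x) (h2.trans (map_zero _).symm)
    rw [h3, FiberBundle.extend_apply_self, FiberBundle.extend_apply_self] at h1
    exact sub_eq_zero.1 h1
  metric v w z := by
    have h1 := h.metric x hx _ _ (mdifferentiableAt_extend w) (mdifferentiableAt_extend z) v
    rwa [FiberBundle.extend_apply_self, FiberBundle.extend_apply_self] at h1

/-- The fundamental lemma of Riemannian geometry, at a point. -/
lemma IsRiemannian.exists_isChristoffelAt [FiniteDimensional ℝ E] {g : BilinField E M}
    (hg : IsRiemannian g) (x : M) : ∃ Γ : TangentSpace 𝓘(ℝ, E) x →ₗ[ℝ]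
      TangentSpace 𝓘(ℝ, E) x →ₗ[ℝ] TangentSpace 𝓘(ℝ, E) x,
      IsChristoffelAt g x fun v w => Γ v w := by
  obtain ⟨G, hG, hGe⟩ := hg.smooth x
  obtain ⟨R, hR⟩ := hg.exists_dual x
  have hmem := chart_source_eventually (E := E) x
  have hG1 : MDifferentiableAt 𝓘(ℝ, E) 𝓘(ℝ, E →L[ℝ] E →L[ℝ] ℝ) G x :=
    hG.self_of_nhds.mdifferentiableAt (by simp)
  set dG : E →L[ℝ] E →L[ℝ] E →L[ℝ] ℝ := mvfderiv 𝓘(ℝ, E) G x with hdG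
  have hd : ∀ v w z : TangentSpace 𝓘(ℝ, E) x, mvfderiv 𝓘(ℝ, E)
      (fun y => g y (FiberBundle.extend E w y) (FiberBundle.extend E z y)) x v = dG v w z := by
    intro v w z
    have e' : (fun y => g y (FiberBundle.extend E w y) (FiberBundle.extend E z y))
        =ᶠ[𝓝 x] fun y => G y (tcoord x x w) (tcoord x x z) :=
      (hmem.and hGe).mono fun y hy => by
        refine (hy.2 _ _).trans ?_
        rw [tcoord_extend hy.1, tcoord_extend hy.1]
    have hc : ∀ c : E, MDifferentiableAt 𝓘(ℝ, E) 𝓘(ℝ, E) (fun _ : M => c) x := fun c =>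
      mdifferentiableAt_const
    rw [mvfderiv_congr e', mvfderiv_clm_apply (hG1.clm_apply (hc _)) (hc _),
      mvfderiv_clm_apply hG1 (hc _), mvfderiv_const, mvfderiv_const, tcoord_self, tcoord_self]
    simp only [map_zero, zero_apply, add_zero, hdG]
    rfl
  have hds : ∀ v w z, dG v w z = dG v z w := by
    intro v w z
    rw [← hd v w z, ← hd v z w]
    congr 3
    ext y
    exact hg.symm _ _ _
  -- Koszul's formula
  let l : E → E → E →L[ℝ] ℝ := fun v w => (1 / 2 : ℝ) • (dG v w + dG w v - (dG.flip v).flip w)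
  have hl : ∀ v w z, l v w z = (1 / 2 : ℝ) * (dG v w z + dG w v z - dG z v w) := by
    intro v w z
    simp [l]
  have hls : ∀ v w, l v w = l w v := by
    intro v w
    ext z
    rw [hl, hl, hds z v w]
    ring
  have hadd : ∀ v v' w, l (v + v') w = l v w + l v' w := by
    intro v v' w
    ext z
    simp only [hl, map_add, add_apply]
    ring
  have hsmul : ∀ (c : ℝ) v w, l (c • v) w = c • l v w := by
    intro c v w
    ext z
    simp only [hl, map_smul, smul_apply, smul_eq_mul]
    ring
  let R' : (E →L[ℝ] ℝ) →ₗ[ℝ] E := R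
  let Γ : E →ₗ[ℝ] E →ₗ[ℝ] E := LinearMap.mk₂ ℝ (fun v w => R' (l v w))
    (fun v v' w => by rw [hadd, map_add]) (fun c v w => by rw [hsmul, map_smul])
    (fun v w w' => by rw [hls v, hls v, hls v, hadd, map_add])
    (fun c v w => by rw [hls v, hls v, hsmul, map_smul])
  refine ⟨Γ, fun v w => congrArg R (hls v w), fun v w z => ?_⟩
  · have h1 := hR (l v w) z
    have h2 := hR (l v z) w
    rw [hg.symm] at h2
    refine (hd v w z).trans ?_
    have h3 : ∀ v w z : E, dG v w z = l v w z + l v z w := by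
      intro v w z
      rw [hl, hl, hds v z w, hds z v w, hds w v z]
      ring
    exact (h3 v w z).trans (congrArg₂ (· + ·) h1 h2).symm

/-- A Riemannian metric has a Levi-Civita connection. -/
lemma IsRiemannian.isLeviCivitaOn [FiniteDimensional ℝ E] {g : BilinField E M}
    (hg : IsRiemannian g) : IsLeviCivitaOn g (leviCivita g) Set.univ := by
  refine Classical.epsilon_spec (p := fun cov => IsLeviCivitaOn g cov Set.univ) ?_
  choose Γ hΓ using hg.exists_isChristoffelAt
  let B : ∀ x : M, TangentSpace 𝓘(ℝ, E) x →
      TangentSpace 𝓘(ℝ, E) x →L[ℝ] TangentSpace 𝓘(ℝ, E) x := fun x w =>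
    (LinearMap.toContinuousLinearMap ((Γ x).flip w : E →ₗ[ℝ] E) : E →L[ℝ] E)
  let cov : (Π x : M, TangentSpace 𝓘(ℝ, E) x) →
      (Π x : M, TangentSpace 𝓘(ℝ, E) x →L[ℝ] TangentSpace 𝓘(ℝ, E) x) := fun Y x =>
    (tvec x).comp (mvfderiv 𝓘(ℝ, E) (fun y => tcoord x y (Y y)) x) +
      B x (Y x)
  have hc : ∀ Y x v, cov Y x v =
      tvec x (mvfderiv 𝓘(ℝ, E) (fun y => tcoord x y (Y y)) x v) + Γ x v (Y x) :=
    fun Y x v => rfl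
  refine ⟨cov, ⟨⟨?_, ?_⟩, ?_, ?_⟩⟩
  · intro σ σ' x hσ hσ' _
    rw [mdifferentiableAt_field_iff] at hσ hσ'
    have := mvfderiv_add hσ hσ'
    ext v
    have h1 := congr($this v)
    refine (hc _ x v).trans (Eq.trans ?_ (congrArg₂ (· + ·) (hc σ x v) (hc σ' x v)).symm)
    have h2 : mvfderiv 𝓘(ℝ, E) (fun y => tcoord x y ((σ + σ') y)) x v = _ :=
      (mvfderiv_congr (Filter.Eventually.of_forall fun y => by simp) v).trans h1
    rw [h2]
    simp only [add_apply, map_add, Pi.add_apply]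
    abel
  · intro σ u x hσ hu _
    rw [mdifferentiableAt_field_iff] at hσ
    have := mvfderiv_smul hu hσ
    ext v
    have h1 := congr($this v)
    have h2 : mvfderiv 𝓘(ℝ, E) (fun y => tcoord x y ((u • σ) y)) x v = _ :=
      (mvfderiv_congr (Filter.Eventually.of_forall fun y => by simp) v).trans h1
    rw [hc, h2]
    simp only [add_apply, smul_apply, ContinuousLinearMap.smulRight_apply, map_add, map_smul,
      Pi.smul_apply', hc, tvec_tcoord, smul_add]
    abel
  · intro x _ X Y hX hY
    refine tcoord_injective (mem_chart_source E x) ?_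
    rw [tcoord_mlieBracket hX hY, hc, hc, (hΓ x).symm]
    simp
  · intro x _ Y Z hY hZ v
    rw [mdifferentiableAt_field_iff] at hY hZ
    have h1 := (hg.mvfderiv_inner (f := fun y : M => y) mdifferentiableAt_id hY hZ).2 v
    have h2 : mfderiv 𝓘(ℝ, E) 𝓘(ℝ, E) (fun y : M => y) x = _ := mfderiv_id
    rw [h2] at h1
    refine h1.trans ?_
    have h3 := (hΓ x).metric v (Y x) (Z x)
    rw [hc, hc, map_add, map_add, LinearMap.add_apply]
    simp only [ContinuousLinearMap.id_apply, h3]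
    ring

end LeviCivita

/-! ### The connection along a map -/

section Christoffel
variable {E : Type*} [NormedAddCommGroup E] [NormedSpace ℝ E]
  {M : Type*} [TopologicalSpace M] [ChartedSpace E M]
  {F : Type*} [NormedAddCommGroup F] [NormedSpace ℝ F]
  {N : Type*} [TopologicalSpace N] [ChartedSpace F N] [IsManifold 𝓘(ℝ, F) ∞ N]

/-- The Christoffel symbols of the Levi-Civita connection at `x` in the chart at `x`. -/
def christoffel (g : BilinField F N) (x : N) (v w : TangentSpace 𝓘(ℝ, F) x) :
    TangentSpace 𝓘(ℝ, F) x :=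
  leviCivita g (FiberBundle.extend F w) x v

lemma IsRiemannian.christoffel [FiniteDimensional ℝ F] {g : BilinField F N}
    (hg : IsRiemannian g) (x : N) :
    IsChristoffelAt g x (christoffel g x) :=
  hg.isLeviCivitaOn.isChristoffelAt (Set.mem_univ x)

lemma covAlong_eq (g : BilinField F N) (f : M → N) (V : Π q : M, TangentSpace 𝓘(ℝ, F) (f q))
    (p : M) (v : TangentSpace 𝓘(ℝ, E) p) :
    covAlong g f V p v =
      tvec (f p) (mvfderiv 𝓘(ℝ, E) (fun q => tcoord (f p) (f q) (V q)) p v) +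
        christoffel g (f p) (dmap E F f p v) (V p) := by
  unfold covAlong
  rw [trivializationAt_symm_self]
  simp only [trivializationAt_snd]
  rfl

/-- The connection along `f` is metric. -/
lemma IsRiemannian.mvfderiv_inner_covAlong [FiniteDimensional ℝ F] {g : BilinField F N}
    (hg : IsRiemannian g) {f : M → N} {p : M} (hf : MDifferentiableAt 𝓘(ℝ, E) 𝓘(ℝ, F) f p)
    {V W : Π q : M, TangentSpace 𝓘(ℝ, F) (f q)}
    (hV : MDifferentiableAt 𝓘(ℝ, E) 𝓘(ℝ, F) (fun q => tcoord (f p) (f q) (V q)) p)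
    (hW : MDifferentiableAt 𝓘(ℝ, E) 𝓘(ℝ, F) (fun q => tcoord (f p) (f q) (W q)) p)
    (v : TangentSpace 𝓘(ℝ, E) p) :
    mvfderiv 𝓘(ℝ, E) (fun q => g (f q) (V q) (W q)) p v =
      g (f p) (covAlong g f V p v) (W p) + g (f p) (V p) (covAlong g f W p v) := by
  rw [(hg.mvfderiv_inner hf hV hW).2 v, (hg.christoffel (f p)).metric, covAlong_eq, covAlong_eq,
    map_add, map_add, LinearMap.add_apply]
  simp only [dmap, ContinuousLinearMap.coe_coe]
  ring

variable [IsManifold 𝓘(ℝ, E) ∞ M]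

lemma eventually_contDiffAt_writtenInExtChartAt {f : M → N} (hf : ContMDiff 𝓘(ℝ, E) 𝓘(ℝ, F) ∞ f)
    (p : M) : ∀ᶠ z in 𝓝 (extChartAt 𝓘(ℝ, E) p p),
      ContDiffAt ℝ ∞ (writtenInExtChartAt 𝓘(ℝ, E) 𝓘(ℝ, F) p f) z := by
  have h := (contMDiff_iff.1 hf).2 p (f p)
  have hs : (extChartAt 𝓘(ℝ, E) p).target ∩
      (extChartAt 𝓘(ℝ, E) p).symm ⁻¹' (f ⁻¹' (extChartAt 𝓘(ℝ, F) (f p)).source) ∈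
        𝓝 (extChartAt 𝓘(ℝ, E) p p) := by
    refine Filter.inter_mem (extChartAt_target_mem_nhds p) ?_
    refine (continuousAt_extChartAt_symm p).preimage_mem_nhds ?_
    rw [extChartAt_to_inv]
    exact hf.continuous.continuousAt.preimage_mem_nhds (extChartAt_source_mem_nhds (f p))
  filter_upwards [eventually_mem_nhds_iff.2 hs] with z hz
  exact h.contDiffAt hz

/-- The differential of `f` in coordinates. -/
lemma eventually_tcoord_dmap {f : M → N} (hf : ContMDiff 𝓘(ℝ, E) 𝓘(ℝ, F) ∞ f) (p : M) :
    ∀ᶠ q in 𝓝 p, ∀ y : TangentSpace 𝓘(ℝ, E) q, tcoord (f p) (f q) (dmap E F f q y) =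
      fderiv ℝ (writtenInExtChartAt 𝓘(ℝ, E) 𝓘(ℝ, F) p f) (extChartAt 𝓘(ℝ, E) p q)
        (tcoord p q y) := by
  set φ := extChartAt 𝓘(ℝ, E) p with hφ
  set U : E → F := writtenInExtChartAt 𝓘(ℝ, E) 𝓘(ℝ, F) p f with hU
  have hU1 : ∀ᶠ q in 𝓝 p, ContDiffAt ℝ ∞ U (φ q) :=
    (continuousAt_extChartAt p).eventually (eventually_contDiffAt_writtenInExtChartAt hf p)
  filter_upwards [hU1, chart_source_eventually (E := E) p,
    hf.continuous.continuousAt.eventually (chart_source_eventually (E := F) (f p))]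
    with q h2 h3 h4 y
  have hφq : MDifferentiableAt 𝓘(ℝ, E) 𝓘(ℝ, E) φ q := mdifferentiableAt_extChartAt h3
  have hUq : MDifferentiableAt 𝓘(ℝ, E) 𝓘(ℝ, F) U (φ q) :=
    (h2.differentiableAt (by simp)).mdifferentiableAt
  have e1 : (fun q => extChartAt 𝓘(ℝ, F) (f p) (f q)) =ᶠ[𝓝 q] fun q => U (φ q) := by
    filter_upwards [(chartAt E p).open_source.mem_nhds h3] with z hz
    have : φ.symm (φ z) = z := φ.left_inv (by simpa [hφ] using hz)
    simp only [hU, writtenInExtChartAt, Function.comp_apply, ← hφ, this]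
  have h5 := mvfderiv_congr e1 y
  have h6 := mvfderiv_comp_mfderiv (u := extChartAt 𝓘(ℝ, F) (f p))
    (mdifferentiableAt_extChartAt h4) ((hf q).mdifferentiableAt (by simp)) y
  rw [mvfderiv_extChartAt h4] at h6
  have h7 := mvfderiv_comp_mfderiv hUq hφq y
  have h8 : mfderiv 𝓘(ℝ, E) 𝓘(ℝ, E) φ q y = tcoord p q y := mvfderiv_extChartAt h3 y
  rw [h8] at h7
  have h9 : ∀ e : E, mvfderiv 𝓘(ℝ, E) U (φ q) e = fderiv ℝ U (φ q) e := fun e =>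
    congr($(mfderiv_eq_fderiv (𝕜 := ℝ) (f := U) (x := φ q)) e)
  exact h6.symm.trans (h5.trans (h7.trans (h9 _)))

/-- The differential of `f` as a family of linear maps in coordinates. -/
def dcoord (E F : Type*) [NormedAddCommGroup E] [NormedSpace ℝ E]
    [NormedAddCommGroup F] [NormedSpace ℝ F]
    {M : Type*} [TopologicalSpace M] [ChartedSpace E M]
    {N : Type*} [TopologicalSpace N] [ChartedSpace F N] (f : M → N) (p q : M) : E →L[ℝ] F :=
  fderiv ℝ (writtenInExtChartAt 𝓘(ℝ, E) 𝓘(ℝ, F) p f) (extChartAt 𝓘(ℝ, E) p q)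

lemma contMDiffAt_dcoord {f : M → N} (hf : ContMDiff 𝓘(ℝ, E) 𝓘(ℝ, F) ∞ f) (p : M) :
    ∀ᶠ q in 𝓝 p, ContMDiffAt 𝓘(ℝ, E) 𝓘(ℝ, E →L[ℝ] F) ∞ (dcoord E F f p) q := by
  filter_upwards [(continuousAt_extChartAt p).eventually
    (eventually_contDiffAt_writtenInExtChartAt hf p), chart_source_eventually (E := E) p]
    with q h h'
  have h1 : ContDiffAt ℝ ∞ (fderiv ℝ (writtenInExtChartAt 𝓘(ℝ, E) 𝓘(ℝ, F) p f))
    (extChartAt 𝓘(ℝ, E) p q) := h.fderiv_right (by simp)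
  exact h1.contMDiffAt.comp q (contMDiffAt_extChartAt' h')

lemma mvfderiv_dcoord_symm {f : M → N} (hf : ContMDiff 𝓘(ℝ, E) 𝓘(ℝ, F) ∞ f) (p : M)
    (v w : TangentSpace 𝓘(ℝ, E) p) :
    mvfderiv 𝓘(ℝ, E) (dcoord E F f p) p v w = mvfderiv 𝓘(ℝ, E) (dcoord E F f p) p w v := by
  set φ := extChartAt 𝓘(ℝ, E) p with hφ
  set U : E → F := writtenInExtChartAt 𝓘(ℝ, E) 𝓘(ℝ, F) p f with hU
  have hUs : ContDiffAt ℝ ∞ U (φ p) :=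
    (eventually_contDiffAt_writtenInExtChartAt hf p).self_of_nhds
  have hA0d : MDifferentiableAt 𝓘(ℝ, E) 𝓘(ℝ, E →L[ℝ] F) (fderiv ℝ U) (φ p) :=
    ((hUs.fderiv_right (m := ∞) (by simp)).differentiableAt (by simp)).mdifferentiableAt
  have hdA : ∀ v, mvfderiv 𝓘(ℝ, E) (dcoord E F f p) p v = fderiv ℝ (fderiv ℝ U) (φ p) v := by
    intro v
    refine (mvfderiv_comp_mfderiv hA0d
      (mdifferentiableAt_extChartAt (mem_chart_source E p)) v).trans ?_
    have h1 : mfderiv 𝓘(ℝ, E) 𝓘(ℝ, E) φ p v = v :=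
      (mvfderiv_extChartAt (mem_chart_source E p) v).trans (tcoord_self p v)
    rw [h1]
    have h2 : mfderiv 𝓘(ℝ, E) 𝓘(ℝ, E →L[ℝ] F) (fderiv ℝ U) (φ p) =
      fderiv ℝ (fderiv ℝ U) (φ p) := mfderiv_eq_fderiv
    exact congr($h2 v)
  have hsymm : IsSymmSndFDerivAt ℝ U (φ p) :=
    hUs.isSymmSndFDerivAt (by
      rw [minSmoothness_of_isRCLikeNormedField]
      exact WithTop.coe_le_coe.2 le_top)
  rw [hdA, hdA]
  exact hsymm v w

/-- The differential of `f` applied to a field along `ι`, in coordinates. -/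
lemma mvfderiv_tcoord_dmap {E' : Type*} [NormedAddCommGroup E'] [NormedSpace ℝ E']
    {L : Type*} [TopologicalSpace L] [ChartedSpace E' L] {f : M → N}
    (hf : ContMDiff 𝓘(ℝ, E) 𝓘(ℝ, F) ∞ f) {ι : L → M} {q : L}
    (hι : MDifferentiableAt 𝓘(ℝ, E') 𝓘(ℝ, E) ι q) {V : Π q : L, TangentSpace 𝓘(ℝ, E) (ι q)}
    (hV : MDifferentiableAt 𝓘(ℝ, E') 𝓘(ℝ, E) (fun r => tcoord (ι q) (ι r) (V r)) q) :
    MDifferentiableAt 𝓘(ℝ, E') 𝓘(ℝ, F)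
      (fun r => tcoord (f (ι q)) (f (ι r)) (dmap E F f (ι r) (V r))) q ∧
    ∀ v : TangentSpace 𝓘(ℝ, E') q,
      mvfderiv 𝓘(ℝ, E') (fun r => tcoord (f (ι q)) (f (ι r)) (dmap E F f (ι r) (V r))) q v =
        mvfderiv 𝓘(ℝ, E) (dcoord E F f (ι q)) (ι q) (dmap E' E ι q v) (V q) +
        tcoord (f (ι q)) (f (ι q)) (dmap E F f (ι q)
          (tvec (ι q) (mvfderiv 𝓘(ℝ, E') (fun r => tcoord (ι q) (ι r) (V r)) q v))) := by
  have hA : MDifferentiableAt 𝓘(ℝ, E) 𝓘(ℝ, E →L[ℝ] F) (dcoord E F f (ι q)) (ι q) :=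
    (contMDiffAt_dcoord hf (ι q)).self_of_nhds.mdifferentiableAt (by simp)
  have hA' : MDifferentiableAt 𝓘(ℝ, E') 𝓘(ℝ, E →L[ℝ] F) (fun r => dcoord E F f (ι q) (ι r)) q :=
    hA.comp q hι
  have he := eventually_tcoord_dmap hf (ι q)
  have he' : (fun r => tcoord (f (ι q)) (f (ι r)) (dmap E F f (ι r) (V r))) =ᶠ[𝓝 q]
      fun r => dcoord E F f (ι q) (ι r) (tcoord (ι q) (ι r) (V r)) :=
    (hι.continuousAt.eventually he).mono fun r hr => hr _
  refine ⟨(hA'.clm_apply hV).congr_of_eventuallyEq he', fun v => ?_⟩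
  rw [mvfderiv_congr he', mvfderiv_clm_apply hA' hV, he.self_of_nhds, tcoord_tvec,
    mvfderiv_comp_mfderiv hA hι]
  congr 2
  exact tcoord_self (ι q) (V q)

/-- The derivative of `df V` for a field `V` along `ι`: its part normal to `f` depends on `V q`
only. -/
lemma covAlong_dmap {E' : Type*} [NormedAddCommGroup E'] [NormedSpace ℝ E']
    [FiniteDimensional ℝ E] {L : Type*} [TopologicalSpace L] [ChartedSpace E' L]
    [IsManifold 𝓘(ℝ, E') ∞ L] (g : BilinField F N) {f : M → N}
    (hf : ContMDiff 𝓘(ℝ, E) 𝓘(ℝ, F) ∞ f) {ι : L → M} {q : L}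
    (hι : MDifferentiableAt 𝓘(ℝ, E') 𝓘(ℝ, E) ι q) {V : Π q : L, TangentSpace 𝓘(ℝ, E) (ι q)}
    (hV : MDifferentiableAt 𝓘(ℝ, E') 𝓘(ℝ, E) (fun r => tcoord (ι q) (ι r) (V r)) q)
    (v : TangentSpace 𝓘(ℝ, E') q) :
    covAlong g (fun r => f (ι r)) (fun r => dmap E F f (ι r) (V r)) q v =
      covAlong g f (fun r => dmap E F f r (FiberBundle.extend E (V q) r)) (ι q) (dmap E' E ι q v) +
      dmap E F f (ι q)
        (tvec (ι q) (mvfderiv 𝓘(ℝ, E') (fun r => tcoord (ι q) (ι r) (V r)) q v)) := by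
  have hid : MDifferentiableAt 𝓘(ℝ, E) 𝓘(ℝ, E) (fun r : M => r) (ι q) := mdifferentiableAt_id
  have h2 := (mvfderiv_tcoord_dmap hf hid (mdifferentiableAt_field_iff.1
    (mdifferentiableAt_extend (V q)))).2 (dmap E' E ι q v)
  have h3 : dmap E E (fun r : M => r) (ι q) (dmap E' E ι q v) = dmap E' E ι q v := by
    have : mfderiv 𝓘(ℝ, E) 𝓘(ℝ, E) (fun r : M => r) (ι q) = _ := mfderiv_id
    simp [dmap, this]
  rw [mvfderiv_tcoord_extend, FiberBundle.extend_apply_self, h3] at h2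
  have h1 : dmap E' F (fun r => f (ι r)) q v = dmap E F f (ι q) (dmap E' E ι q v) :=
    mfderiv_comp_apply q ((hf (ι q)).mdifferentiableAt (by simp)) hι v
  rw [covAlong_eq, covAlong_eq, (mvfderiv_tcoord_dmap hf hι hV).2, h2, h1,
    FiberBundle.extend_apply_self]
  simp only [map_add, map_zero, tvec_tcoord, add_zero]
  abel

/-- The connection along `f` is torsion free. -/
lemma IsRiemannian.covAlong_dmap_extend_symm [FiniteDimensional ℝ E] [FiniteDimensional ℝ F]
    {g : BilinField F N} (hg : IsRiemannian g) {f : M → N}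
    (hf : ContMDiff 𝓘(ℝ, E) 𝓘(ℝ, F) ∞ f) {p : M}
    (v w : TangentSpace 𝓘(ℝ, E) p) :
    covAlong g f (fun q => dmap E F f q (FiberBundle.extend E w q)) p v =
      covAlong g f (fun q => dmap E F f q (FiberBundle.extend E v q)) p w := by
  have hid : MDifferentiableAt 𝓘(ℝ, E) 𝓘(ℝ, E) (fun r : M => r) p := mdifferentiableAt_id
  have h2 := fun v w => (mvfderiv_tcoord_dmap hf hid (mdifferentiableAt_field_iff.1
    (mdifferentiableAt_extend w))).2 v
  have h3 : ∀ v, dmap E E (fun r : M => r) p v = v := by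
    have : mfderiv 𝓘(ℝ, E) 𝓘(ℝ, E) (fun r : M => r) p = _ := mfderiv_id
    simp [dmap, this]
  simp only [mvfderiv_tcoord_extend, FiberBundle.extend_apply_self, h3] at h2
  rw [covAlong_eq, covAlong_eq, h2, h2, FiberBundle.extend_apply_self,
    FiberBundle.extend_apply_self, mvfderiv_dcoord_symm hf p v w, (hg.christoffel (f p)).symm]

end Christoffel

/-! ### Locally conformal Kähler metrics -/

section LocallyConformalKaehler
variable {E : Type*} [NormedAddCommGroup E] [NormedSpace ℝ E]
  {M : Type*} [TopologicalSpace M] [ChartedSpace E M]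
  {F : Type*} [NormedAddCommGroup F] [NormedSpace ℝ F]
  {N : Type*} [TopologicalSpace N] [ChartedSpace F N]
  {J : Π x : N, TangentSpace 𝓘(ℝ, F) x →L[ℝ] TangentSpace 𝓘(ℝ, F) x}
  {g : BilinField F N} {lee : Π x : N, TangentSpace 𝓘(ℝ, F) x →L[ℝ] ℝ}

lemma mvfderiv_exp_neg_mul {u φ : N → ℝ} {x : N} (hu : MDifferentiableAt 𝓘(ℝ, F) 𝓘(ℝ, ℝ) u x)
    (hφ : MDifferentiableAt 𝓘(ℝ, F) 𝓘(ℝ, ℝ) φ x) (v : TangentSpace 𝓘(ℝ, F) x) :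
    mvfderiv 𝓘(ℝ, F) (fun y => Real.exp (-φ y) * u y) x v =
      Real.exp (-φ x) * (mvfderiv 𝓘(ℝ, F) u x v - mvfderiv 𝓘(ℝ, F) φ x v * u x) := by
  have hφ' := (mdifferentiableAt_iff_chart.1 hφ)
  have hu' := (mdifferentiableAt_iff_chart.1 hu)
  have h := (hφ'.2.hasFDerivAt.neg.exp).mul hu'.2.hasFDerivAt
  have hd : MDifferentiableAt 𝓘(ℝ, F) 𝓘(ℝ, ℝ) (fun y => Real.exp (-φ y) * u y) x := by
    refine mdifferentiableAt_iff_chart.2 ⟨?_, h.differentiableAt⟩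
    exact (Real.continuous_exp.continuousAt.comp hφ'.1.neg).mul hu'.1
  rw [mvfderiv_eq_fderiv hd, mvfderiv_eq_fderiv hφ, mvfderiv_eq_fderiv hu]
  have h2 := congr($(h.fderiv) v)
  refine h2.trans ?_
  simp only [Function.comp_apply, Pi.neg_apply, extChartAt_to_inv]
  have h3 : ∀ (a b : ℝ) (k l : F →L[ℝ] ℝ) (v : F),
      (a • k + b • a • -l) v = a * (k v - l v * b) := by
    intro a b k l v
    simp only [add_apply, smul_apply, neg_apply, smul_eq_mul]
    ring
  exact h3 _ _ _ _ _

variable [IsManifold 𝓘(ℝ, F) ∞ N]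

lemma IsAlmostHermitian.exists_coord (hJ : IsAlmostHermitian J g) (x : N) :
    ∃ Jh : N → F →L[ℝ] F, ContMDiffOn 𝓘(ℝ, F) 𝓘(ℝ, F →L[ℝ] F) ∞ Jh (chartAt F x).source ∧
      ∀ y ∈ (chartAt F x).source, ∀ v, tcoord x y (J y v) = Jh y (tcoord x y v) := by
  set e := trivializationAt (F →L[ℝ] F)
    (fun y : N => TangentSpace 𝓘(ℝ, F) y →L[ℝ] TangentSpace 𝓘(ℝ, F) y) x with he
  refine ⟨fun y => (e ⟨y, J y⟩).2, ?_, ?_⟩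
  · have hb : e.baseSet = (chartAt F x).source := by
      simp [he, hom_trivializationAt_baseSet]
    rw [← hb]
    exact (e.contMDiffOn_section_baseSet_iff).1 hJ.contMDiff.contMDiffOn
  · intro y hy v
    have hb : y ∈ (trivializationAt F (TangentSpace 𝓘(ℝ, F)) x).baseSet := by simpa using hy
    have h := (trivializationAt F (TangentSpace 𝓘(ℝ, F)) x).symm_apply_apply_mk hb v
    change _ = (e ⟨y, J y⟩).2 _
    rw [he, hom_trivializationAt_apply, ContinuousLinearMap.inCoordinates_eq hb hb]
    simp only [ContinuousLinearMap.comp_apply, ContinuousLinearEquiv.coe_coe,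
      Trivialization.continuousLinearEquivAt_apply, Trivialization.symm_continuousLinearEquivAt_eq,
      Trivialization.symmL_apply _ hb, ← trivializationAt_snd, h]

lemma IsAlmostHermitian.skew (hJ : IsAlmostHermitian J g) (x : N) (v w : TangentSpace 𝓘(ℝ, F) x) :
    g x (J x v) w = -g x v (J x w) := by
  rw [← hJ.hermitian x v (J x w), hJ.sq, map_neg, neg_neg]

variable [FiniteDimensional ℝ F]

lemma mdifferentiableAt_inner_extend (hg : IsRiemannian g) (x : N) (w z : TangentSpace 𝓘(ℝ, F) x) :
    MDifferentiableAt 𝓘(ℝ, F) 𝓘(ℝ, ℝ)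
      (fun y => g y (FiberBundle.extend F w y) (FiberBundle.extend F z y)) x :=
  (hg.mvfderiv_inner (f := fun y : N => y) mdifferentiableAt_id
    (mdifferentiableAt_field_iff.1 (mdifferentiableAt_extend w))
    (mdifferentiableAt_field_iff.1 (mdifferentiableAt_extend z))).1

/-- The change of the Christoffel symbols under a conformal change of the metric; `B` is the
gradient of `φ`. -/
lemma IsChristoffelAt.of_conformal (hg : IsRiemannian g) {φ : N → ℝ} {x : N}
    (hφ : MDifferentiableAt 𝓘(ℝ, F) 𝓘(ℝ, ℝ) φ x)
    {Γ : TangentSpace 𝓘(ℝ, F) x → TangentSpace 𝓘(ℝ, F) x → TangentSpace 𝓘(ℝ, F) x}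
    (h : IsChristoffelAt (conformal φ g) x Γ) {B : TangentSpace 𝓘(ℝ, F) x}
    (hB : ∀ z, g x B z = mvfderiv 𝓘(ℝ, F) φ x z) :
    IsChristoffelAt g x fun v w => Γ v w + (1 / 2 : ℝ) • (mvfderiv 𝓘(ℝ, F) φ x v • w +
      mvfderiv 𝓘(ℝ, F) φ x w • v - g x v w • B) where
  symm v w := by
    rw [h.symm v w, hg.symm x v w, add_comm (mvfderiv 𝓘(ℝ, F) φ x v • w)]
  metric v w z := by
    have h1 := h.metric v w z
    have h2 := mvfderiv_exp_neg_mul (mdifferentiableAt_inner_extend hg x w z) hφ v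
    rw [FiberBundle.extend_apply_self, FiberBundle.extend_apply_self] at h2
    have h3 : Real.exp (-φ x) * _ = Real.exp (-φ x) * g x (Γ v w) z +
      Real.exp (-φ x) * g x w (Γ v z) := h2.symm.trans h1
    have h4 := mul_left_cancel₀ (Real.exp_ne_zero _) (h3.trans (mul_add _ _ _).symm)
    have h5 := eq_add_of_sub_eq h4
    rw [h5]
    simp only [map_add, map_sub, map_smul, LinearMap.add_apply, LinearMap.sub_apply,
      LinearMap.smul_apply, smul_eq_mul, hB, hg.symm x w B, hg.symm x w v]
    ring

/-- The deviation of `J` from being parallel, for the Levi-Civita connection of a locally conformal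
Kähler metric with Lee form `lee` dual to `B`. -/
def leeDefect (J : Π x : N, TangentSpace 𝓘(ℝ, F) x →L[ℝ] TangentSpace 𝓘(ℝ, F) x)
    (g : BilinField F N) (lee : Π x : N, TangentSpace 𝓘(ℝ, F) x →L[ℝ] ℝ) (x : N)
    (B v w : TangentSpace 𝓘(ℝ, F) x) : TangentSpace 𝓘(ℝ, F) x :=
  (1 / 2 : ℝ) • (lee x (J x w) • v - lee x w • J x v + g x v w • J x B - g x v (J x w) • B)

lemma IsLCKWithLeeForm.mvfderiv_coord (hg : IsRiemannian g)
    (h : IsLCKWithLeeForm J g lee) {x : N} {B : TangentSpace 𝓘(ℝ, F) x}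
    (hB : ∀ z, g x B z = lee x z) {Jh : N → F →L[ℝ] F}
    (hJh : MDifferentiableAt 𝓘(ℝ, F) 𝓘(ℝ, F →L[ℝ] F) Jh x)
    (hJe : ∀ᶠ y in 𝓝 x, ∀ v, tcoord x y (J y v) = Jh y (tcoord x y v))
    (v w : TangentSpace 𝓘(ℝ, F) x) :
    tvec x (mvfderiv 𝓘(ℝ, F) Jh x v (tcoord x x w)) + christoffel g x v (J x w) =
      J x (christoffel g x v w) + leeDefect J g lee x B v w := by
  obtain ⟨U, hU, hxU, φ, hφ, ⟨cov, hcov, hpar⟩, hl⟩ := h x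
  have hφx : MDifferentiableAt 𝓘(ℝ, F) 𝓘(ℝ, ℝ) φ x :=
    (hφ.contMDiffAt (hU.mem_nhds hxU)).mdifferentiableAt (by simp)
  rw [hl x hxU] at hB
  have hΓ := (hcov.isChristoffelAt hxU).of_conformal hg hφx hB
  have hu := fun v w => (hg.christoffel x).unique hg hΓ v w
  have he : (fun y => tcoord x y (J y (FiberBundle.extend F w y))) =ᶠ[𝓝 x]
      fun y => Jh y (tcoord x x w) := by
    filter_upwards [hJe, chart_source_eventually (E := F) x] with y h1 h2
    rw [h1, tcoord_extend h2]
  have hc : MDifferentiableAt 𝓘(ℝ, F) 𝓘(ℝ, F) (fun _ : N => tcoord x x w) x :=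
    mdifferentiableAt_const
  have hJY : MDiffAt (T% fun y => J y (FiberBundle.extend F w y)) x :=
    mdifferentiableAt_field_iff.2 ((hJh.clm_apply hc).congr_of_eventuallyEq he)
  have h1 := cov_eq_mvfderiv_add hcov.isCovariantDerivativeOn hxU hJY v
  rw [hpar x hxU _ (mdifferentiableAt_extend w), mvfderiv_congr he, mvfderiv_clm_apply hJh hc,
    mvfderiv_const, FiberBundle.extend_apply_self] at h1
  simp only [zero_apply, map_zero, add_zero] at h1
  rw [hu, hu, map_add, h1, leeDefect, hl x hxU]
  simp only [map_add, map_sub, map_smul]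
  module

/-- The derivative of `J V` for a field `V` along `f`. -/
lemma IsLCKWithLeeForm.covAlong_J (hg : IsRiemannian g) (hJ : IsAlmostHermitian J g)
    (h : IsLCKWithLeeForm J g lee) {f : M → N} {p : M}
    (hf : MDifferentiableAt 𝓘(ℝ, E) 𝓘(ℝ, F) f p) {B : TangentSpace 𝓘(ℝ, F) (f p)}
    (hB : ∀ z, g (f p) B z = lee (f p) z)
    {V : Π q : M, TangentSpace 𝓘(ℝ, F) (f q)}
    (hV : MDifferentiableAt 𝓘(ℝ, E) 𝓘(ℝ, F) (fun q => tcoord (f p) (f q) (V q)) p) :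
    MDifferentiableAt 𝓘(ℝ, E) 𝓘(ℝ, F) (fun q => tcoord (f p) (f q) (J (f q) (V q))) p ∧
    ∀ v : TangentSpace 𝓘(ℝ, E) p, covAlong g f (fun q => J (f q) (V q)) p v =
      J (f p) (covAlong g f V p v) + leeDefect J g lee (f p) B (dmap E F f p v) (V p) := by
  obtain ⟨Jh, hJs, hJe⟩ := hJ.exists_coord (f p)
  have hmem := chart_source_eventually (E := F) (f p)
  have hJh : MDifferentiableAt 𝓘(ℝ, F) 𝓘(ℝ, F →L[ℝ] F) Jh (f p) :=
    (hJs.contMDiffAt hmem).mdifferentiableAt (by simp)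
  have hJf : MDifferentiableAt 𝓘(ℝ, E) 𝓘(ℝ, F →L[ℝ] F) (fun q => Jh (f q)) p := hJh.comp p hf
  have he : (fun q => tcoord (f p) (f q) (J (f q) (V q))) =ᶠ[𝓝 p]
      fun q => Jh (f q) (tcoord (f p) (f q) (V q)) :=
    (hf.continuousAt.eventually hmem).mono fun q hq => hJe _ hq _
  refine ⟨(hJf.clm_apply hV).congr_of_eventuallyEq he, fun v => ?_⟩
  have h1 := h.mvfderiv_coord hg hB hJh (hmem.mono hJe) (dmap E F f p v) (V p)
  rw [covAlong_eq, covAlong_eq, mvfderiv_congr he, mvfderiv_clm_apply hJf hV,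
    mvfderiv_comp_mfderiv hJh hf, map_add, map_add]
  have h2 : tvec (f p) (Jh (f p) (mvfderiv 𝓘(ℝ, E) (fun q => tcoord (f p) (f q) (V q)) p v)) =
      J (f p) (tvec (f p) (mvfderiv 𝓘(ℝ, E) (fun q => tcoord (f p) (f q) (V q)) p v)) := by
    refine tcoord_injective (mem_chart_source F (f p)) ?_
    rw [tcoord_tvec, hJe _ hmem.self_of_nhds, tcoord_tvec]
  rw [h2, add_right_comm]
  refine (congrArg (· + _) h1).trans ?_
  abel

end LocallyConformalKaehler

/-! ### Induced metrics and CR-submanifolds -/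

section OrthogonalProjection
variable {V : Type*} [AddCommGroup V] [Module ℝ V]
  {b : LinearMap.BilinForm ℝ V}

lemma eq_of_mem_of_inner (hp : ∀ v, v ≠ 0 → 0 < b v v)
    {S : Submodule ℝ V} {v w : V} (hv : v ∈ S) (hw : w ∈ S) (h : ∀ s ∈ S, b s v = b s w) :
    v = w := by
  by_contra hne
  refine (hp (v - w) (sub_ne_zero.2 hne)).ne' ?_
  rw [map_sub (b (v - w)), h _ (S.sub_mem hv hw), sub_self]

variable [FiniteDimensional ℝ V]

lemma isCompl_orthogonal_of_pos (hs : ∀ v w, b v w = b w v) (hp : ∀ v, v ≠ 0 → 0 < b v v)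
    (S : Submodule ℝ V) : IsCompl S (b.orthogonal S) := by
  refine (LinearMap.BilinForm.isCompl_orthogonal_iff_disjoint
    (fun v w h => by rwa [hs])).2 (Submodule.disjoint_def.2 fun v hv hv' => ?_)
  by_contra h
  exact (hp v h).ne' (hv' v hv)

lemma orthProj_spec (hs : ∀ v w, b v w = b w v) (hp : ∀ v, v ≠ 0 → 0 < b v v)
    (S : Submodule ℝ V) (v : V) :
    orthProj b S v ∈ S ∧ ∀ s ∈ S, b s (v - orthProj b S v) = 0 := by
  refine Classical.epsilon_spec (p := fun w => w ∈ S ∧ ∀ s ∈ S, b s (v - w) = 0) ?_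
  have h : v ∈ S ⊔ b.orthogonal S := by
    rw [(isCompl_orthogonal_of_pos hs hp S).sup_eq_top]; trivial
  obtain ⟨w, hw, t, ht, rfl⟩ := Submodule.mem_sup.1 h
  exact ⟨w, hw, fun s hs => by simpa using ht s hs⟩

lemma inner_orthProj (hs : ∀ v w, b v w = b w v) (hp : ∀ v, v ≠ 0 → 0 < b v v)
    {S : Submodule ℝ V} (v : V) {s : V} (h : s ∈ S) : b s (orthProj b S v) = b s v := by
  have := (orthProj_spec hs hp S v).2 s h
  rw [map_sub, sub_eq_zero] at this
  exact this.symm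

lemma orthProj_eq_zero_iff (hs : ∀ v w, b v w = b w v) (hp : ∀ v, v ≠ 0 → 0 < b v v)
    {S : Submodule ℝ V} {v : V} : orthProj b S v = 0 ↔ ∀ s ∈ S, b s v = 0 := by
  constructor
  · intro h s hS
    rw [← inner_orthProj hs hp v hS, h, map_zero]
  · intro h
    refine eq_of_mem_of_inner hp (orthProj_spec hs hp S v).1 S.zero_mem fun s hS => ?_
    rw [inner_orthProj hs hp v hS, h s hS, map_zero]

end OrthogonalProjection

section Submanifold
variable {E : Type*} [NormedAddCommGroup E] [NormedSpace ℝ E]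
  {M : Type*} [TopologicalSpace M] [ChartedSpace E M]
  {F : Type*} [NormedAddCommGroup F] [NormedSpace ℝ F]
  {N : Type*} [TopologicalSpace N] [ChartedSpace F N]
  {J : Π x : N, TangentSpace 𝓘(ℝ, F) x →L[ℝ] TangentSpace 𝓘(ℝ, F) x}
  {g : BilinField F N} {lee : Π x : N, TangentSpace 𝓘(ℝ, F) x →L[ℝ] ℝ}
  {f : M → N} {D : Distribution E M}

instance [FiniteDimensional ℝ E] (x : M) : FiniteDimensional ℝ (TangentSpace 𝓘(ℝ, E) x) :=
  inferInstanceAs (FiniteDimensional ℝ E)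

lemma IsRiemannian.exists_inner_eq [FiniteDimensional ℝ E] {g : BilinField E M}
    (hg : IsRiemannian g) (x : M) (l : TangentSpace 𝓘(ℝ, E) x →ₗ[ℝ] ℝ) : ∃ v, ∀ z, g x v z = l z :=
  ⟨(LinearMap.BilinForm.toDual (g x) (hg.separatingLeft x)).symm l, fun z => by
    simp [LinearMap.BilinForm.apply_toDual_symm_apply]⟩

lemma inducedMetric_apply (g : BilinField F N) (f : M → N) (p : M)
    (v w : TangentSpace 𝓘(ℝ, E) p) :
    inducedMetric g f p v w = g (f p) (dmap E F f p v) (dmap E F f p w) := rfl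

lemma contMDiffAt_bilinear_pullback {A : M → E →L[ℝ] F} {G : M → F →L[ℝ] F →L[ℝ] ℝ} {q : M}
    (hA : ContMDiffAt 𝓘(ℝ, E) 𝓘(ℝ, E →L[ℝ] F) ∞ A q)
    (hG : ContMDiffAt 𝓘(ℝ, E) 𝓘(ℝ, F →L[ℝ] F →L[ℝ] ℝ) ∞ G q) :
    ContMDiffAt 𝓘(ℝ, E) 𝓘(ℝ, E →L[ℝ] E →L[ℝ] ℝ) ∞
      (fun q => ((A q).precomp ℝ).comp ((G q).comp (A q))) q := by
  have h1 : ContMDiffAt 𝓘(ℝ, E) 𝓘(ℝ, E →L[ℝ] F →L[ℝ] ℝ) ∞ (fun q => (G q).comp (A q)) q :=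
    hG.clm_comp hA
  have h2 : ContMDiffAt 𝓘(ℝ, E) 𝓘(ℝ, (F →L[ℝ] ℝ) →L[ℝ] (E →L[ℝ] ℝ)) ∞
    (fun q => (A q).precomp ℝ) q := hA.clm_precomp
  exact h2.clm_comp h1

variable [IsManifold 𝓘(ℝ, E) ∞ M]

/-- Every vector of a smooth distribution extends to a local section of it. -/
lemma IsSmoothDistribution.exists_section (hD : IsSmoothDistribution D) {p : M}
    {Y : TangentSpace 𝓘(ℝ, E) p} (hY : Y ∈ D p) :
    ∃ Ys : Π x : M, TangentSpace 𝓘(ℝ, E) x, MDiffAt (T% Ys) p ∧ (∀ᶠ x in 𝓝 p, Ys x ∈ D x) ∧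
      Ys p = Y := by
  obtain ⟨U, hU, hp, r, X, hX, hs⟩ := hD p
  rw [← (hs p hp).2, Submodule.mem_span_range_iff_exists_fun] at hY
  obtain ⟨c, hc⟩ := hY
  refine ⟨fun x => ∑ i, c i • X i x, ?_, ?_, hc⟩
  · have h1 : ∀ i, MDifferentiableAt 𝓘(ℝ, E) 𝓘(ℝ, E) (fun y => tcoord p y (X i y)) p := fun i =>
      mdifferentiableAt_field_iff.1
        (((hX i).contMDiffAt (hU.mem_nhds hp)).mdifferentiableAt (by simp))
    rw [mdifferentiableAt_field_iff, mdifferentiableAt_iff_chart]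
    simp only [map_sum, map_smul]
    constructor
    · exact tendsto_finsetSum _ fun i _ => ((h1 i).continuousAt).const_smul (c i)
    · exact DifferentiableAt.fun_sum fun i _ =>
        ((mdifferentiableAt_iff_chart.1 (h1 i)).2).const_smul (c i)
  · filter_upwards [hU.mem_nhds hp] with x hx
    rw [← (hs x hx).2]
    exact Submodule.sum_mem _ fun i _ => Submodule.smul_mem _ _ (Submodule.subset_span ⟨i, rfl⟩)

lemma IsCRSubmanifold.exists_J_eq (hD : IsCRSubmanifold J g f D) {p : M}
    {Y : TangentSpace 𝓘(ℝ, E) p} (hY : Y ∈ D p) :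
    ∃ u ∈ D p, dmap E F f p u = J (f p) (dmap E F f p Y) := by
  have : J (f p) (dmap E F f p Y) ∈ mapJ J f p (D p) := ⟨_, ⟨Y, hY, rfl⟩, rfl⟩
  rw [hD.holomorphic p] at this
  exact this

variable [IsManifold 𝓘(ℝ, F) ∞ N]

lemma IsRiemannian.induced (hg : IsRiemannian g) (hf : IsSmoothImmersion (E := E) (F := F) f) :
    IsRiemannian (E := E) (inducedMetric g f) where
  symm x v w := hg.symm _ _ _
  pos x v hv := hg.pos _ _ fun h => hv (hf.injective_mfderiv x (h.trans (map_zero _).symm))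
  smooth x := by
    obtain ⟨G, hG, hGe⟩ := hg.smooth (f x)
    refine ⟨fun q => ((dcoord E F f x q).precomp ℝ).comp ((G (f q)).comp (dcoord E F f x q)),
      ?_, ?_⟩
    · filter_upwards [hf.contMDiff.continuous.continuousAt.eventually hG,
        contMDiffAt_dcoord hf.contMDiff x] with q h1 h2
      have h3 : ContMDiffAt 𝓘(ℝ, E) 𝓘(ℝ, F →L[ℝ] F →L[ℝ] ℝ) ∞ (fun q => G (f q)) q :=
        h1.comp q (hf.contMDiff q)
      exact contMDiffAt_bilinear_pullback h2 h3
    · filter_upwards [hf.contMDiff.continuous.continuousAt.eventually hGe,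
        eventually_tcoord_dmap hf.contMDiff x] with q h1 h2 v w
      rw [inducedMetric_apply, h1, h2, h2]
      rfl

variable [FiniteDimensional ℝ E] [FiniteDimensional ℝ F]

/-- The Gauss formula for the Christoffel symbols. -/
lemma IsRiemannian.inducedMetric_christoffel (hg : IsRiemannian g)
    (hf : IsSmoothImmersion (E := E) (F := F) f) (p : M) (v w z : TangentSpace 𝓘(ℝ, E) p) :
    inducedMetric g f p (LCK.christoffel (inducedMetric g f) p v w) z =
      g (f p) (covAlong g f (fun q => dmap E F f q (FiberBundle.extend E w q)) p v)
        (dmap E F f p z) := by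
  have hgM := hg.induced hf
  choose Γ hΓ using fun v w : TangentSpace 𝓘(ℝ, E) p => hgM.exists_inner_eq p
    ((g (f p) (covAlong g f (fun q => dmap E F f q (FiberBundle.extend E w q)) p v)).comp
      (dmap E F f p))
  have hC : IsChristoffelAt (inducedMetric g f) p Γ := by
    refine ⟨fun v w => hgM.eq_of_forall fun z => ?_, fun v w z => ?_⟩
    · rw [hΓ, hΓ, hg.covAlong_dmap_extend_symm hf.contMDiff]
    · have hd : ∀ w : TangentSpace 𝓘(ℝ, E) p, MDifferentiableAt 𝓘(ℝ, E) 𝓘(ℝ, F) (fun q =>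
          tcoord (f p) (f q) (dmap E F f q (FiberBundle.extend E w q))) p := fun w =>
        (mvfderiv_tcoord_dmap hf.contMDiff (ι := fun q : M => q) mdifferentiableAt_id
          (mdifferentiableAt_field_iff.1 (mdifferentiableAt_extend w))).1
      have := hg.mvfderiv_inner_covAlong ((hf.contMDiff p).mdifferentiableAt (by simp))
        (hd w) (hd z) v
      rw [hgM.symm p w, hΓ, hΓ]
      refine this.trans ?_
      rw [FiberBundle.extend_apply_self, FiberBundle.extend_apply_self,
        hg.symm (f p) _ (covAlong _ _ _ _ _)]
      rfl
  rw [(hgM.christoffel p).unique hgM hC, hΓ]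
  rfl

/-- The Gauss formula along a map `ι`. -/
lemma IsRiemannian.inducedMetric_covAlong (hg : IsRiemannian g)
    (hf : IsSmoothImmersion (E := E) (F := F) f)
    {E' : Type*} [NormedAddCommGroup E'] [NormedSpace ℝ E']
    {L : Type*} [TopologicalSpace L] [ChartedSpace E' L]
    [IsManifold 𝓘(ℝ, E') ∞ L] {ι : L → M} {q : L}
    (hι : MDifferentiableAt 𝓘(ℝ, E') 𝓘(ℝ, E) ι q) {V : Π q : L, TangentSpace 𝓘(ℝ, E) (ι q)}
    (hV : MDifferentiableAt 𝓘(ℝ, E') 𝓘(ℝ, E) (fun r => tcoord (ι q) (ι r) (V r)) q)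
    (v : TangentSpace 𝓘(ℝ, E') q) (u : TangentSpace 𝓘(ℝ, E) (ι q)) :
    inducedMetric g f (ι q) (covAlong (inducedMetric g f) ι V q v) u =
      g (f (ι q)) (covAlong g (fun r => f (ι r)) (fun r => dmap E F f (ι r) (V r)) q v)
        (dmap E F f (ι q) u) := by
  rw [covAlong_eq, map_add, LinearMap.add_apply, hg.inducedMetric_christoffel hf,
    covAlong_dmap g hf.contMDiff hι hV, map_add, LinearMap.add_apply, add_comm]
  rfl

/-- Up to the anti-Lee form, the `D`-component of the derivative of a field tangent to `D^⊥` along a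
map `ι` tangent to `D^⊥` is the `JD^⊥`-component of the second fundamental form of `f`. This is the
derivative along `ι` of the equation `g(J Y, W) = 0`, for a section `Y` of `D` and a field `W`
tangent to the leaf, where the derivative of `J` is given by the Lee form. -/
lemma IsCRSubmanifold.inducedMetric_covAlong_leaf (hD : IsCRSubmanifold J g f D)
    (hg : IsRiemannian g) (hJ : IsAlmostHermitian J g) (hl : IsLCKWithLeeForm J g lee)
    {E' : Type*} [NormedAddCommGroup E'] [NormedSpace ℝ E'] [FiniteDimensional ℝ E']
    {L : Type*} [TopologicalSpace L] [ChartedSpace E' L] [IsManifold 𝓘(ℝ, E') ∞ L]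
    {ι : L → M} (hι : ContMDiff 𝓘(ℝ, E') 𝓘(ℝ, E) ∞ ι)
    (htan : ∀ q v, dmap E' E ι q v ∈ orthDistribution (inducedMetric g f) D (ι q)) {q : L}
    (v w : TangentSpace 𝓘(ℝ, E') q) {Y u : TangentSpace 𝓘(ℝ, E) (ι q)}
    (hY : Y ∈ D (ι q)) (hu : u ∈ D (ι q))
    (hYu : dmap E F f (ι q) u = J (f (ι q)) (dmap E F f (ι q) Y)) :
    inducedMetric g f (ι q) (covAlong (inducedMetric g f) ι
        (fun r => dmap E' E ι r (FiberBundle.extend E' w r)) q v) u =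
      g (f (ι q)) (secondFundamentalForm g f (ι q) (dmap E' E ι q v) Y)
        (J (f (ι q)) (dmap E F f (ι q) (dmap E' E ι q w))) -
      (1 / 2) * (antiLee J lee (f (ι q)) (dmap E F f (ι q) Y) *
        inducedMetric g f (ι q) (dmap E' E ι q v) (dmap E' E ι q w)) := by
  have hf := hD.isSmoothImmersion
  obtain ⟨Ys, hYs, hYsD, hYsq⟩ := hD.smooth.exists_section hY
  obtain ⟨B, hB⟩ := hg.exists_inner_eq (f (ι q)) (lee (f (ι q))).toLinearMap
  have hιq : MDifferentiableAt 𝓘(ℝ, E') 𝓘(ℝ, E) ι q := (hι q).mdifferentiableAt (by simp)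
  have hfq : MDifferentiableAt 𝓘(ℝ, E) 𝓘(ℝ, F) f (ι q) :=
    (hf.contMDiff _).mdifferentiableAt (by simp)
  have hfι : MDifferentiableAt 𝓘(ℝ, E') 𝓘(ℝ, F) (fun r => f (ι r)) q := hfq.comp q hιq
  set W : Π r : L, TangentSpace 𝓘(ℝ, E) (ι r) :=
    fun r => dmap E' E ι r (FiberBundle.extend E' w r) with hWdef
  have hW : MDifferentiableAt 𝓘(ℝ, E') 𝓘(ℝ, E) (fun r => tcoord (ι q) (ι r) (W r)) q :=
    (mvfderiv_tcoord_dmap hι (ι := fun r : L => r) mdifferentiableAt_id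
      (mdifferentiableAt_field_iff.1 (mdifferentiableAt_extend w))).1
  have hV : MDifferentiableAt 𝓘(ℝ, E') 𝓘(ℝ, E) (fun r => tcoord (ι q) (ι r) (Ys (ι r))) q :=
    (mdifferentiableAt_field_iff.1 hYs).comp q hιq
  have hfW := (mvfderiv_tcoord_dmap hf.contMDiff hιq hW).1
  have hfV := (mvfderiv_tcoord_dmap hf.contMDiff hιq hV).1
  obtain ⟨hJV, hJVc⟩ := hl.covAlong_J hg hJ hfι hB hfV
  have hzero : (fun r => g (f (ι r)) (J (f (ι r)) (dmap E F f (ι r) (Ys (ι r))))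
      (dmap E F f (ι r) (W r))) =ᶠ[𝓝 q] fun _ => 0 := by
    filter_upwards [hιq.continuousAt.eventually hYsD] with r hr
    obtain ⟨y, hy, hy'⟩ := hD.exists_J_eq hr
    rw [← hy']
    exact htan r _ y hy
  have h1 := hg.mvfderiv_inner_covAlong hfι hJV hfW v
  rw [mvfderiv_congr hzero, mvfderiv_const, hJVc, hYsq] at h1
  have hWq : W q = dmap E' E ι q w := by
    simp only [hWdef, FiberBundle.extend_apply_self]
  -- `J df` of a vector tangent to `D^⊥` is normal to `M`
  have hnormal : ∀ z, J (f (ι q)) (dmap E F f (ι q) (dmap E' E ι q z)) ∈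
      normalSpace E g f (ι q) := fun z =>
    hD.totally_real (ι q) ⟨_, ⟨_, htan q z, rfl⟩, rfl⟩
  have hnor0 : ∀ z x, g (f (ι q)) (dmap E F f (ι q) x)
      (J (f (ι q)) (dmap E F f (ι q) (dmap E' E ι q z))) = 0 := fun z x => hnormal z _ ⟨x, rfl⟩
  have hc := covAlong_dmap g hf.contMDiff hιq hV v
  rw [hg.inducedMetric_covAlong hf hιq hW, hYu, hg.symm]
  have h2 : g (f (ι q)) (secondFundamentalForm g f (ι q) (dmap E' E ι q v) Y)
        (J (f (ι q)) (dmap E F f (ι q) (dmap E' E ι q w))) =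
      g (f (ι q)) (covAlong g (fun r => f (ι r)) (fun r => dmap E F f (ι r) (Ys (ι r))) q v)
        (J (f (ι q)) (dmap E F f (ι q) (dmap E' E ι q w))) := by
    rw [hc, map_add, LinearMap.add_apply, hnor0, add_zero, hg.symm, secondFundamentalForm,
      inner_orthProj (hg.symm _) (hg.pos _) _ (hnormal w), hg.symm, hYsq]
  have hD0 : ∀ z, ∀ y ∈ D (ι q), g (f (ι q)) (dmap E F f (ι q) y)
      (dmap E F f (ι q) (dmap E' E ι q z)) = 0 := fun z y hy => htan q z y hy
  have hcomp : dmap E' F (fun r => f (ι r)) q v = dmap E F f (ι q) (dmap E' E ι q v) :=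
    mfderiv_comp_apply q hfq hιq v
  have h3 : g (f (ι q)) (leeDefect J g lee (f (ι q)) B (dmap E' F (fun r => f (ι r)) q v)
      (dmap E F f (ι q) Y)) (dmap E F f (ι q) (dmap E' E ι q w)) =
      (1 / 2) * (antiLee J lee (f (ι q)) (dmap E F f (ι q) Y) *
        inducedMetric g f (ι q) (dmap E' E ι q v) (dmap E' E ι q w)) := by
    rw [leeDefect, hcomp, ← hYu]
    have e1 : g (f (ι q)) (J (f (ι q)) (dmap E F f (ι q) (dmap E' E ι q v)))
      (dmap E F f (ι q) (dmap E' E ι q w)) = 0 := by rw [hg.symm]; exact hnor0 v _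
    have e2 : g (f (ι q)) (dmap E F f (ι q) (dmap E' E ι q v)) (dmap E F f (ι q) Y) = 0 := by
      rw [hg.symm]; exact hD0 v Y hY
    have e3 : g (f (ι q)) (dmap E F f (ι q) (dmap E' E ι q v)) (dmap E F f (ι q) u) = 0 := by
      rw [hg.symm]; exact hD0 v u hu
    have e4 : antiLee J lee (f (ι q)) (dmap E F f (ι q) Y) =
      lee (f (ι q)) (dmap E F f (ι q) u) := by rw [hYu]; rfl
    simp only [map_smul, map_add, map_sub, LinearMap.smul_apply, LinearMap.add_apply,
      LinearMap.sub_apply, smul_eq_mul, e1, e2, e3, e4, inducedMetric_apply, zero_smul]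
    simp
  rw [h2]
  rw [map_add, LinearMap.add_apply, hWq, h3, hJ.skew] at h1
  have h4 : (0 : TangentSpace 𝓘(ℝ, E') q →L[ℝ] ℝ) v = 0 := rfl
  rw [h4] at h1
  linarith

end Submanifold

/-! ### The second fundamental form of the leaves -/

section Leaves
variable {E : Type*} [NormedAddCommGroup E] [NormedSpace ℝ E]
  {M : Type*} [TopologicalSpace M] [ChartedSpace E M]
  {F : Type*} [NormedAddCommGroup F] [NormedSpace ℝ F] [FiniteDimensional ℝ F]
  {N : Type*} [TopologicalSpace N] [ChartedSpace F N] [IsManifold 𝓘(ℝ, F) ∞ N]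
  {J : Π x : N, TangentSpace 𝓘(ℝ, F) x →L[ℝ] TangentSpace 𝓘(ℝ, F) x}
  {g : BilinField F N} {lee : Π x : N, TangentSpace 𝓘(ℝ, F) x →L[ℝ] ℝ}
  {f : M → N} {D : Distribution E M}

lemma IsRiemannian.orthDistribution_orthogonal [FiniteDimensional ℝ E] {g : BilinField E M}
    (hg : IsRiemannian g) (D : Distribution E M) (p : M) :
    (orthDistribution g D p).orthogonalBilin (g p) = D p :=
  LinearMap.BilinForm.orthogonal_orthogonal (hg.separatingLeft p)
    (fun v w h => by rwa [hg.symm]) (D p)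

variable [IsManifold 𝓘(ℝ, E) ∞ M]

/-- The equation `θ(Y) J X = 2 h_{JD^⊥}(X, Y)` holds between vectors of `JD^⊥`, and is tested on
the vectors `J Z` with `Z` in `D^⊥`. -/
lemma IsAlmostHermitian.smul_eq_orthProj_iff (hJ : IsAlmostHermitian J g)
    (hg : IsRiemannian g) {p : M} {X Y : TangentSpace 𝓘(ℝ, E) p}
    (hX : X ∈ orthDistribution (inducedMetric g f) D p) :
    antiLee J lee (f p) (dmap E F f p Y) • J (f p) (dmap E F f p X) =
      (2 : ℝ) • orthProj (g (f p)) (mapJ J f p (orthDistribution (inducedMetric g f) D p))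
        (secondFundamentalForm g f p X Y) ↔
    ∀ Z ∈ orthDistribution (inducedMetric g f) D p,
      antiLee J lee (f p) (dmap E F f p Y) * inducedMetric g f p X Z =
      2 * g (f p) (secondFundamentalForm g f p X Y) (J (f p) (dmap E F f p Z)) := by
  have hmem : ∀ Z ∈ orthDistribution (inducedMetric g f) D p, J (f p) (dmap E F f p Z) ∈
      mapJ J f p (orthDistribution (inducedMetric g f) D p) := fun Z hZ => ⟨_, ⟨Z, hZ, rfl⟩, rfl⟩
  have h1 : ∀ Z ∈ orthDistribution (inducedMetric g f) D p,
      g (f p) (J (f p) (dmap E F f p Z))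
        (antiLee J lee (f p) (dmap E F f p Y) • J (f p) (dmap E F f p X)) =
      antiLee J lee (f p) (dmap E F f p Y) * inducedMetric g f p X Z := by
    intro Z _
    rw [map_smul, smul_eq_mul, hJ.hermitian, hg.symm]
    rfl
  have h2 : ∀ Z ∈ orthDistribution (inducedMetric g f) D p,
      g (f p) (J (f p) (dmap E F f p Z)) ((2 : ℝ) • orthProj (g (f p))
        (mapJ J f p (orthDistribution (inducedMetric g f) D p))
        (secondFundamentalForm g f p X Y)) =
      2 * g (f p) (secondFundamentalForm g f p X Y) (J (f p) (dmap E F f p Z)) := by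
    intro Z hZ
    rw [map_smul, smul_eq_mul, inner_orthProj (hg.symm _) (hg.pos _) _ (hmem Z hZ), hg.symm]
  constructor
  · intro h Z hZ
    rw [← h1 Z hZ, ← h2 Z hZ, h]
  · intro h
    refine eq_of_mem_of_inner (hg.pos _) (Submodule.smul_mem _ _ (hmem X hX))
      (Submodule.smul_mem _ _ (orthProj_spec (hg.symm _) (hg.pos _) _ _).1) ?_
    rintro _ ⟨_, ⟨Z, hZ, rfl⟩, rfl⟩
    exact (h1 Z hZ).trans ((h Z hZ).trans (h2 Z hZ).symm)

variable [FiniteDimensional ℝ E]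

/-- The second fundamental form of an integral manifold of `D^⊥` in terms of that of `f`. The normal
space of the integral manifold in `M` is `D = JD`, so it suffices to test against `J Y`, `Y ∈ D`. -/
lemma IsCRSubmanifold.secondFundamentalForm_eq_zero_iff (hD : IsCRSubmanifold J g f D)
    (hg : IsRiemannian g) (hJ : IsAlmostHermitian J g) (hl : IsLCKWithLeeForm J g lee)
    {E' : Type*} [NormedAddCommGroup E'] [NormedSpace ℝ E'] [FiniteDimensional ℝ E']
    {L : Type*} [TopologicalSpace L] [ChartedSpace E' L] [IsManifold 𝓘(ℝ, E') ∞ L]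
    {ι : L → M} (hι : ContMDiff 𝓘(ℝ, E') 𝓘(ℝ, E) ∞ ι)
    (htan : ∀ q, LinearMap.range (dmap E' E ι q) = orthDistribution (inducedMetric g f) D (ι q))
    {q : L} (v w : TangentSpace 𝓘(ℝ, E') q) :
    secondFundamentalForm (inducedMetric (E := E) g f) ι q v w = 0 ↔ ∀ Y ∈ D (ι q),
      antiLee J lee (f (ι q)) (dmap E F f (ι q) Y) *
        inducedMetric g f (ι q) (dmap E' E ι q v) (dmap E' E ι q w) =
      2 * g (f (ι q)) (secondFundamentalForm g f (ι q) (dmap E' E ι q v) Y)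
        (J (f (ι q)) (dmap E F f (ι q) (dmap E' E ι q w))) := by
  have hgM := hg.induced hD.isSmoothImmersion
  have htan' : ∀ q v, dmap E' E ι q v ∈ orthDistribution (inducedMetric g f) D (ι q) :=
    fun q v => (htan q).le (LinearMap.mem_range_self _ v)
  have hn : normalSpace E' (inducedMetric g f) ι q = D (ι q) := by
    rw [normalSpace, htan, hgM.orthDistribution_orthogonal]
  rw [secondFundamentalForm, orthProj_eq_zero_iff (hgM.symm _) (hgM.pos _), hn]
  constructor
  · intro h Y hY
    obtain ⟨u, hu, hu'⟩ := hD.exists_J_eq hY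
    have h1 := hD.inducedMetric_covAlong_leaf hg hJ hl hι htan' v w hY hu hu'
    rw [hgM.symm, h u hu] at h1
    linarith
  · intro h u hu
    obtain ⟨y, hy, hy'⟩ := hD.exists_J_eq hu
    have hYu : dmap E F f (ι q) u = J (f (ι q)) (dmap E F f (ι q) (-y)) := by
      rw [map_neg, map_neg, hy', hJ.sq, neg_neg]
    have h1 := hD.inducedMetric_covAlong_leaf hg hJ hl hι htan' v w ((D _).neg_mem hy) hu hYu
    have h2 := h _ ((D _).neg_mem hy)
    rw [hgM.symm, h1]
    linarith

end Leaves

/-! ### The fundamental form of the local Kähler metric -/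

section TwoForm
variable {E : Type*} [NormedAddCommGroup E] [NormedSpace ℝ E]
  {F : Type*} [NormedAddCommGroup F] [NormedSpace ℝ F] [FiniteDimensional ℝ F]
  {N : Type*} [TopologicalSpace N] [ChartedSpace F N] [IsManifold 𝓘(ℝ, F) ∞ N]
  {J : Π x : N, TangentSpace 𝓘(ℝ, F) x →L[ℝ] TangentSpace 𝓘(ℝ, F) x}
  {g : BilinField F N} {lee : Π x : N, TangentSpace 𝓘(ℝ, F) x →L[ℝ] ℝ}

lemma contDiffAt_real_smul {H : Type*} [NormedAddCommGroup H] [NormedSpace ℝ H] {a : E → ℝ}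
    {u : E → H} {z : E} (ha : ContDiffAt ℝ ∞ a z) (hu : ContDiffAt ℝ ∞ u z) :
    ContDiffAt ℝ ∞ (fun z => a z • u z) z := ha.smul hu

@[simp] lemma tcoord_model (x y : E) (v : TangentSpace 𝓘(ℝ, E) y) : tcoord x y v = v := by
  have h : fderivWithin ℝ (((chartAt E x).extend 𝓘(ℝ, E)) ∘ ((chartAt E y).extend 𝓘(ℝ, E)).symm)
      (Set.range 𝓘(ℝ, E)) ((chartAt E y).extend 𝓘(ℝ, E) y) = ContinuousLinearMap.id ℝ E := by
    rw [modelWithCornersSelf_coe, Set.range_id, fderivWithin_univ]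
    exact fderiv_id
  exact congr($h v)

lemma extend_model (x y : E) (w : TangentSpace 𝓘(ℝ, E) x) :
    (FiberBundle.extend E w y : E) = w := by
  have h := tcoord_extend (E := E) (x := x) (y := y)
    (by rw [chartAt_self_eq]; trivial) w
  rwa [tcoord_model, tcoord_model] at h

variable [FiniteDimensional ℝ E]

/-- A smooth self-map of `E` with values in a given neighbourhood of `z₀` that is the identity
near `z₀`. -/
lemma exists_contDiff_retraction {z₀ : E} {s : Set E} (hs : s ∈ 𝓝 z₀) :
    ∃ ρ : E → E, ContDiff ℝ ∞ ρ ∧ (∀ z, ρ z ∈ s) ∧ ∀ᶠ z in 𝓝 z₀, ρ z = z := by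
  obtain ⟨ε, hε, hεs⟩ := Metric.mem_nhds_iff.1 hs
  let χ : ContDiffBump z₀ := ⟨ε / 2, ε, by positivity, by linarith⟩
  refine ⟨fun z => z₀ + χ z • (z - z₀), ?_, fun z => hεs ?_, ?_⟩
  · exact contDiff_const.add (χ.contDiff.smul (contDiff_id.sub contDiff_const))
  · rw [Metric.mem_ball, dist_eq_norm, add_sub_cancel_left, norm_smul,
      Real.norm_of_nonneg χ.nonneg]
    by_cases h : dist z z₀ < ε
    · rw [dist_eq_norm] at h
      exact (mul_le_of_le_one_left (norm_nonneg _) χ.le_one).trans_lt h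
    · rw [χ.zero_of_le_dist (not_lt.1 h), zero_mul]
      exact hε
  · filter_upwards [χ.eventuallyEq_one] with z hz
    rw [hz]
    simp

/-- The pull-back by `F₀` of the Kähler form `exp (-φ) g(·, J ·)` is a smooth closed 2-form. -/
lemma exists_closed_twoForm (hg : IsRiemannian g) (hJ : IsAlmostHermitian J g)
    (hl : IsLCKWithLeeForm J g lee) {F₀ : E → N} (hF : ContMDiff 𝓘(ℝ, E) 𝓘(ℝ, F) ∞ F₀) (z₀ : E) :
    ∃ Ω : E → E →L[ℝ] E →L[ℝ] ℝ, (∀ᶠ z in 𝓝 z₀, ContDiffAt ℝ ∞ Ω z) ∧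
      (∀ᶠ z in 𝓝 z₀, ∃ c : ℝ, 0 < c ∧ ∀ a b : TangentSpace 𝓘(ℝ, E) z, Ω z a b =
        c * g (F₀ z) (dmap E F F₀ z a) (J (F₀ z) (dmap E F F₀ z b))) ∧
      ∀ᶠ z in 𝓝 z₀, ∀ a b c,
        fderiv ℝ Ω z a b c + fderiv ℝ Ω z b c a + fderiv ℝ Ω z c a b = 0 := by
  obtain ⟨U, hU, hzU, φ, hφ, hK, hlφ⟩ := hl (F₀ z₀)
  obtain ⟨G, hG, hGe⟩ := hg.smooth (F₀ z₀)
  obtain ⟨Jh, hJs, hJe⟩ := hJ.exists_coord (F₀ z₀)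
  have hcont := hF.continuous.continuousAt (x := z₀)
  have hUz : ∀ᶠ z in 𝓝 z₀, F₀ z ∈ U := hcont.eventually (hU.mem_nhds hzU)
  have hmem := hcont.eventually (chart_source_eventually (E := F) (F₀ z₀))
  have hφs : ∀ᶠ z in 𝓝 z₀, ContMDiffAt 𝓘(ℝ, E) 𝓘(ℝ, ℝ) ∞ (fun z => φ (F₀ z)) z :=
    hUz.mono fun z hz => (hφ.contMDiffAt (hU.mem_nhds hz)).comp z (hF z)
  have hGs : ∀ᶠ z in 𝓝 z₀, ContMDiffAt 𝓘(ℝ, E) 𝓘(ℝ, F →L[ℝ] F →L[ℝ] ℝ) ∞ (fun z => G (F₀ z)) z :=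
    (hcont.eventually hG).mono fun z hz => hz.comp z (hF z)
  have hJs' : ∀ᶠ z in 𝓝 z₀, ContMDiffAt 𝓘(ℝ, E) 𝓘(ℝ, F →L[ℝ] F) ∞ (fun z => Jh (F₀ z)) z :=
    hmem.mono fun z hz =>
      (hJs.contMDiffAt ((chartAt F (F₀ z₀)).open_source.mem_nhds hz)).comp z (hF z)
  let Ω : E → E →L[ℝ] E →L[ℝ] ℝ := fun z => Real.exp (-φ (F₀ z)) •
    (((Jh (F₀ z)).comp (dcoord E F F₀ z₀ z)).precomp ℝ).comp
      ((G (F₀ z)).comp (dcoord E F F₀ z₀ z))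
  have hΩs : ∀ᶠ z in 𝓝 z₀, ContDiffAt ℝ ∞ Ω z := by
    filter_upwards [hφs, hGs, hJs', contMDiffAt_dcoord hF z₀] with z h1 h2 h3 h4
    have h1' := h1.contDiffAt
    have h2' := h2.contDiffAt
    have h3' := h3.contDiffAt
    have h4' := h4.contDiffAt
    have h5 : ContDiffAt ℝ ∞ (fun z => (Jh (F₀ z)).comp (dcoord E F F₀ z₀ z)) z :=
      h3'.clm_comp h4'
    have h6 : ContDiffAt ℝ ∞ (fun z => ((Jh (F₀ z)).comp (dcoord E F F₀ z₀ z)).precomp ℝ) z :=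
      h5.contMDiffAt.clm_precomp.contDiffAt
    have h7 : ContDiffAt ℝ ∞ (fun z => (G (F₀ z)).comp (dcoord E F F₀ z₀ z)) z :=
      h2'.clm_comp h4'
    exact contDiffAt_real_smul h1'.neg.exp (h6.clm_comp h7)
  have hΩe : ∀ᶠ z in 𝓝 z₀, ∀ a b : TangentSpace 𝓘(ℝ, E) z, Ω z a b =
      Real.exp (-φ (F₀ z)) * g (F₀ z) (dmap E F F₀ z a) (J (F₀ z) (dmap E F F₀ z b)) := by
    filter_upwards [hmem, hcont.eventually hGe, eventually_tcoord_dmap hF z₀] with z h1 h2 h3 a b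
    rw [h2, hJe _ h1, h3, h3, tcoord_model, tcoord_model]
    rfl
  refine ⟨Ω, hΩs, hΩe.mono fun z hz => ⟨_, Real.exp_pos _, hz⟩, ?_⟩
  filter_upwards [hΩs, hΩe.eventually_nhds, hUz, hφs] with z h1 h2 h3 h4
  obtain ⟨B, hB⟩ := hg.exists_inner_eq (F₀ z) (lee (F₀ z)).toLinearMap
  have hFz : MDifferentiableAt 𝓘(ℝ, E) 𝓘(ℝ, F) F₀ z := (hF z).mdifferentiableAt (by simp)
  have hfield : ∀ a : E, (fun r => dmap E F F₀ r (FiberBundle.extend E (x := z) a r)) =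
      fun r => dmap E F F₀ r a := fun a => by
    funext r
    exact congrArg (dmap E F F₀ r) (extend_model z r a)
  have hd : ∀ a : E, MDifferentiableAt 𝓘(ℝ, E) 𝓘(ℝ, F)
      (fun r => tcoord (F₀ z) (F₀ r) (dmap E F F₀ r a)) z := fun a => by
    have := (mvfderiv_tcoord_dmap hF (ι := fun r : E => r) mdifferentiableAt_id
      (mdifferentiableAt_field_iff.1 (mdifferentiableAt_extend (x := z) a))).1
    exact this.congr_of_eventuallyEq (Filter.Eventually.of_forall fun r => congrArg
      (fun t => tcoord (F₀ z) (F₀ r) (dmap E F F₀ r t)) (extend_model z r a).symm)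
  set S : E → E → TangentSpace 𝓘(ℝ, F) (F₀ z) := fun c a =>
    covAlong g F₀ (fun r => dmap E F F₀ r a) z c with hS
  have hSs : ∀ c a, S c a = S a c := by
    intro c a
    have := hg.covAlong_dmap_extend_symm hF (p := z) c a
    rw [hfield, hfield] at this
    exact this
  have hder : ∀ c a b : E, fderiv ℝ Ω z c a b = Real.exp (-φ (F₀ z)) *
      (g (F₀ z) (S c a) (J (F₀ z) (dmap E F F₀ z b)) + g (F₀ z) (dmap E F F₀ z a)
        (J (F₀ z) (S c b) + leeDefect J g lee (F₀ z) B (dmap E F F₀ z c) (dmap E F F₀ z b)) -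
        lee (F₀ z) (dmap E F F₀ z c) *
          g (F₀ z) (dmap E F F₀ z a) (J (F₀ z) (dmap E F F₀ z b))) := by
    intro c a b
    obtain ⟨hJV, hJVc⟩ := hl.covAlong_J hg hJ hFz hB (hd b)
    have e1 : (fun r => Ω r a b) =ᶠ[𝓝 z] fun r => Real.exp (-φ (F₀ r)) *
        g (F₀ r) (dmap E F F₀ r a) (J (F₀ r) (dmap E F F₀ r b)) := h2.mono fun r hr => hr a b
    have hφm : MDifferentiableAt 𝓘(ℝ, E) 𝓘(ℝ, ℝ) (fun r => φ (F₀ r)) z :=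
      h4.mdifferentiableAt (by simp)
    have e2 := mvfderiv_exp_neg_mul (hg.mvfderiv_inner hFz (hd a) hJV).1 hφm c
    have e3 := mvfderiv_comp_mfderiv (u := φ) ((hφ.contMDiffAt
      (hU.mem_nhds h3)).mdifferentiableAt (by simp)) hFz c
    have e4 := (hg.mvfderiv_inner_covAlong hFz (hd a) hJV c).trans (congrArg
      (fun t => _ + g (F₀ z) (dmap E F F₀ z a) t) (hJVc c))
    rw [e3, e4, ← hlφ _ h3] at e2
    have e5 : fderiv ℝ Ω z c a b = mvfderiv 𝓘(ℝ, E) (fun r => Ω r a b) z c := by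
      have hd1 : HasFDerivAt (fun r => Ω r a b) _ z :=
        ((h1.differentiableAt (by simp)).hasFDerivAt.clm_apply (hasFDerivAt_const a z)).clm_apply
          (hasFDerivAt_const b z)
      have e6 : mvfderiv 𝓘(ℝ, E) (fun r => Ω r a b) z = fderiv ℝ (fun r => Ω r a b) z :=
        mfderiv_eq_fderiv
      rw [e6, hd1.fderiv]
      simp only [ContinuousLinearMap.comp_zero, zero_add]
      rfl
    exact e5.trans ((mvfderiv_congr e1 c).trans e2)
  have hsk : ∀ a b, g (F₀ z) a (J (F₀ z) b) = -g (F₀ z) b (J (F₀ z) a) := fun a b => by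
    rw [hg.symm, hJ.skew]
  have hdef : ∀ a c b, g (F₀ z) a (leeDefect J g lee (F₀ z) B c b) = (1 / 2) *
      (lee (F₀ z) (J (F₀ z) b) * g (F₀ z) a c - lee (F₀ z) b * g (F₀ z) a (J (F₀ z) c) -
      g (F₀ z) c b * lee (F₀ z) (J (F₀ z) a) - g (F₀ z) c (J (F₀ z) b) * lee (F₀ z) a) := by
    intro a c b
    have e1 : g (F₀ z) a B = lee (F₀ z) a := by
      rw [hg.symm, hB]; rfl
    have e2 : g (F₀ z) a (J (F₀ z) B) = -lee (F₀ z) (J (F₀ z) a) := by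
      rw [hg.symm, hJ.skew, hB]; rfl
    rw [leeDefect]
    simp only [map_smul, map_add, map_sub, smul_eq_mul, e1, e2]
    ring
  -- the cyclic sum vanishes by the symmetries of `g`, `J` and the second derivatives
  have hcyc : ∀ a b c sab sbc sca : TangentSpace 𝓘(ℝ, F) (F₀ z),
      (g (F₀ z) sab (J (F₀ z) c) + g (F₀ z) b (J (F₀ z) sca + leeDefect J g lee (F₀ z) B a c) -
        lee (F₀ z) a * g (F₀ z) b (J (F₀ z) c)) +
      (g (F₀ z) sbc (J (F₀ z) a) + g (F₀ z) c (J (F₀ z) sab + leeDefect J g lee (F₀ z) B b a) -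
        lee (F₀ z) b * g (F₀ z) c (J (F₀ z) a)) +
      (g (F₀ z) sca (J (F₀ z) b) + g (F₀ z) a (J (F₀ z) sbc + leeDefect J g lee (F₀ z) B c b) -
        lee (F₀ z) c * g (F₀ z) a (J (F₀ z) b)) = 0 := by
    intro a b c sab sbc sca
    simp only [map_add (g (F₀ z) _), hdef]
    rw [hsk b sca, hsk c sab, hsk a sbc, hsk c b, hsk b a, hsk c a, hg.symm _ c b,
      hg.symm _ b a]
    ring
  intro a b c
  rw [hder, hder, hder, ← mul_add, ← mul_add, hSs a c, hSs b a, hSs c b]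
  exact mul_eq_zero_of_right _ (hcyc _ _ _ _ _ _)

end TwoForm

/-! ### Plaques of a distribution -/

section Plaques
variable {E : Type*} [NormedAddCommGroup E] [NormedSpace ℝ E]
  {M : Type*} [TopologicalSpace M] [ChartedSpace E M] [IsManifold 𝓘(ℝ, E) ∞ M]
  {F : Type*} [NormedAddCommGroup F] [NormedSpace ℝ F]
  {N : Type*} [TopologicalSpace N] [ChartedSpace F N] [IsManifold 𝓘(ℝ, F) ∞ N]
  {J : Π x : N, TangentSpace 𝓘(ℝ, F) x →L[ℝ] TangentSpace 𝓘(ℝ, F) x}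
  {g : BilinField F N} {lee : Π x : N, TangentSpace 𝓘(ℝ, F) x →L[ℝ] ℝ}
  {f : M → N} {D : Distribution E M}
  {H : Type*} [NormedAddCommGroup H] [NormedSpace ℝ H]

/-- A plaque of the distribution `𝒟`: an integral manifold `ψ` of `𝒟`, defined on the open set `B`
of the model space `H`, with a smooth left inverse `P` on the neighbourhood `W` of its image. The
last condition says that a map tangent to `𝒟` with a value on the plaque stays on it nearby; it
makes the plaque unique as a germ at each of its points, and makes overlaps of plaques open. -/
structure IsPlaque (𝒟 : Distribution E M) (B : Set H) (ψ : H → M) (P : M → H)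
    (W : Set M) : Prop where
  isOpen_source : IsOpen B
  isOpen_nhd : IsOpen W
  contMDiffOn_param : ContMDiffOn 𝓘(ℝ, H) 𝓘(ℝ, E) ∞ ψ B
  contMDiffOn_proj : ContMDiffOn 𝓘(ℝ, E) 𝓘(ℝ, H) ∞ P W
  mapsTo : Set.MapsTo ψ B W
  left_inv : ∀ x ∈ B, P (ψ x) = x
  range_dmap : ∀ x ∈ B, LinearMap.range (dmap H E ψ x) = 𝒟 (ψ x)
  eventually_mem : ∀ (u : H → M) (e₀ : H), (∀ᶠ e in 𝓝 e₀, ContMDiffAt 𝓘(ℝ, H) 𝓘(ℝ, E) ∞ u e ∧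
    ∀ v, dmap H E u e v ∈ 𝒟 (u e)) → u e₀ ∈ ψ '' B → ∀ᶠ e in 𝓝 e₀, u e ∈ ψ '' B

/-- The differential of a map `u : H → M` read in the chart at `p`. -/
lemma tcoord_dmap_eq_fderiv {u : H → M} {e : H} {p : M}
    (hu : MDifferentiableAt 𝓘(ℝ, H) 𝓘(ℝ, E) u e) (hp : u e ∈ (chartAt E p).source) (v : H) :
    tcoord p (u e) (dmap H E u e v) = fderiv ℝ (fun e => extChartAt 𝓘(ℝ, E) p (u e)) e v := by
  have h := mvfderiv_comp_mfderiv (mdifferentiableAt_extChartAt (I := 𝓘(ℝ, E)) hp) hu v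
  rw [mvfderiv_extChartAt hp] at h
  have h2 : mvfderiv 𝓘(ℝ, H) (fun e => extChartAt 𝓘(ℝ, E) p (u e)) e =
    fderiv ℝ (fun e => extChartAt 𝓘(ℝ, E) p (u e)) e := mfderiv_eq_fderiv
  rw [h2] at h
  exact h.symm

/-- The Frobenius theorem for a distribution that is in a chart the kernel of a closed 2-form of
constant nullity. -/
lemma exists_isPlaque_of_twoForm [FiniteDimensional ℝ E] [FiniteDimensional ℝ H]
    {𝒟 : Distribution E M} {p : M} {Ω : E → E →L[ℝ] E →L[ℝ] ℝ}
    (hΩ : ∀ᶠ z in 𝓝 (extChartAt 𝓘(ℝ, E) p p), ContDiffAt ℝ ∞ Ω z)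
    (hskew : ∀ᶠ z in 𝓝 (extChartAt 𝓘(ℝ, E) p p), ∀ a b, Ω z a b = -Ω z b a)
    (hclosed : ∀ᶠ z in 𝓝 (extChartAt 𝓘(ℝ, E) p p), ∀ a b c,
      fderiv ℝ Ω z a b c + fderiv ℝ Ω z b c a + fderiv ℝ Ω z c a b = 0)
    (hker : ∀ᶠ q in 𝓝 p, ∀ v, Ω (extChartAt 𝓘(ℝ, E) p q) (tcoord p q v) = 0 ↔ v ∈ 𝒟 q)
    (hk : ∀ᶠ q in 𝓝 p, Module.finrank ℝ (𝒟 q) = Module.finrank ℝ H) :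
    ∃ (B : Set H) (ψ : H → M) (P : M → H) (W : Set M), IsPlaque 𝒟 B ψ P W ∧ p ∈ ψ '' B := by
  set φ := extChartAt 𝓘(ℝ, E) p with hφ
  have hsymm : Filter.Tendsto φ.symm (𝓝 (φ p)) (𝓝 p) := by
    have := continuousAt_extChartAt_symm (I := 𝓘(ℝ, E)) p
    rwa [ContinuousAt, extChartAt_to_inv] at this
  have hsrc : ∀ q, q ∈ φ.source ↔ q ∈ (chartAt E p).source := fun q => by simp [hφ]
  have htgt : φ.target ∈ 𝓝 (φ p) := extChartAt_target_mem_nhds p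
  have hk' : ∀ᶠ z in 𝓝 (φ p),
      Module.finrank ℝ (LinearMap.ker (Ω z).toLinearMap) = Module.finrank ℝ H := by
    filter_upwards [hsymm.eventually hker, hsymm.eventually hk, htgt] with z h1 h2 h3
    have hz : φ (φ.symm z) = z := φ.right_inv h3
    have hinj := tcoord_injective (E := E) ((hsrc _).1 (φ.map_target h3))
    rw [hz] at h1
    let T : E →ₗ[ℝ] E := (tcoord (E := E) p (φ.symm z)).toLinearMap
    have hsurj : Function.Surjective T := LinearMap.injective_iff_surjective.1 hinj
    have : LinearMap.ker (Ω z).toLinearMap =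
        (𝒟 (φ.symm z)).map (tcoord (E := E) p (φ.symm z)).toLinearMap := by
      ext a
      constructor
      · intro ha
        obtain ⟨v, rfl⟩ := hsurj a
        exact ⟨v, (h1 v).1 ha, rfl⟩
      · rintro ⟨v, hv, rfl⟩
        exact (h1 v).2 hv
    rw [this, ← h2]
    exact (Submodule.equivMapOfInjective _ hinj _).finrank_eq.symm
  obtain ⟨P, r, ψ, W, hr, hW, hpW, hWO, hψp, hψs, hψW, hPψ, hψr, huniq⟩ :=
    exists_plaque (K := H) hΩ hskew hclosed hk'
      (Filter.inter_mem htgt (hsymm.eventually hker))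
  have hcφ : ContinuousOn φ φ.source := continuousOn_extChartAt p
  have hWt : ∀ x ∈ Metric.ball (P (φ p)) r, ψ x ∈ φ.target := fun x hx => (hWO (hψW hx)).1
  have hsm : ∀ x ∈ Metric.ball (P (φ p)) r,
      ContMDiffAt 𝓘(ℝ, H) 𝓘(ℝ, E) ∞ (fun x => φ.symm (ψ x)) x := by
    intro x hx
    have h1 : ContMDiffAt 𝓘(ℝ, E) 𝓘(ℝ, E) ∞ φ.symm (ψ x) :=
      (contMDiffOn_extChartAt_symm p).contMDiffAt
        ((isOpen_extChartAt_target p).mem_nhds (hWt x hx))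
    exact h1.comp x ((hψs.contDiffAt (Metric.isOpen_ball.mem_nhds hx)).contMDiffAt)
  have hWopen : IsOpen (φ.source ∩ φ ⁻¹' (W ∩ P ⁻¹' Metric.ball (P (φ p)) r)) :=
    hcφ.isOpen_inter_preimage (isOpen_extChartAt_source p)
      (hW.inter (Metric.isOpen_ball.preimage P.continuous))
  refine ⟨Metric.ball (P (φ p)) r, fun x => φ.symm (ψ x), fun q => P (φ q),
    φ.source ∩ φ ⁻¹' (W ∩ P ⁻¹' Metric.ball (P (φ p)) r), ⟨Metric.isOpen_ball, hWopen, fun x hx =>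
      (hsm x hx).contMDiffWithinAt, ?_, ?_, ?_, ?_, ?_⟩, ?_⟩
  · intro q hq
    have h1 : ContMDiffAt 𝓘(ℝ, E) 𝓘(ℝ, E) ∞ φ q := contMDiffAt_extChartAt' ((hsrc q).1 hq.1)
    exact (P.contDiff.contMDiff.contMDiffAt.comp q h1).contMDiffWithinAt
  · intro x hx
    refine ⟨φ.map_target (hWt x hx), ?_⟩
    simp only [Set.mem_preimage, φ.right_inv (hWt x hx)]
    refine ⟨hψW hx, ?_⟩
    rw [Set.mem_preimage, hPψ x hx]
    exact hx
  · intro x hx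
    simp only [φ.right_inv (hWt x hx)]
    exact hPψ x hx
  · intro x hx
    have hq := (hsrc _).1 (φ.map_target (hWt x hx))
    have h1 : ∀ v, Ω (φ (φ.symm (ψ x))) (tcoord p (φ.symm (ψ x)) v) = 0 ↔ v ∈ 𝒟 (φ.symm (ψ x)) :=
      (hWO (hψW hx)).2
    rw [φ.right_inv (hWt x hx)] at h1
    have h2 : (fun x => φ (φ.symm (ψ x))) =ᶠ[𝓝 x] ψ := by
      filter_upwards [Metric.isOpen_ball.mem_nhds hx] with y hy
      exact φ.right_inv (hWt y hy)
    have h3 := fun v => tcoord_dmap_eq_fderiv ((hsm x hx).mdifferentiableAt (by simp)) hq v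
    rw [← hφ, h2.fderiv_eq] at h3
    ext v
    rw [← h1, hψr x hx]
    constructor
    · rintro ⟨w, rfl⟩
      exact ⟨w, (h3 w).symm⟩
    · rintro ⟨w, hw⟩
      exact ⟨w, tcoord_injective hq ((h3 w).trans hw)⟩
  · rintro u e₀ hu ⟨x₀, hx₀, hx₀'⟩
    have hu₀W : u e₀ ∈ φ.source ∩ φ ⁻¹' (W ∩ P ⁻¹' Metric.ball (P (φ p)) r) := by
      rw [← hx₀']
      refine ⟨φ.map_target (hWt x₀ hx₀), ?_⟩
      simp only [Set.mem_preimage, φ.right_inv (hWt x₀ hx₀)]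
      refine ⟨hψW hx₀, ?_⟩
      rw [Set.mem_preimage, hPψ x₀ hx₀]
      exact hx₀
    have hu₀ : φ (u e₀) = ψ (P (φ (u e₀))) := by
      rw [← hx₀', φ.right_inv (hWt x₀ hx₀), hPψ x₀ hx₀]
    have hev := hu.and (hu.self_of_nhds.1.continuousAt.eventually (hWopen.mem_nhds hu₀W))
    obtain ⟨δ, hδ, hball⟩ := Metric.eventually_nhds_iff_ball.1 hev
    filter_upwards [Metric.ball_mem_nhds e₀ hδ] with e he
    -- the straight segment from `e₀` to `e` gives an integral curve
    set γ : ℝ → H := fun t => e₀ + t • (e - e₀) with hγ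
    have hγb : ∀ t ∈ Set.Icc (0 : ℝ) 1, γ t ∈ Metric.ball e₀ δ := by
      intro t ht
      have := (convex_ball e₀ δ).add_smul_sub_mem (Metric.mem_ball_self hδ) he ht
      exact this
    have hus : ∀ t ∈ Set.Icc (0 : ℝ) 1, ContDiffAt ℝ ∞ (fun e => φ (u e)) (γ t) := by
      intro t ht
      obtain ⟨⟨h1, h2⟩, h3⟩ := hball _ (hγb t ht)
      have h4 : ContMDiffAt 𝓘(ℝ, E) 𝓘(ℝ, E) ∞ φ (u (γ t)) :=
        contMDiffAt_extChartAt' ((hsrc _).1 h3.1)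
      exact (h4.comp _ h1).contDiffAt
    have hγd : ∀ t, HasDerivAt γ (e - e₀) t := by
      intro t
      have := ((hasDerivAt_id t).smul_const (e - e₀)).const_add e₀
      rw [one_smul] at this
      exact this
    have h := huniq (fun t => φ (u (γ t)))
      (fun t => fderiv ℝ (fun e => φ (u e)) (γ t) (e - e₀)) ?_ ?_ ?_
    · have e1 : γ 1 = e := by simp [hγ]
      simp only [e1] at h
      obtain ⟨-, h3⟩ := hball _ he
      refine ⟨P (φ (u e)), h3.2.2, ?_⟩
      simp only [← h]
      exact φ.left_inv h3.1
    · intro t ht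
      have h1 : ContDiffAt ℝ ∞ (fderiv ℝ fun e => φ (u e)) (γ t) :=
        (hus t ht).fderiv_right (by simp)
      exact ((h1.continuousAt.comp (hγd t).continuousAt).clm_apply
        continuousAt_const).continuousWithinAt
    · intro t ht
      obtain ⟨⟨h1, h2⟩, h3⟩ := hball _ (hγb t ht)
      refine ⟨?_, h3.2.1, ?_, h3.2.2⟩
      · exact (((hus t ht).differentiableAt (by simp)).hasFDerivAt.comp_hasDerivAt t
          (hγd t)).hasDerivWithinAt
      · have h4 := (hWO h3.2.1).2
        have h5 : ∀ v, Ω (φ (φ.symm (φ (u (γ t))))) (tcoord p (φ.symm (φ (u (γ t)))) v) = 0 ↔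
          v ∈ 𝒟 (φ.symm (φ (u (γ t)))) := h4
        rw [φ.left_inv h3.1] at h5
        have h6 := tcoord_dmap_eq_fderiv (h1.mdifferentiableAt (by simp)) ((hsrc _).1 h3.1) (e - e₀)
        rw [← hφ] at h6
        rw [← h6]
        exact (h5 _).2 (h2 _)
    · have e0 : γ 0 = e₀ := by simp [hγ]
      simp only [e0]
      exact hu₀
  · refine ⟨P (φ p), Metric.mem_ball_self hr, ?_⟩
    simp only [hψp]
    exact extChartAt_to_inv p

end Plaques

/-! ### Integrability of the totally real distribution -/

section TotallyReal
variable {E : Type*} [NormedAddCommGroup E] [NormedSpace ℝ E] [FiniteDimensional ℝ E]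
  {M : Type*} [TopologicalSpace M] [ChartedSpace E M] [IsManifold 𝓘(ℝ, E) ∞ M]
  {F : Type*} [NormedAddCommGroup F] [NormedSpace ℝ F]
  {N : Type*} [TopologicalSpace N] [ChartedSpace F N] [IsManifold 𝓘(ℝ, F) ∞ N]
  {J : Π x : N, TangentSpace 𝓘(ℝ, F) x →L[ℝ] TangentSpace 𝓘(ℝ, F) x}
  {g : BilinField F N} {lee : Π x : N, TangentSpace 𝓘(ℝ, F) x →L[ℝ] ℝ}
  {f : M → N} {D : Distribution E M}
  {H : Type*} [NormedAddCommGroup H] [NormedSpace ℝ H]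

/-- `D^⊥` is the kernel of the fundamental form `g(·, J ·)` restricted to `M`. -/
lemma IsCRSubmanifold.mem_orthDistribution_iff (hD : IsCRSubmanifold J g f D)
    (hg : IsRiemannian g) (hJ : IsAlmostHermitian J g) {p : M} {v : TangentSpace 𝓘(ℝ, E) p} :
    v ∈ orthDistribution (inducedMetric g f) D p ↔
      ∀ w, g (f p) (dmap E F f p v) (J (f p) (dmap E F f p w)) = 0 := by
  have hgM := hg.induced hD.isSmoothImmersion
  constructor
  · intro hv w
    have hw : w ∈ D p ⊔ (inducedMetric g f p).orthogonal (D p) := by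
      rw [(isCompl_orthogonal_of_pos (hgM.symm p) (hgM.pos p) (D p)).sup_eq_top]; trivial
    obtain ⟨w₁, h₁, w₂, h₂, rfl⟩ := Submodule.mem_sup.1 hw
    obtain ⟨u, hu, hu'⟩ := hD.exists_J_eq h₁
    rw [map_add, map_add, map_add, ← hu', hg.symm]
    have e1 : g (f p) (dmap E F f p u) (dmap E F f p v) = 0 := hv u hu
    have e2 : g (f p) (dmap E F f p v) (J (f p) (dmap E F f p w₂)) = 0 :=
      hD.totally_real p ⟨_, ⟨w₂, h₂, rfl⟩, rfl⟩ _ ⟨v, rfl⟩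
    rw [e1, e2, add_zero]
  · intro h u hu
    obtain ⟨y, hy, hy'⟩ := hD.exists_J_eq hu
    have e1 : inducedMetric g f p u v = - g (f p) (dmap E F f p v) (J (f p) (dmap E F f p y)) := by
      rw [hy', hJ.sq, map_neg, neg_neg, hg.symm]
      rfl
    exact e1.trans (by rw [h, neg_zero])

lemma IsSmoothDistribution.eventually_finrank_orthDistribution (hD : IsSmoothDistribution D)
    {g : BilinField E M} (hg : IsRiemannian g) (p : M) : ∀ᶠ q in 𝓝 p,
    Module.finrank ℝ (orthDistribution g D q) = Module.finrank ℝ (orthDistribution g D p) := by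
  obtain ⟨U, hU, hp, r, X, -, hs⟩ := hD p
  have h : ∀ q ∈ U, Module.finrank ℝ (orthDistribution g D q) = Module.finrank ℝ E - r := by
    intro q hq
    have h1 : Module.finrank ℝ (D q) = r := by
      rw [← (hs q hq).2, finrank_span_eq_card (hs q hq).1, Fintype.card_fin]
    rw [← h1]
    exact LinearMap.BilinForm.finrank_orthogonal (hg.separatingLeft q) (D q)
  filter_upwards [hU.mem_nhds hp] with q hq
  rw [h q hq, h p hp]

/-- Integrability of the totally real distribution: it is locally the kernel of the pull-back of a
closed 2-form, the fundamental form of the local Kähler metric. -/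
theorem IsCRSubmanifold.exists_isPlaque [FiniteDimensional ℝ F] [FiniteDimensional ℝ H]
    (hD : IsCRSubmanifold J g f D) (hg : IsRiemannian g) (hJ : IsAlmostHermitian J g)
    (hl : IsLCKWithLeeForm J g lee) (p : M)
    (hk : Module.finrank ℝ (orthDistribution (inducedMetric g f) D p) = Module.finrank ℝ H) :
    ∃ (B : Set H) (ψ : H → M) (P : M → H) (W : Set M),
      IsPlaque (orthDistribution (inducedMetric g f) D) B ψ P W ∧ p ∈ ψ '' B := by
  have hf := hD.isSmoothImmersion
  have hgM := hg.induced hf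
  set φ := extChartAt 𝓘(ℝ, E) p with hφ
  obtain ⟨ρ, hρ, hρt, hρe⟩ := exists_contDiff_retraction
    (extChartAt_target_mem_nhds (I := 𝓘(ℝ, E)) p)
  have hF₀ : ContMDiff 𝓘(ℝ, E) 𝓘(ℝ, F) ∞ (fun z => f (φ.symm (ρ z))) := by
    intro z
    have h1 : ContMDiffAt 𝓘(ℝ, E) 𝓘(ℝ, E) ∞ φ.symm (ρ z) :=
      (contMDiffOn_extChartAt_symm p).contMDiffAt
        ((isOpen_extChartAt_target p).mem_nhds (hρt z))
    exact (hf.contMDiff _).comp z (h1.comp z hρ.contMDiff.contMDiffAt)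
  obtain ⟨Ω, hΩs, hΩe, hΩc⟩ := exists_closed_twoForm hg hJ hl hF₀ (φ p)
  have hφc : Filter.Tendsto φ (𝓝 p) (𝓝 (φ p)) := continuousAt_extChartAt p
  refine exists_isPlaque_of_twoForm hΩs ?_ hΩc ?_ ?_
  · filter_upwards [hΩe] with z hz a b
    obtain ⟨c, -, h⟩ := hz
    have e1 := h a b
    have e2 := h b a
    rw [hg.symm, hJ.skew] at e1
    linarith
  · have hloc : ∀ᶠ q in 𝓝 p, (fun q => f (φ.symm (ρ (φ q)))) =ᶠ[𝓝 q] f := by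
      have : ∀ᶠ q in 𝓝 p, f (φ.symm (ρ (φ q))) = f q := by
        filter_upwards [hφc.eventually hρe, chart_source_eventually (E := E) p] with q h1 h2
        rw [h1, φ.left_inv (by simpa [hφ] using h2)]
      exact this.eventually_nhds
    have htransport : ∀ (x y : N) (_ : x = y) (a b : F),
        g x (a : TangentSpace 𝓘(ℝ, F) x) (J x b) = g y (a : TangentSpace 𝓘(ℝ, F) y) (J y b) := by
      rintro x _ rfl a b
      rfl
    filter_upwards [hφc.eventually hΩe, hloc, chart_source_eventually (E := E) p] with q h1 h2 h3 v
    obtain ⟨c, hc, hce⟩ := h1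
    -- `Ω` in the chart is the fundamental form on `M` up to a positive factor
    have hd : ∀ w : TangentSpace 𝓘(ℝ, E) q,
        (dmap E F (fun z => f (φ.symm (ρ z))) (φ q) (tcoord (E := E) p q w) : F) =
          dmap E F f q w := by
      intro w
      have e1 := h2.mfderiv_eq (I := 𝓘(ℝ, E)) (I' := 𝓘(ℝ, F))
      have e2 := mfderiv_comp_apply q ((hF₀ (φ q)).mdifferentiableAt (by simp))
        (mdifferentiableAt_extChartAt (I := 𝓘(ℝ, E)) h3) w
      have e3 : mfderiv 𝓘(ℝ, E) 𝓘(ℝ, E) φ q w = tcoord p q w := mvfderiv_extChartAt h3 w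
      rw [e3] at e2
      exact e2.symm.trans congr($e1 w)
    have key : ∀ w : TangentSpace 𝓘(ℝ, E) q, Ω (φ q) (tcoord p q v) (tcoord p q w) =
        c * g (f q) (dmap E F f q v) (J (f q) (dmap E F f q w)) := by
      intro w
      refine (hce _ _).trans (congrArg (c * ·) ?_)
      refine Eq.trans ?_ (htransport _ _ h2.self_of_nhds _ _)
      exact congrArg₂ (fun a b : F => g (f (φ.symm (ρ (φ q)))) a (J (f (φ.symm (ρ (φ q)))) b))
        (hd v) (hd w)
    rw [hD.mem_orthDistribution_iff hg hJ]
    constructor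
    · intro h w
      have := key w
      rw [h] at this
      exact (mul_eq_zero.1 this.symm).resolve_left hc.ne'
    · intro h
      let T : E →ₗ[ℝ] E := (tcoord (E := E) p q).toLinearMap
      have hsurj : Function.Surjective T :=
        LinearMap.injective_iff_surjective.1 (tcoord_injective h3)
      ext b
      obtain ⟨w, rfl⟩ := hsurj b
      exact (key w).trans (by rw [h w, mul_zero]; rfl)
  · exact (hD.smooth.eventually_finrank_orthDistribution hgM p).mono fun q hq => hq.trans hk

end TotallyReal

/-! ### The leaf topology -/

section Leaves
universe u
variable {E : Type*} [NormedAddCommGroup E] [NormedSpace ℝ E]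
  {M : Type u} [TopologicalSpace M] [ChartedSpace E M]
  {H : Type*} [NormedAddCommGroup H] [NormedSpace ℝ H]
  {𝒟 : Distribution E M}

lemma IsPlaque.eventuallyEq_left_inv {B : Set H} {ψ : H → M} {P : M → H} {W : Set M}
    (h : IsPlaque 𝒟 B ψ P W) {x : H} (hx : x ∈ B) : P ∘ ψ =ᶠ[𝓝 x] id := by
  filter_upwards [h.isOpen_source.mem_nhds hx] with y hy using h.left_inv y hy

lemma IsPlaque.contMDiffAt_param {B : Set H} {ψ : H → M} {P : M → H} {W : Set M}
    (h : IsPlaque 𝒟 B ψ P W) {x : H} (hx : x ∈ B) : ContMDiffAt 𝓘(ℝ, H) 𝓘(ℝ, E) ∞ ψ x :=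
  h.contMDiffOn_param.contMDiffAt (h.isOpen_source.mem_nhds hx)

lemma IsPlaque.contMDiffAt_proj {B : Set H} {ψ : H → M} {P : M → H} {W : Set M}
    (h : IsPlaque 𝒟 B ψ P W) {x : H} (hx : x ∈ B) : ContMDiffAt 𝓘(ℝ, E) 𝓘(ℝ, H) ∞ P (ψ x) :=
  h.contMDiffOn_proj.contMDiffAt (h.isOpen_nhd.mem_nhds (h.mapsTo hx))

lemma IsPlaque.injective_dmap {B : Set H} {ψ : H → M} {P : M → H} {W : Set M}
    (h : IsPlaque 𝒟 B ψ P W) {x : H} (hx : x ∈ B) : Function.Injective (dmap H E ψ x) := by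
  have h1 : mfderiv 𝓘(ℝ, H) 𝓘(ℝ, H) (P ∘ ψ) x = ContinuousLinearMap.id ℝ _ :=
    ((h.eventuallyEq_left_inv hx).mfderiv_eq).trans mfderiv_id
  rw [mfderiv_comp x ((h.contMDiffAt_proj hx).mdifferentiableAt (by simp))
    ((h.contMDiffAt_param hx).mdifferentiableAt (by simp))] at h1
  intro v w hvw
  have hv := congrArg (fun A => A v) h1
  have hw := congrArg (fun A => A w) h1
  have hvw' : mfderiv 𝓘(ℝ, H) 𝓘(ℝ, E) ψ x v = mfderiv 𝓘(ℝ, H) 𝓘(ℝ, E) ψ x w := hvw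
  exact hv.symm.trans ((congrArg (mfderiv 𝓘(ℝ, E) 𝓘(ℝ, H) P (ψ x)) hvw').trans hw)

lemma IsPlaque.finrank_eq {B : Set H} {ψ : H → M} {P : M → H} {W : Set M}
    (h : IsPlaque 𝒟 B ψ P W) {x : H} (hx : x ∈ B) :
    Module.finrank ℝ (𝒟 (ψ x)) = Module.finrank ℝ H := by
  rw [← h.range_dmap x hx]
  exact LinearMap.finrank_range_of_inj (h.injective_dmap hx)

/-- Every point at which `𝒟` has the dimension of `H` lies on a plaque modelled on `H`. -/
def HasPlaques (𝒟 : Distribution E M) (H : Type*) [NormedAddCommGroup H] [NormedSpace ℝ H] : Prop :=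
  ∀ p, Module.finrank ℝ (𝒟 p) = Module.finrank ℝ H →
    ∃ (B : Set H) (ψ : H → M) (P : M → H) (W : Set M), IsPlaque 𝒟 B ψ P W ∧ p ∈ ψ '' B

/-- The set of points of `M` at which `𝒟` has the dimension of `H`, a union of leaves. It carries
the leaf topology, in which the plaques are open, and not the topology induced from `M`; hence the
separate type. The existence of plaques is an argument of the type, so that the leaf topology can
be an instance. -/
def LeafSpace (_h : HasPlaques 𝒟 H) : Type u :=
  {p : M // Module.finrank ℝ (𝒟 p) = Module.finrank ℝ H}

variable {h : HasPlaques 𝒟 H}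

/-- The inclusion of the union of leaves in `M`. -/
def LeafSpace.val (q : LeafSpace h) : M := Subtype.val q

lemma LeafSpace.val_injective : Function.Injective (LeafSpace.val (h := h)) :=
  Subtype.val_injective

/-- `e` is the chart of the leaf topology given by a plaque. -/
structure IsPlaqueChart (e : PartialEquiv (LeafSpace h) H) (B : Set H) (ψ : H → M) (P : M → H)
    (W : Set M) : Prop where
  isPlaque : IsPlaque 𝒟 B ψ P W
  mem_source : ∀ q, q ∈ e.source ↔ q.val ∈ ψ '' B
  target : e.target = B
  apply : ∀ q, e q = P q.val
  symm_apply : ∀ x ∈ B, (e.symm x).val = ψ x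

/-- A plaque through `q` gives a chart of the leaf topology at `q`. -/
lemma exists_isPlaqueChart (q : LeafSpace h) :
    ∃ e : PartialEquiv (LeafSpace h) H, q ∈ e.source ∧ ∃ B ψ P W, IsPlaqueChart e B ψ P W := by
  classical
  obtain ⟨B, ψ, P, W, hP, hq⟩ := h q.val q.2
  obtain ⟨inv, hinv⟩ : ∃ inv : H → LeafSpace h, ∀ x ∈ B, (inv x).val = ψ x := by
    refine ⟨fun x => if hx : x ∈ B then ⟨ψ x, hP.finrank_eq hx⟩ else q, fun x hx => ?_⟩
    exact congrArg LeafSpace.val (dif_pos hx)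
  refine ⟨{
    toFun := fun r => P r.val
    invFun := inv
    source := {r | r.val ∈ ψ '' B}
    target := B
    map_source' := ?_
    map_target' := fun x hx => ⟨x, hx, (hinv x hx).symm⟩
    left_inv' := ?_
    right_inv' := fun x hx => (congrArg P (hinv x hx)).trans (hP.left_inv x hx) }, hq,
      B, ψ, P, W, hP, fun _ => Iff.rfl, rfl, fun _ => rfl, hinv⟩
  · rintro r ⟨x, hx, hr⟩
    rw [← hr, hP.left_inv x hx]
    exact hx
  · rintro r ⟨x, hx, hr⟩
    have h1 : P r.val = x := by rw [← hr, hP.left_inv x hx]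
    exact LeafSpace.val_injective ((congrArg (fun y => (inv y).val) h1).trans
      ((hinv x hx).trans hr))

lemma IsPlaqueChart.trans_source {e e' : PartialEquiv (LeafSpace h) H} {B B' : Set H}
    {ψ ψ' : H → M} {P P' : M → H} {W W' : Set M} (he : IsPlaqueChart e B ψ P W)
    (he' : IsPlaqueChart e' B' ψ' P' W') :
    (e.symm.trans e').source = {x | x ∈ B ∧ ψ x ∈ ψ' '' B'} := by
  ext x
  simp only [PartialEquiv.trans_source, PartialEquiv.symm_source, he.target, Set.mem_inter_iff,
    Set.mem_preimage, Set.mem_ofPred_eq, he'.mem_source]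
  refine and_congr_right fun hx => ?_
  rw [he.symm_apply x hx]

lemma IsPlaqueChart.isOpen_trans_source {e e' : PartialEquiv (LeafSpace h) H} {B B' : Set H}
    {ψ ψ' : H → M} {P P' : M → H} {W W' : Set M} (he : IsPlaqueChart e B ψ P W)
    (he' : IsPlaqueChart e' B' ψ' P' W') : IsOpen (e.symm.trans e').source := by
  rw [he.trans_source he', isOpen_iff_mem_nhds]
  rintro x ⟨hx, hx'⟩
  have hB := he.isPlaque.isOpen_source.mem_nhds hx
  have h1 : ∀ᶠ y in 𝓝 x, ContMDiffAt 𝓘(ℝ, H) 𝓘(ℝ, E) ∞ ψ y ∧ ∀ v, dmap H E ψ y v ∈ 𝒟 (ψ y) := by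
    filter_upwards [hB] with y hy
    refine ⟨he.isPlaque.contMDiffAt_param hy, fun v => ?_⟩
    rw [← he.isPlaque.range_dmap y hy]
    exact LinearMap.mem_range_self _ v
  filter_upwards [hB, he'.isPlaque.eventually_mem ψ x h1 hx'] with y hy hy' using ⟨hy, hy'⟩

lemma IsPlaqueChart.contDiffOn_trans {e e' : PartialEquiv (LeafSpace h) H} {B B' : Set H}
    {ψ ψ' : H → M} {P P' : M → H} {W W' : Set M} (he : IsPlaqueChart e B ψ P W)
    (he' : IsPlaqueChart e' B' ψ' P' W') :
    ContDiffOn ℝ ∞ (e.symm.trans e') (e.symm.trans e').source := by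
  rw [← contMDiffOn_iff_contDiffOn, he.trans_source he']
  have h1 : ContMDiffOn 𝓘(ℝ, H) 𝓘(ℝ, H) ∞ (P' ∘ ψ) {x | x ∈ B ∧ ψ x ∈ ψ' '' B'} := by
    refine he'.isPlaque.contMDiffOn_proj.comp
      (he.isPlaque.contMDiffOn_param.mono fun x hx => hx.1) ?_
    rintro x ⟨-, y, hy, hyx⟩
    change ψ x ∈ W'
    rw [← hyx]
    exact he'.isPlaque.mapsTo hy
  refine h1.congr fun x hx => ?_
  rw [PartialEquiv.coe_trans, Function.comp_apply, he'.apply, he.symm_apply x hx.1]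
  rfl

/-- The atlas of plaques of the union of leaves. -/
def leafCore (h : HasPlaques 𝒟 H) : ChartedSpaceCore H (LeafSpace h) where
  atlas := {e | ∃ B ψ P W, IsPlaqueChart e B ψ P W}
  chartAt q := (exists_isPlaqueChart q).choose
  mem_chart_source q := (exists_isPlaqueChart q).choose_spec.1
  chart_mem_atlas q := (exists_isPlaqueChart q).choose_spec.2
  open_source := by
    rintro e e' ⟨B, ψ, P, W, he⟩ ⟨B', ψ', P', W', he'⟩
    exact he.isOpen_trans_source he'
  continuousOn_toFun := by
    rintro e e' ⟨B, ψ, P, W, he⟩ ⟨B', ψ', P', W', he'⟩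
    exact (he.contDiffOn_trans he').continuousOn

instance : TopologicalSpace (LeafSpace h) := (leafCore h).toTopologicalSpace

instance : ChartedSpace H (LeafSpace h) := (leafCore h).toChartedSpace

lemma exists_isPlaqueChart_of_mem_atlas {e : OpenPartialHomeomorph (LeafSpace h) H}
    (he : e ∈ atlas H (LeafSpace h)) : ∃ B ψ P W, IsPlaqueChart e.toPartialEquiv B ψ P W := by
  change e ∈ ⋃ (e : PartialEquiv (LeafSpace h) H) (he : e ∈ (leafCore h).atlas),
    {(leafCore h).openPartialHomeomorph e he} at he
  simp only [Set.mem_iUnion, Set.mem_singleton_iff] at he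
  obtain ⟨e', he', rfl⟩ := he
  exact he'

instance : IsManifold 𝓘(ℝ, H) ∞ (LeafSpace h) := by
  refine isManifold_of_contDiffOn _ _ _ fun e e' he he' => ?_
  obtain ⟨B, ψ, P, W, hc⟩ := exists_isPlaqueChart_of_mem_atlas he
  obtain ⟨B', ψ', P', W', hc'⟩ := exists_isPlaqueChart_of_mem_atlas he'
  simpa using hc.contDiffOn_trans hc'

lemma LeafSpace.exists_param (q : LeafSpace h) : ∃ B ψ P W,
    IsPlaqueChart (chartAt H q).toPartialEquiv B ψ P W :=
  exists_isPlaqueChart_of_mem_atlas (chart_mem_atlas H q)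

/-- A map into `M` that is tangent to `𝒟` is continuous for the leaf topology. -/
lemma continuous_leafSpace_lift {L : Type*} [TopologicalSpace L] [ChartedSpace H L]
    [IsManifold 𝓘(ℝ, H) ∞ L] {j : L → LeafSpace h}
    (hj : ContMDiff 𝓘(ℝ, H) 𝓘(ℝ, E) ∞ fun b => (j b).val)
    (ht : ∀ b v, dmap H E (fun b => (j b).val) b v ∈ 𝒟 (j b).val) : Continuous j := by
  rw [continuous_iff_continuousAt]
  intro b
  obtain ⟨B, ψ, P, W, hc⟩ := LeafSpace.exists_param (j b)
  set c := extChartAt 𝓘(ℝ, H) b with hcdef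
  have hb : (j b).val ∈ ψ '' B := (hc.mem_source _).1 (mem_chart_source H (j b))
  have hcb : c.symm (c b) = b := extChartAt_to_inv b
  have htgt : c.target ∈ 𝓝 (c b) := extChartAt_target_mem_nhds b
  have h1 : ∀ᶠ e in 𝓝 (c b),
      ContMDiffAt 𝓘(ℝ, H) 𝓘(ℝ, E) ∞ (fun e => (j (c.symm e)).val) e ∧
      ∀ v, dmap H E (fun e => (j (c.symm e)).val) e v ∈ 𝒟 (j (c.symm e)).val := by
    filter_upwards [eventually_mem_nhds_iff.2 htgt] with e he
    have hs : ContMDiffAt 𝓘(ℝ, H) 𝓘(ℝ, H) ∞ c.symm e :=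
      (contMDiffOn_extChartAt_symm b).contMDiffAt he
    refine ⟨hj.contMDiffAt.comp e hs, fun v => ?_⟩
    have h2 : mfderiv 𝓘(ℝ, H) 𝓘(ℝ, E) (fun e => (j (c.symm e)).val) e =
        (mfderiv 𝓘(ℝ, H) 𝓘(ℝ, E) (fun b => (j b).val) (c.symm e)).comp
          (mfderiv 𝓘(ℝ, H) 𝓘(ℝ, H) c.symm e) :=
      mfderiv_comp e (hj.contMDiffAt.mdifferentiableAt (by simp)) (hs.mdifferentiableAt (by simp))
    have h3 : dmap H E (fun e => (j (c.symm e)).val) e v =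
        dmap H E (fun b => (j b).val) (c.symm e) (mfderiv 𝓘(ℝ, H) 𝓘(ℝ, H) c.symm e v) :=
      congrArg (fun A => A v) h2
    exact h3 ▸ ht _ _
  have h4 := hc.isPlaque.eventually_mem _ _ h1 (by simpa only [hcb] using hb)
  have h5 : ∀ᶠ a in 𝓝 b, (j a).val ∈ ψ '' B := by
    have := (continuousAt_extChartAt (I := 𝓘(ℝ, H)) b).eventually h4
    filter_upwards [this, extChartAt_source_mem_nhds (I := 𝓘(ℝ, H)) b] with a ha ha'
    simpa only [hcdef, (extChartAt 𝓘(ℝ, H) b).left_inv ha'] using ha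
  have h6 : j ⁻¹' (chartAt H (j b)).source ∈ 𝓝 b := by
    filter_upwards [h5] with a ha using (hc.mem_source _).2 ha
  rw [(chartAt H (j b)).continuousAt_iff_continuousAt_comp_left h6]
  have h7 : (chartAt H (j b)) ∘ j = P ∘ fun a => (j a).val := funext fun a => hc.apply (j a)
  rw [h7]
  obtain ⟨x, hx, hxb⟩ := hb
  refine ContinuousAt.comp ?_ hj.continuous.continuousAt
  rw [← hxb]
  exact (hc.isPlaque.contMDiffAt_proj hx).continuousAt

/-- The leaf through a point: its connected component for the leaf topology, as an open subset of
the union of leaves. -/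
def leaf (q : LeafSpace h) : TopologicalSpace.Opens (LeafSpace h) where
  carrier := connectedComponent q
  is_open' := by
    have := ChartedSpace.locallyConnectedSpace H (LeafSpace h)
    exact isOpen_connectedComponent

/-- A map that is near `r` a plaque composed with the chart at `r` is an immersion with tangent
space `𝒟` at `r`. -/
lemma IsPlaque.tangent_of_eventuallyEq {X : Type*} [TopologicalSpace X] [ChartedSpace H X]
    [IsManifold 𝓘(ℝ, H) ∞ X] {B : Set H} {ψ : H → M} {P : M → H} {W : Set M}
    (hP : IsPlaque 𝒟 B ψ P W) {ι : X → M} {r : X} (hr : extChartAt 𝓘(ℝ, H) r r ∈ B)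
    (hι : ι =ᶠ[𝓝 r] ψ ∘ extChartAt 𝓘(ℝ, H) r) :
    ContMDiffAt 𝓘(ℝ, H) 𝓘(ℝ, E) ∞ ι r ∧ Function.Injective (dmap H E ι r) ∧
      LinearMap.range (dmap H E ι r) = 𝒟 (ι r) := by
  have hc : ContMDiffAt 𝓘(ℝ, H) 𝓘(ℝ, H) ∞ (extChartAt 𝓘(ℝ, H) r) r := contMDiffAt_extChartAt
  have hψ := hP.contMDiffAt_param hr
  obtain ⟨A, hA⟩ := isInvertible_mfderiv_extChartAt (I := 𝓘(ℝ, H)) (mem_extChartAt_source r)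
  have hd : ∀ v : H, (dmap H E ι r v : E) = dmap H E ψ (extChartAt 𝓘(ℝ, H) r r) (A v) := fun v =>
    (congrArg (fun A : H →L[ℝ] E => A v) (hι.mfderiv_eq.trans
      (mfderiv_comp r (hψ.mdifferentiableAt (by simp)) (hc.mdifferentiableAt (by simp))))).trans
      (congrArg (fun A : H →L[ℝ] H => dmap H E ψ (extChartAt 𝓘(ℝ, H) r r) (A v)) hA.symm)
  refine ⟨(hψ.comp r hc).congr_of_eventuallyEq hι, fun v w hvw => ?_, ?_⟩
  · exact A.injective (hP.injective_dmap hr ((hd v).symm.trans (Eq.trans hvw (hd w))))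
  · have h1 := hP.range_dmap _ hr
    have h2 : ψ (extChartAt 𝓘(ℝ, H) r r) = ι r := hι.self_of_nhds.symm
    have h3 : ∀ y, ψ (extChartAt 𝓘(ℝ, H) r r) = y → ∀ v : E,
        v ∈ LinearMap.range (dmap H E ψ (extChartAt 𝓘(ℝ, H) r r)) ↔ v ∈ 𝒟 y := by
      rintro _ rfl v
      rw [h1]
    ext v
    refine Iff.trans ?_ (h3 _ h2 v)
    constructor
    · rintro ⟨w, rfl⟩
      exact ⟨_, (hd w).symm⟩
    · rintro ⟨w, rfl⟩
      exact ⟨A.symm w, (hd _).trans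
        (congrArg (dmap H E ψ (extChartAt 𝓘(ℝ, H) r r)) (A.apply_symm_apply w))⟩

/-- The inclusion of a leaf is a smooth immersion with tangent spaces `𝒟`. -/
lemma LeafSpace.tangent (q : LeafSpace h) (r : leaf q) :
    ContMDiffAt 𝓘(ℝ, H) 𝓘(ℝ, E) ∞ (fun r : leaf q => r.1.val) r ∧
      Function.Injective (dmap H E (fun r : leaf q => r.1.val) r) ∧
      LinearMap.range (dmap H E (fun r : leaf q => r.1.val) r) = 𝒟 r.1.val := by
  obtain ⟨B, ψ, P, W, hc⟩ := LeafSpace.exists_param r.1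
  have h1 : ∀ s : leaf q, extChartAt 𝓘(ℝ, H) r s = P s.1.val := fun s => hc.apply s.1
  have h2 : ∀ s : LeafSpace h, s.val ∈ ψ '' B → P s.val ∈ B ∧ s.val = ψ (P s.val) := by
    rintro s ⟨x, hx, hs⟩
    rw [← hs, hc.isPlaque.left_inv x hx]
    exact ⟨hx, rfl⟩
  have h3 : ∀ᶠ s : leaf q in 𝓝 r, s.1.val ∈ ψ '' B := by
    have : ∀ᶠ s : LeafSpace h in 𝓝 r.1, s.val ∈ ψ '' B := by
      filter_upwards [(chartAt H r.1).open_source.mem_nhds (mem_chart_source H r.1)] with s hs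
        using (hc.mem_source s).1 hs
    exact continuous_subtype_val.continuousAt.eventually this
  refine hc.isPlaque.tangent_of_eventuallyEq ?_ ?_
  · rw [h1]
    exact (h2 r.1 h3.self_of_nhds).1
  · filter_upwards [h3] with s hs
    exact ((h2 s.1 hs).2).trans (congrArg ψ (h1 s).symm)

end Leaves

section Leaves
universe u
variable {E : Type*} [NormedAddCommGroup E] [NormedSpace ℝ E]
  {M : Type u} [TopologicalSpace M] [ChartedSpace E M] {𝒟 : Distribution E M}

/-- If plaques of dimension `k` exist, there is a leaf through every point where `𝒟` has
dimension `k`. -/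
lemma exists_isLeaf {k : ℕ} (h : HasPlaques 𝒟 (EuclideanSpace ℝ (Fin k))) {p : M}
    (hp : Module.finrank ℝ (𝒟 p) = k) :
    ∃ (L : Type u) (_ : TopologicalSpace L) (_ : ChartedSpace (EuclideanSpace ℝ (Fin k)) L)
      (_ : IsManifold (𝓡 k) ∞ L) (ι : L → M), IsLeaf 𝒟 k ι ∧ p ∈ Set.range ι := by
  set H := EuclideanSpace ℝ (Fin k)
  have hk : Module.finrank ℝ H = k := by simp [H]
  let q : LeafSpace h := ⟨p, hp.trans hk.symm⟩
  refine ⟨leaf q, inferInstance, inferInstance, inferInstance, fun r => r.1.val,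
    ⟨⟨⟨fun r => (LeafSpace.tangent q r).1, fun r => (LeafSpace.tangent q r).2.1⟩,
      fun r s hrs => Subtype.ext (LeafSpace.val_injective hrs),
      fun r => (LeafSpace.tangent q r).2.2⟩, ?_, ?_⟩, ⟨q, mem_connectedComponent⟩, rfl⟩
  · exact Subtype.connectedSpace isConnected_connectedComponent
  · rintro L' _ _ _ _ ι' hι' ⟨_, ⟨r, rfl⟩, b, hb⟩
    -- `ι'` lifts to a continuous map to the leaf topology, so its image is connected there
    have hrank : ∀ b, Module.finrank ℝ (𝒟 (ι' b)) = Module.finrank ℝ H := fun b => by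
      rw [← hι'.tangent b]
      exact LinearMap.finrank_range_of_inj (hι'.isSmoothImmersion.injective_mfderiv b)
    let j : L' → LeafSpace h := fun b => ⟨ι' b, hrank b⟩
    have hj : Continuous j := continuous_leafSpace_lift hι'.isSmoothImmersion.contMDiff
      fun b v => (hι'.tangent b).le (LinearMap.mem_range_self _ v)
    have hjb : j b = r.1 := LeafSpace.val_injective hb
    have hsub : Set.range j ⊆ connectedComponent q := by
      have h1 : connectedComponent q = connectedComponent (j b) := by
        rw [hjb]
        exact connectedComponent_eq r.2
      rw [h1]
      exact (isConnected_range hj).isPreconnected.subset_connectedComponent ⟨b, rfl⟩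
    rintro _ ⟨a, rfl⟩
    exact ⟨⟨j a, hsub ⟨a, rfl⟩⟩, rfl⟩

end Leaves

end LCK

end

/-! ### Totally geodesic leaves -/

theorem mainTheorem2 {n m : ℕ}
    {N : Type*} [TopologicalSpace N] [T2Space N]
    [ChartedSpace (EuclideanSpace ℝ (Fin (2 * n))) N] [IsManifold (𝓡 (2 * n)) ∞ N]
    {M : Type*} [TopologicalSpace M] [T2Space M]
    [ChartedSpace (EuclideanSpace ℝ (Fin m)) M] [IsManifold (𝓡 m) ∞ M]
    (g : ContMDiffRiemannianMetric (𝓡 (2 * n)) ∞ (EuclideanSpace ℝ (Fin (2 * n)))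
      (fun x : N => TangentSpace (𝓡 (2 * n)) x))
    (J : ∀ x : N, TangentSpace (𝓡 (2 * n)) x →L[ℝ] TangentSpace (𝓡 (2 * n)) x)
    (hJ : LCK.IsAlmostHermitian J (LCK.ofMetric g))
    (lee : ∀ x : N, TangentSpace (𝓡 (2 * n)) x →L[ℝ] ℝ)
    (hlee : LCK.IsLCKWithLeeForm J (LCK.ofMetric g) lee)
    (f : M → N) (D : LCK.Distribution (EuclideanSpace ℝ (Fin m)) M)
    (hD : LCK.IsCRSubmanifold J (LCK.ofMetric g) f D) :
    LCK.IsTotallyGeodesicFoliation (LCK.inducedMetric (LCK.ofMetric g) f)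
        (LCK.orthDistribution (LCK.inducedMetric (LCK.ofMetric g) f) D) ↔
      ∀ (p : M),
        ∀ X ∈ LCK.orthDistribution (LCK.inducedMetric (LCK.ofMetric g) f) D p,
        ∀ Y ∈ D p,
          LCK.antiLee J lee (f p) (mfderiv (𝓡 m) (𝓡 (2 * n)) f p Y) •
              J (f p) (mfderiv (𝓡 m) (𝓡 (2 * n)) f p X) =
            (2 : ℝ) • LCK.orthProj (LCK.ofMetric g (f p))
              (LCK.mapJ J f p
                (LCK.orthDistribution (LCK.inducedMetric (LCK.ofMetric g) f) D p))
              (LCK.secondFundamentalForm (LCK.ofMetric g) f p X Y) := by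
  have hg := LCK.isRiemannian_ofMetric g
  constructor
  · intro hfol p X hX Y hY
    obtain ⟨L, _, _, _, ι, hL, q, rfl⟩ := LCK.exists_isLeaf
      (𝒟 := LCK.orthDistribution (LCK.inducedMetric (LCK.ofMetric g) f) D)
      (k := Module.finrank ℝ (LCK.orthDistribution (LCK.inducedMetric (LCK.ofMetric g) f) D p))
      (fun p hp => hD.exists_isPlaque hg hJ hlee p hp) (p := p) rfl
    have htan := hL.isIntegralManifold.tangent
    have hX' := hX
    rw [← htan q] at hX'
    obtain ⟨v, rfl⟩ := hX'
    refine (hJ.smul_eq_orthProj_iff hg hX).2 fun Z hZ => ?_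
    rw [← htan q] at hZ
    obtain ⟨w, rfl⟩ := hZ
    exact (hD.secondFundamentalForm_eq_zero_iff hg hJ hlee
      hL.isIntegralManifold.isSmoothImmersion.contMDiff htan v w).1 (hfol _ L ι hL q v w) Y hY
  · intro h k L _ _ _ ι hL q v w
    have htan := hL.isIntegralManifold.tangent
    refine (hD.secondFundamentalForm_eq_zero_iff hg hJ hlee
      hL.isIntegralManifold.isSmoothImmersion.contMDiff htan v w).2 fun Y hY => ?_
    have hmem : ∀ v, LCK.dmap (EuclideanSpace ℝ (Fin k)) (EuclideanSpace ℝ (Fin m)) ι q v ∈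
        LCK.orthDistribution (LCK.inducedMetric (LCK.ofMetric g) f) D (ι q) := fun v =>
      (htan q).le (LinearMap.mem_range_self _ v)
    exact (hJ.smul_eq_orthProj_iff hg (hmem v)).1 (h (ι q) _ (hmem v) Y hY) _ (hmem w)
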